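/- Setting. Let $\Delta$ be a finite ranked signature and $G$ a linear monadic context-free tree grammar over $\Delta$ (nonterminals of rank $0$ or $1$; the variable occurs at most once in a right-hand side), with tree language $\mathbf T=L(G)$. A context is a tree with exactly one hole $X$; heights are normalised so that constants have height $1$ and $X$ has height $0$. Let $\mathrm{yd}$ be a projective yield: each $f$ of rank $n$ has strings $u_0,\dots,u_n$, and $\mathrm{yd}(f(t_1,\dots,t_n))=u_0\,\mathrm{yd}(t_1)\,u_1\cdots \mathrm{yd}(t_n)\,u_n$; the yield of a context is the string generated to the left of the hole followed by the one generated to its right. Let $h$ be a linear nondeleting tree homomorphism into terms of the graph algebra $\mathsf{HR}_k$ of finite edge-labelled multigraphs with $k$ source names (constants, parallel composition, forgetting and renaming of sources), and let $\mathrm{graph}(t)$ be the value of $h(t)$ (for a context, the hole is valued as the empty graph). String tokens are $a,b,c,d$, $\bar a,\bar b,\bar c,\bar d$ and the brackets $\langle,\rangle$. Let $A=\{a\langle^i\bar a^i\rangle^i: i\ge 0\}$, let $B,C,D$ be the analogous languages for $b,c,d$, and $\mathsf{CSD}_s=\bigcup_{n,m\ge1}A^nB^mC^nD^m$. Assume that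 for every $t\in\mathbf T$ the string $\mathrm{yd}(t)$ is in $\mathsf{CSD}_s$ and $\mathrm{graph}(t)$ has, for each $z\in\{a,b,c,d,\bar a,\bar b,\bar c,\bar d\}$, exactly as many $z$-labelled edges as $\mathrm{yd}(t)$ has $z$-tokens. (This holds in particular if the pairs $(\mathrm{yd}(t),\mathrm{graph}(t))$, $t\in\mathbf T$, form a relation $\mathsf{CSD}$ between the strings of $\mathsf{CSD}_s$ and graphs with one $z$-edge for each $z$-token.) For a tree or context $u$ let $n^u_z$ be the number of $z$-tokens of its yield, $e^u_z$ the number of $z$-edges of its graph, and $r^u_z$ the length of the rightmost maximal nonempty run of $z$-tokens in its yield ($0$ if there is none). A number $p$ is a pumping height of $\mathbf T$ if every $t\in\mathbf T$ of height greater than $p$ can be written $t=C_1[C_2[C_3[C_4[t_5]]]]$ with $\mathrm{ht}(C_2[C_3[C_4]])\le p$, $\mathrm{ht}(C_2)+\mathrm{ht}(C_4)>0$, and $C_1[v^i[t_5]]\in\mathbf T$ for all $i\ge0$, where $v^0=C_3$ and $v^{i+1}=C_2[v^i[C_4]]$. For such a $p$ let $l_0$ be a number such that every context of height at most $p$ generates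 at most $l_0$ string tokens and at most $l_0$ edges (for instance the least such number). For $(x,y)\in\mathsf{Sep}=\{(a,c),(c,a),(b,d),(d,b)\}$, an $x,y,l$-separation of $t$ is a decomposition $t=D_x[D_0[t_y]]$ into contexts $D_x,D_0$ and a tree $t_y$ with $n^{D_x}_y=0$, $n^{D_0}_x\le l$ and $n^{t_y}_x=0$; it is minimal if $\mathrm{ht}(D_0)$ is least among all $x,y,l$-separations of $t$. Claim. Such $p$ and $l_0$ exist, and for all such $p$ and $l_0$, all $(x,y)\in\mathsf{Sep}$ and all $t\in\mathbf T$: 1. For every $x,y,l_0$-separation $t=D_x[D_0[t_y]]$, with $t_0=D_0[t_y]$, $$e^{t_0}_{\bar x}\le n^{t_0}_{\bar x}+n^t_x\,l_0 .$$ 2. If $t$ has an $x,y,l_0$-separation, then it has a minimal $x,y,l_0$-separation $t=D_x[D_0[t_y]]$ such that, with $t_0=D_0[t_y]$, $$e^{t_0}_{\bar y}\ge n^t_{\bar y}-n^t_x\,l_0-r^t_{\bar y}.$$ -/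

import Mathlib

/-! ## Ranked trees and one-hole contexts -/

/-- A ranked signature. -/
structure Signature where
  Sym : Type
  rank : Sym → ℕ

/-- Trees over a signature. -/
inductive RTree (Δ : Signature) : Type
  | node (f : Δ.Sym) (ts : Fin (Δ.rank f) → RTree Δ) : RTree Δ

/-- Contexts: trees with exactly one hole `X`. `node f i ts c` has the root symbol `f`, the
context `c` at the child `i` and the tree `ts j _` at every other child `j`. -/
inductive Ctx (Δ : Signature) : Type
  | hole : Ctx Δ
  | node (f : Δ.Sym) (i : Fin (Δ.rank f)) (ts : ∀ j : Fin (Δ.rank f), j ≠ i → RTree Δ)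
      (c : Ctx Δ) : Ctx Δ

/-- Height of a tree; a constant has height `1`. -/
def RTree.height {Δ : Signature} : RTree Δ → ℕ
  | .node _ ts => 1 + Finset.univ.sup fun i => (ts i).height

/-- Height of a context; the trivial context `X` has height `0`. -/
def Ctx.height {Δ : Signature} : Ctx Δ → ℕ
  | .hole => 0
  | .node _ i ts c =>
      1 + Finset.univ.sup fun j => if hj : j = i then c.height else (ts j hj).height

/-- `C[t]`. -/
def Ctx.plug {Δ : Signature} : Ctx Δ → RTree Δ → RTree Δ
  | .hole, t => t
  | .node f i ts c, t => .node f fun j => if hj : j = i then c.plug t else ts j hj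

/-- `C[C']`, again a context. -/
def Ctx.comp {Δ : Signature} : Ctx Δ → Ctx Δ → Ctx Δ
  | .hole, c' => c'
  | .node f i ts c, c' => .node f i ts (c.comp c')

/-! ## Linear monadic context-free tree grammars -/

/-- Right-hand sides and sentential forms: trees over the signature, nonterminals of rank `0`
(`N₀`) and of rank `1` (`N₁`), and the variable `x`. -/
inductive SForm (Δ : Signature) (N₀ N₁ : Type) : Type
  | var : SForm Δ N₀ N₁
  | term (f : Δ.Sym) (ts : Fin (Δ.rank f) → SForm Δ N₀ N₁) : SForm Δ N₀ N₁
  | nt0 (A : N₀) : SForm Δ N₀ N₁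
  | nt1 (B : N₁) (s : SForm Δ N₀ N₁) : SForm Δ N₀ N₁

/-- Number of occurrences of the variable. -/
def SForm.varCount {Δ : Signature} {N₀ N₁ : Type} : SForm Δ N₀ N₁ → ℕ
  | .var => 1
  | .term _ ts => ∑ i, (ts i).varCount
  | .nt0 _ => 0
  | .nt1 _ s => s.varCount

/-- Substitution of `u` for the variable. -/
def SForm.subst {Δ : Signature} {N₀ N₁ : Type} :
    SForm Δ N₀ N₁ → SForm Δ N₀ N₁ → SForm Δ N₀ N₁
  | .var, u => u
  | .term f ts, u => .term f fun i => (ts i).subst u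
  | .nt0 A, _ => .nt0 A
  | .nt1 B s, u => .nt1 B (s.subst u)

/-- A tree as a sentential form. -/
def RTree.toSForm {Δ : Signature} {N₀ N₁ : Type} : RTree Δ → SForm Δ N₀ N₁
  | .node f ts => .term f fun i => (ts i).toSForm

/-- A linear monadic context-free tree grammar: finitely many nonterminals, all of rank `0` or
`1`, and finitely many rules `A → r` and `B(x) → r`, where `x` occurs at most once in the `r` of
a rule of the second kind and not at all in the `r` of a rule of the first kind. -/
structure LMCFTG (Δ : Signature) where
  N₀ : Type
  N₁ : Type
  finite_N₀ : Finite N₀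
  finite_N₁ : Finite N₁
  start : N₀
  rules₀ : Set (N₀ × SForm Δ N₀ N₁)
  rules₁ : Set (N₁ × SForm Δ N₀ N₁)
  finite_rules₀ : rules₀.Finite
  finite_rules₁ : rules₁.Finite
  closed₀ : ∀ r ∈ rules₀, r.2.varCount = 0
  linear₁ : ∀ r ∈ rules₁, r.2.varCount ≤ 1

/-- One rewriting step. -/
inductive LMCFTG.Step {Δ : Signature} (G : LMCFTG Δ) :
    SForm Δ G.N₀ G.N₁ → SForm Δ G.N₀ G.N₁ → Prop
  | rule₀ (A : G.N₀) (r : SForm Δ G.N₀ G.N₁) : (A, r) ∈ G.rules₀ → G.Step (.nt0 A) r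
  | rule₁ (B : G.N₁) (r s : SForm Δ G.N₀ G.N₁) :
      (B, r) ∈ G.rules₁ → G.Step (.nt1 B s) (r.subst s)
  | inTerm (f : Δ.Sym) (ts : Fin (Δ.rank f) → SForm Δ G.N₀ G.N₁) (i : Fin (Δ.rank f))
      (u : SForm Δ G.N₀ G.N₁) :
      G.Step (ts i) u → G.Step (.term f ts) (.term f (Function.update ts i u))
  | inNt1 (B : G.N₁) (s u : SForm Δ G.N₀ G.N₁) :
      G.Step s u → G.Step (.nt1 B s) (.nt1 B u)

/-- The tree language `L(G)`. -/
def LMCFTG.language {Δ : Signature} (G : LMCFTG Δ) : Set (RTree Δ) :=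
  {t | Relation.ReflTransGen G.Step (.nt0 G.start) t.toSForm}

/-! ## Tokens and projective yields -/

/-- The core letters `a, b, c, d`. -/
inductive Core : Type
  | a | b | c | d
  deriving DecidableEq

/-- String tokens: core letters `z`, barred letters `z̄`, and the brackets `⟨` and `⟩`. -/
inductive Token : Type
  | core (z : Core)
  | bar (z : Core)
  | lbr
  | rbr
  deriving DecidableEq

/-- A projective (context-free) yield: a symbol `f` of rank `n` comes with strings `u₀, …, uₙ`,
and the yield of `f(t₁, …, tₙ)` is `u₀ w₁ u₁ w₂ u₂ ⋯ wₙ uₙ`, where `wᵢ` is the yield of `tᵢ`. -/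
structure ProjYield (Δ : Signature) where
  pieces : ∀ f : Δ.Sym, Fin (Δ.rank f + 1) → List Token

/-- The yield of a tree. -/
def ProjYield.tree {Δ : Signature} (yd : ProjYield Δ) : RTree Δ → List Token
  | .node f ts =>
      yd.pieces f 0 ++ (List.finRange (Δ.rank f)).flatMap fun j =>
        yd.tree (ts j) ++ yd.pieces f j.succ

/-- The string that a context generates on the left of its hole. -/
def ProjYield.left {Δ : Signature} (yd : ProjYield Δ) : Ctx Δ → List Token
  | .hole => []
  | .node f i ts c =>
      yd.pieces f 0 ++ ((List.finRange (Δ.rank f)).flatMap fun j =>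
        if hj : j < i then yd.tree (ts j (ne_of_lt hj)) ++ yd.pieces f j.succ else []) ++
      yd.left c

/-- The string that a context generates on the right of its hole. -/
def ProjYield.right {Δ : Signature} (yd : ProjYield Δ) : Ctx Δ → List Token
  | .hole => []
  | .node f i ts c =>
      yd.right c ++ yd.pieces f i.succ ++ (List.finRange (Δ.rank f)).flatMap fun j =>
        if hj : i < j then yd.tree (ts j (ne_of_gt hj)) ++ yd.pieces f j.succ else []

/-- The yield of a context. -/
def ProjYield.ctx {Δ : Signature} (yd : ProjYield Δ) (C : Ctx Δ) : List Token :=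
  yd.left C ++ yd.right C

/-! ## The graph algebra with `k` sources -/

/-- Finite directed multigraphs with edge labels in `L` and (partially defined) sources named
by `Fin k`. -/
structure SGraph (k : ℕ) (L : Type) where
  V : Type
  E : Type
  finite_V : Finite V
  finite_E : Finite E
  src : E → V
  tgt : E → V
  label : E → L
  source : Fin k → Option V

namespace SGraph

variable {k : ℕ} {L : Type}

/-- The empty graph. -/
def empty : SGraph k L where
  V := Empty
  E := Empty
  finite_V := inferInstance
  finite_E := inferInstance
  src := Empty.elim
  tgt := Empty.elim
  label := Empty.elim
  source := fun _ => none

/-- The pairs of nodes that a parallel composition identifies: sources of the same name. -/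
def Fuse (G H : SGraph k L) (u v : G.V ⊕ H.V) : Prop :=
  ∃ (i : Fin k) (a : G.V) (b : H.V),
    G.source i = some a ∧ H.source i = some b ∧ u = Sum.inl a ∧ v = Sum.inr b

/-- Parallel composition: disjoint union with sources of the same name identified. -/
def par (G H : SGraph k L) : SGraph k L where
  V := Quot (Fuse G H)
  E := G.E ⊕ H.E
  finite_V := by
    have := G.finite_V
    have := H.finite_V
    infer_instance
  finite_E := by
    have := G.finite_E
    have := H.finite_E
    infer_instance
  src := Sum.elim (fun e => Quot.mk _ (Sum.inl (G.src e))) (fun e => Quot.mk _ (Sum.inr (H.src e)))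
  tgt := Sum.elim (fun e => Quot.mk _ (Sum.inl (G.tgt e))) (fun e => Quot.mk _ (Sum.inr (H.tgt e)))
  label := Sum.elim G.label H.label
  source := fun i =>
    ((G.source i).map fun a => Quot.mk _ (Sum.inl a)).or
      ((H.source i).map fun b => Quot.mk _ (Sum.inr b))

/-- The source name `i` is forgotten (the node stays). -/
def forget (i : Fin k) (G : SGraph k L) : SGraph k L :=
  { G with source := Function.update G.source i none }

/-- Renaming of sources: the names `i` and `j` are exchanged. -/
def rename (i j : Fin k) (G : SGraph k L) : SGraph k L :=
  { G with source := fun m => G.source (Equiv.swap i j m) }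

/-- The number of edges with label `z`. -/
noncomputable def edgeCount (G : SGraph k L) (z : L) : ℕ :=
  Nat.card {e : G.E // G.label e = z}

/-- The number of all edges. -/
noncomputable def size (G : SGraph k L) : ℕ :=
  Nat.card G.E

end SGraph

/-- Terms over the graph algebra with `k` sources, with variables from `Fin n`. -/
inductive HRTerm (k : ℕ) (L : Type) (n : ℕ) : Type 1
  | var (i : Fin n) : HRTerm k L n
  | const (G : SGraph k L) : HRTerm k L n
  | par (s t : HRTerm k L n) : HRTerm k L n
  | forget (i : Fin k) (s : HRTerm k L n) : HRTerm k L n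
  | rename (i j : Fin k) (s : HRTerm k L n) : HRTerm k L n

/-- Number of occurrences of the variable `m`. -/
def HRTerm.occ {k : ℕ} {L : Type} {n : ℕ} (m : Fin n) : HRTerm k L n → ℕ
  | .var i => if i = m then 1 else 0
  | .const _ => 0
  | .par s t => s.occ m + t.occ m
  | .forget _ s => s.occ m
  | .rename _ _ s => s.occ m

/-- Evaluation in the graph algebra. -/
def HRTerm.eval {k : ℕ} {L : Type} {n : ℕ} (env : Fin n → SGraph k L) :
    HRTerm k L n → SGraph k L
  | .var i => env i
  | .const G => G
  | .par s t => (s.eval env).par (t.eval env)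
  | .forget i s => (s.eval env).forget i
  | .rename i j s => (s.eval env).rename i j

/-- A linear nondeleting tree homomorphism from trees over `Δ` to terms of the graph algebra. -/
structure HRHom (Δ : Signature) (k : ℕ) (L : Type) where
  image : ∀ f : Δ.Sym, HRTerm k L (Δ.rank f)
  linear : ∀ (f : Δ.Sym) (m : Fin (Δ.rank f)), (image f).occ m = 1

/-- The graph generated by a tree. -/
def HRHom.tree {Δ : Signature} {k : ℕ} {L : Type} (h : HRHom Δ k L) : RTree Δ → SGraph k L
  | .node f ts => (h.image f).eval fun i => h.tree (ts i)

/-- The graph generated by a context; the hole contributes the empty graph. -/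
def HRHom.ctx {Δ : Signature} {k : ℕ} {L : Type} (h : HRHom Δ k L) : Ctx Δ → SGraph k L
  | .hole => SGraph.empty
  | .node f i ts c =>
      (h.image f).eval fun j => if hj : j = i then h.ctx c else h.tree (ts j hj)

/-- The string-graph relation of a grammar, a projective yield and a homomorphism. -/
def rel {Δ : Signature} {k : ℕ} {L : Type} (G : LMCFTG Δ) (yd : ProjYield Δ) (h : HRHom Δ k L) :
    Set (List Token × SGraph k L) :=
  {P | ∃ t ∈ G.language, P = (yd.tree t, h.tree t)}

/-! ## Cross-serial dependencies -/

/-- The blocks `z ⟨ⁱ z̄ⁱ ⟩ⁱ` with `i ≥ 0`. -/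
def block (z : Core) : Language Token :=
  {w | ∃ i : ℕ, w = Token.core z :: (List.replicate i Token.lbr ++
    List.replicate i (Token.bar z) ++ List.replicate i Token.rbr)}

/-- The string language `AⁿBᵐCⁿDᵐ` (`n, m ≥ 1`) of cross-serial dependencies, where
`A, B, C, D` are the languages of blocks of the four letters. -/
def csdStrings : Language Token :=
  {w | ∃ n m : ℕ, 1 ≤ n ∧ 1 ≤ m ∧
    w ∈ block Core.a ^ n * block Core.b ^ m * block Core.c ^ n * block Core.d ^ m}

/-- The string-graph pairs whose string is in `csdStrings` and whose graph has exactly one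
`z`-edge for each `z`-token of the string, for each of the eight letters `z`. The edges may be
arranged in any way, and there may be edges with further labels in `Λ`. -/
def csdPairs (k : ℕ) (Λ : Type) : Set (List Token × SGraph k (Token ⊕ Λ)) :=
  {P | P.1 ∈ csdStrings ∧ ∀ z : Core,
    P.2.edgeCount (Sum.inl (Token.core z)) = P.1.count (Token.core z) ∧
    P.2.edgeCount (Sum.inl (Token.bar z)) = P.1.count (Token.bar z)}

/-- The pairs `a/c`, `c/a`, `b/d`, `d/b`. -/
def sepPairs : Set (Core × Core) :=
  {(Core.a, Core.c), (Core.c, Core.a), (Core.b, Core.d), (Core.d, Core.b)}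

/-! ## Pumping height and the constant bounding small contexts -/

/-- `v⁰ = C₃` and `vⁱ⁺¹ = C₂[vⁱ[C₄]]`. -/
def pump {Δ : Signature} (C₂ C₃ C₄ : Ctx Δ) : ℕ → Ctx Δ
  | 0 => C₃
  | i + 1 => C₂.comp ((pump C₂ C₃ C₄ i).comp C₄)

/-- `(C₁, C₂, C₃, C₄, t₅)` is a pumping decomposition of `t` in `T`, for the height `p`. -/
def IsPumpingDecomposition {Δ : Signature} (T : Set (RTree Δ)) (p : ℕ) (t : RTree Δ)
    (C₁ C₂ C₃ C₄ : Ctx Δ) (t₅ : RTree Δ) : Prop :=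
  t = C₁.plug (C₂.plug (C₃.plug (C₄.plug t₅))) ∧
  (C₂.comp (C₃.comp C₄)).height ≤ p ∧
  0 < C₂.height + C₄.height ∧
  ∀ i : ℕ, C₁.plug ((pump C₂ C₃ C₄ i).plug t₅) ∈ T

/-- `p` is a pumping height of `T`: all trees of `T` of height more than `p` have a pumping
decomposition. -/
def IsPumpingHeight {Δ : Signature} (T : Set (RTree Δ)) (p : ℕ) : Prop :=
  ∀ t ∈ T, p < t.height →
    ∃ (C₁ C₂ C₃ C₄ : Ctx Δ) (t₅ : RTree Δ), IsPumpingDecomposition T p t C₁ C₂ C₃ C₄ t₅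

/-- A context of height at most `p` generates at most `l` string tokens and at most `l` edges. -/
def IsGenerationBound {Δ : Signature} {k : ℕ} {L : Type} (yd : ProjYield Δ) (h : HRHom Δ k L)
    (p l : ℕ) : Prop :=
  ∀ C : Ctx Δ, C.height ≤ p → (yd.ctx C).length ≤ l ∧ (h.ctx C).size ≤ l

/-! ## Separations -/

/-- `t = Dx[D₀[ty]]` is an `x,y,l`-separation of `t`. -/
def IsSeparation {Δ : Signature} (yd : ProjYield Δ) (x y : Core) (l : ℕ) (t : RTree Δ)
    (Dx D₀ : Ctx Δ) (ty : RTree Δ) : Prop :=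
  t = Dx.plug (D₀.plug ty) ∧
  (yd.ctx Dx).count (Token.core y) = 0 ∧
  (yd.ctx D₀).count (Token.core x) ≤ l ∧
  (yd.tree ty).count (Token.core x) = 0

/-- `t` is `x,y,l`-separated. -/
def IsSeparated {Δ : Signature} (yd : ProjYield Δ) (x y : Core) (l : ℕ) (t : RTree Δ) : Prop :=
  ∃ (Dx D₀ : Ctx Δ) (ty : RTree Δ), IsSeparation yd x y l t Dx D₀ ty

/-- A separation is minimal if the height of its middle context is minimal. -/
def IsMinimalSeparation {Δ : Signature} (yd : ProjYield Δ) (x y : Core) (l : ℕ) (t : RTree Δ)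
    (Dx D₀ : Ctx Δ) (ty : RTree Δ) : Prop :=
  IsSeparation yd x y l t Dx D₀ ty ∧
  ∀ (Dx' D₀' : Ctx Δ) (ty' : RTree Δ),
    IsSeparation yd x y l t Dx' D₀' ty' → D₀.height ≤ D₀'.height

/-- The length of the rightmost maximal nonempty run of the token `z` in `w` (`0` if `z` does
not occur). -/
def lastRun (z : Token) (w : List Token) : ℕ :=
  ((w.reverse.dropWhile fun u => decide (u ≠ z)).takeWhile fun u => decide (u = z)).length

/-!
All yields are concatenations of blocks `z ⟨ⁱ z̄ⁱ ⟩ⁱ`, so what one round of pumping adds contains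
equally many opening brackets, barred letters and closing brackets. It also contains equally many
`x` and `y`. If it contains an `x`, then the bound grows by `l₀`, and this pays for everything that
the round adds. If it contains no `x`, then pumped tokens `x̄` or `ȳ` come from `C₄` alone, since a
pumped string that contains such a token consists of copies of it, and opening brackets have to be
pumped before it and closing ones after it.

Both bounds are proved for a tree `D[t₀]`, where `D` generates no `y`, by induction along pumping
decompositions. Undoing one round of pumping turns the cut of the yield at the hole of `D` into a
cut of a shorter yield, and what `D` loses depends on the place of its hole relative to the pumped
contexts. For the second bound, the induction also needs an estimate in terms of the closing
brackets to the right of `D`, since every `ȳ` has its own closing bracket.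

A pumping height exists because a path of a minimal derivation tree that is long enough repeats a
sentential form. The repetition can be chosen such that the two derived objects are trees, or all
objects between them on the path are contexts.
-/

/-! ## Block strings -/

/-- The alphabetical order of the core letters. -/
instance : LinearOrder Core :=
  LinearOrder.lift' Core.ctorIdx fun x y h => by cases x <;> cases y <;> simp_all [Core.ctorIdx]

/-- The position of a token inside a block. -/
def Token.phase : Token → ℕ
  | .core _ => 0
  | .lbr => 1
  | .bar _ => 2
  | .rbr => 3

/-- The letter of a token that is not a bracket. -/
def Token.letter : Token → Option Core
  | .core z => some z
  | .bar z => some z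
  | .lbr => none
  | .rbr => none

/-- The tokens `z̄`. -/
def Token.isBar : Token → Bool
  | .bar _ => true
  | _ => false

/-- The number of barred letters of a string. -/
def barCount (w : List Token) : ℕ := w.countP Token.isBar

@[simp]
theorem barCount_append (u v : List Token) : barCount (u ++ v) = barCount u + barCount v :=
  List.countP_append

theorem count_bar_le_barCount (y : Core) (w : List Token) : w.count (.bar y) ≤ barCount w :=
  List.countP_mono_left fun p _ h => by simp_all [Token.isBar]

theorem count_rbr_add_barCount_le_length (w : List Token) :
    w.count .rbr + barCount w ≤ w.length := by
  induction w with
  | nil => simp [barCount]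
  | cons p w ih =>
    rw [barCount] at ih
    cases p <;> simp [barCount, List.countP_cons, Token.isBar] <;> omega

/-- The block `z ⟨ⁱ z̄ⁱ ⟩ⁱ` of the pair `(z, i)`. -/
def blockTokens (B : Core × ℕ) : List Token :=
  .core B.1 :: (List.replicate B.2 .lbr ++ List.replicate B.2 (.bar B.1) ++
    List.replicate B.2 .rbr)

/-- Concatenations of blocks in the alphabetical order of their letters. -/
def IsBlockString (w : List Token) : Prop :=
  ∃ L : List (Core × ℕ), (L.map Prod.fst).Pairwise (· ≤ ·) ∧ w = L.flatMap blockTokens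

theorem exists_blocks_of_prefix {L : List (Core × ℕ)} {u v : List Token}
    (h : L.flatMap blockTokens = u ++ v) :
    ∃ (L₁ : List (Core × ℕ)) (B : Core × ℕ) (n : ℕ),
      u = L₁.flatMap blockTokens ++ (blockTokens B).take n := by
  rw [List.flatMap_def, List.flatten_eq_append_iff] at h
  rcases h with ⟨as, bs, hL, rfl, -⟩ | ⟨as, c, p, d, bs, hL, rfl, -⟩
  · obtain ⟨L₁, L₂, -, rfl, -⟩ := List.map_eq_append_iff.1 hL
    exact ⟨L₁, (.a, 0), 0, by simp [List.flatMap_def]⟩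
  · obtain ⟨L₁, L₂, -, rfl, hL₂⟩ := List.map_eq_append_iff.1 hL
    obtain ⟨B, L₃, -, hB, -⟩ := List.map_eq_cons_iff.1 hL₂
    exact ⟨L₁, B, c.length, by simp [List.flatMap_def, hB]⟩

theorem blockTokens_balanced (B : Core × ℕ) :
    (blockTokens B).count .rbr = barCount (blockTokens B) ∧
      barCount (blockTokens B) = (blockTokens B).count .lbr := by
  simp [blockTokens, barCount, Token.isBar, List.countP_replicate, List.count_replicate]

theorem flatMap_blockTokens_balanced (L : List (Core × ℕ)) :
    (L.flatMap blockTokens).count .rbr = barCount (L.flatMap blockTokens) ∧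
      barCount (L.flatMap blockTokens) = (L.flatMap blockTokens).count .lbr := by
  induction L with
  | nil => simp [barCount]
  | cons B L ih =>
    have := blockTokens_balanced B
    simp only [List.flatMap_cons, List.count_append, barCount_append]
    omega

theorem count_rbr_take_blockTokens_le (B : Core × ℕ) (n : ℕ) :
    ((blockTokens B).take n).count .rbr ≤ barCount ((blockTokens B).take n) ∧
      barCount ((blockTokens B).take n) ≤ ((blockTokens B).take n).count .lbr := by
  cases n with
  | zero => simp [barCount]
  | succ n =>
    simp [barCount, blockTokens, List.take_append, List.take_replicate, List.countP_replicate,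
      List.count_replicate, Token.isBar]

theorem letter_of_mem_blockTokens {B : Core × ℕ} {p : Token} {z : Core}
    (hp : p ∈ blockTokens B) (hz : p.letter = some z) : z = B.1 := by
  simp only [blockTokens, List.mem_cons, List.mem_append, List.mem_replicate] at hp
  rcases hp with rfl | (⟨-, rfl⟩ | ⟨-, rfl⟩) | ⟨-, rfl⟩ <;> simp_all [Token.letter]

theorem blockTokens_pairwise_phase (B : Core × ℕ) :
    (blockTokens B).Pairwise fun p q => p.phase ≤ q.phase := by
  simp only [blockTokens, List.pairwise_cons, List.pairwise_append, List.mem_append,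
    List.mem_replicate, List.pairwise_replicate]
  refine ⟨?_, ⟨?_, ?_, ?_⟩, ?_, ?_⟩
  all_goals grind [Token.phase]

theorem count_core_flatMap_blockTokens (z : Core) (L : List (Core × ℕ)) :
    (L.flatMap blockTokens).count (.core z) = (L.map Prod.fst).count z := by
  induction L with
  | nil => rfl
  | cons B L ih =>
    rw [List.flatMap_cons, List.count_append, ih, List.map_cons, List.count_cons]
    simp [blockTokens, List.count_cons, List.count_replicate]
    omega

namespace IsBlockString

variable {w u v : List Token}

theorem balanced (hw : IsBlockString w) :
    w.count .rbr = barCount w ∧ barCount w = w.count .lbr := by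
  obtain ⟨L, -, rfl⟩ := hw
  exact flatMap_blockTokens_balanced L

theorem prefix_le (hw : IsBlockString w) (h : w = u ++ v) :
    u.count .rbr ≤ barCount u ∧ barCount u ≤ u.count .lbr := by
  obtain ⟨L, -, rfl⟩ := hw
  obtain ⟨L₁, B, n, rfl⟩ := exists_blocks_of_prefix h
  have := flatMap_blockTokens_balanced L₁
  have := count_rbr_take_blockTokens_le B n
  simp only [List.count_append, barCount_append]
  omega

theorem balanced_before_core (hw : IsBlockString w) {z : Core} (h : w = u ++ .core z :: v) :
    u.count .rbr = barCount u ∧ barCount u = u.count .lbr := by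
  obtain ⟨L, -, rfl⟩ := hw
  rw [List.flatMap_def, List.flatten_eq_append_iff] at h
  rcases h with ⟨as, bs, hL, rfl, -⟩ | ⟨as, c, p, d, bs, hL, rfl, hp⟩
  · obtain ⟨L₁, L₂, -, rfl, -⟩ := List.map_eq_append_iff.1 hL
    exact flatMap_blockTokens_balanced L₁
  · obtain ⟨L₁, L₂, -, rfl, hL₂⟩ := List.map_eq_append_iff.1 hL
    obtain ⟨B, L₃, -, hB, -⟩ := List.map_eq_cons_iff.1 hL₂
    obtain ⟨rfl, -⟩ := List.cons_eq_cons.1 hp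
    suffices hc : c = [] by
      simpa [hc, List.flatMap_def] using flatMap_blockTokens_balanced L₁
    rcases c with _ | ⟨q, c⟩
    · rfl
    · have hz : Token.core z ∈ c ++ .core z :: d := by simp
      rw [← List.append_eq, ← (List.cons_eq_cons.1 hB).2] at hz
      simp [List.mem_replicate] at hz

theorem letters_sorted (hw : IsBlockString w) (h : w = u ++ v) {p q : Token} (hp : p ∈ u)
    (hq : q ∈ v) {z z' : Core} (hz : p.letter = some z) (hz' : q.letter = some z') : z ≤ z' := by
  obtain ⟨L, hL, rfl⟩ := hw
  have hsorted : (L.flatMap blockTokens).Pairwise fun p q => ∀ z z', p.letter = some z →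
      q.letter = some z' → z ≤ z' := by
    rw [List.pairwise_flatMap]
    refine ⟨fun B _ => List.pairwise_of_forall_mem_list ?_, (List.pairwise_map.1 hL).imp ?_⟩
    · intro p hp q hq z z' hz hz'
      rw [letter_of_mem_blockTokens hp hz, letter_of_mem_blockTokens hq hz']
    · intro B B' hB p hp q hq z z' hz hz'
      rwa [letter_of_mem_blockTokens hp hz, letter_of_mem_blockTokens hq hz']
  rw [h, List.pairwise_append] at hsorted
  exact hsorted.2.2 p hp q hq z z' hz hz'

theorem core_mem_of_bar_mem (hw : IsBlockString w) (h : w = u ++ v) {z : Core}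
    (hz : .bar z ∈ u) : .core z ∈ u := by
  obtain ⟨L, -, rfl⟩ := hw
  obtain ⟨L₁, B, n, rfl⟩ := exists_blocks_of_prefix h
  rcases List.mem_append.1 hz with hz | hz
  · obtain ⟨B', hB', hz⟩ := List.mem_flatMap.1 hz
    obtain rfl := letter_of_mem_blockTokens hz rfl
    exact List.mem_append_left _ (List.mem_flatMap.2 ⟨B', hB', by simp [blockTokens]⟩)
  · obtain rfl := letter_of_mem_blockTokens (List.mem_of_mem_take hz) rfl
    cases n with
    | zero => simp at hz
    | succ n => simp [blockTokens]

theorem exists_core_mem (hw : IsBlockString w) (h : w = u ++ v) (hu : u ≠ []) :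
    ∃ z, .core z ∈ u := by
  obtain ⟨L, -, rfl⟩ := hw
  rcases L with _ | ⟨B, L⟩
  · simp_all
  · obtain ⟨q, u, rfl⟩ := List.exists_cons_of_ne_nil hu
    exact ⟨B.1, by simp [← (List.cons_eq_cons.1 h).1]⟩

theorem phase_sorted {m : List Token} (hw : IsBlockString w) (h : w = u ++ (m ++ v))
    (hm : ∀ z, .core z ∉ m) : m.Pairwise fun p q => p.phase ≤ q.phase := by
  obtain ⟨L, hL, rfl⟩ := hw
  have tail_eq_nil {L₂ : List (Core × ℕ)} {m₂ : List Token} (hL₂ : L₂.Sublist L)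
      (h₂ : L₂.flatMap blockTokens = m₂ ++ v) (hm₂ : ∀ p ∈ m₂, p ∈ m) : m₂ = [] := by
    by_contra hne
    obtain ⟨z, hz⟩ := exists_core_mem ⟨L₂, hL.sublist (hL₂.map _), rfl⟩ h₂ hne
    exact hm z (hm₂ _ hz)
  rw [List.flatMap_def, List.flatten_eq_append_iff] at h
  rcases h with ⟨as, bs, h, -, h₂⟩ | ⟨as, c, p, d, bs, h, -, h₂⟩
  · obtain ⟨L₁, L₂, rfl, -, rfl⟩ := List.map_eq_append_iff.1 h
    rw [tail_eq_nil (by simp) h₂.symm fun _ => id]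
    exact .nil
  · obtain ⟨L₁, L₂, rfl, -, h⟩ := List.map_eq_append_iff.1 h
    obtain ⟨B, L₃, rfl, hB, rfl⟩ := List.map_eq_cons_iff.1 h
    have hphase := blockTokens_pairwise_phase B
    rw [hB, List.pairwise_append] at hphase
    rcases List.append_eq_append_iff.1 h₂ with ⟨a, ha, -⟩ | ⟨m₂, hm₂, ha⟩
    · exact (List.pairwise_append.1 (ha ▸ hphase.2.1)).1
    · rw [tail_eq_nil (L₂ := L₃) (by simp) ha fun p hp => by simp [hm₂, hp],
        List.append_nil] at hm₂
      exact hm₂ ▸ hphase.2.1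

end IsBlockString

theorem exists_blocks_of_mem_block_pow {z : Core} {n : ℕ} {w : List Token}
    (h : w ∈ block z ^ n) :
    ∃ L : List (Core × ℕ), w = L.flatMap blockTokens ∧ L.map Prod.fst = List.replicate n z := by
  induction n generalizing w with
  | zero =>
    rw [pow_zero, Language.mem_one] at h
    exact ⟨[], by simp [h], rfl⟩
  | succ n ih =>
    rw [pow_succ', Language.mem_mul] at h
    obtain ⟨_, ⟨i, rfl⟩, _, hv, rfl⟩ := h
    obtain ⟨L, rfl, hL⟩ := ih hv
    exact ⟨(z, i) :: L, rfl, by simp [hL, List.replicate_succ]⟩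

theorem exists_blocks_of_mem_csdStrings {w : List Token} (h : w ∈ csdStrings) :
    ∃ (L : List (Core × ℕ)) (n m : ℕ), 1 ≤ n ∧ 1 ≤ m ∧ w = L.flatMap blockTokens ∧
      L.map Prod.fst = List.replicate n .a ++ List.replicate m .b ++ List.replicate n .c ++
        List.replicate m .d := by
  obtain ⟨n, m, hn, hm, h⟩ := h
  obtain ⟨_, habc, _, hd, rfl⟩ := Language.mem_mul.1 h
  obtain ⟨_, hab, _, hc, rfl⟩ := Language.mem_mul.1 habc
  obtain ⟨_, ha, _, hb, rfl⟩ := Language.mem_mul.1 hab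
  obtain ⟨La, rfl, hLa⟩ := exists_blocks_of_mem_block_pow ha
  obtain ⟨Lb, rfl, hLb⟩ := exists_blocks_of_mem_block_pow hb
  obtain ⟨Lc, rfl, hLc⟩ := exists_blocks_of_mem_block_pow hc
  obtain ⟨Ld, rfl, hLd⟩ := exists_blocks_of_mem_block_pow hd
  exact ⟨La ++ Lb ++ Lc ++ Ld, n, m, hn, hm, by simp, by simp [hLa, hLb, hLc, hLd]⟩

theorem isBlockString_of_mem_csdStrings {w : List Token} (h : w ∈ csdStrings) :
    IsBlockString w := by
  obtain ⟨L, n, m, -, -, rfl, hL⟩ := exists_blocks_of_mem_csdStrings h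
  refine ⟨L, ?_, rfl⟩
  have hab : Core.a ≤ .b := by decide
  have hbc : Core.b ≤ .c := by decide
  have hcd : Core.c ≤ .d := by decide
  simp only [hL, List.pairwise_append, List.mem_append, List.mem_replicate,
    List.pairwise_replicate]
  grind

theorem count_core_eq_of_mem_csdStrings {w : List Token} (h : w ∈ csdStrings) {x y : Core}
    (hxy : (x, y) ∈ sepPairs) : w.count (.core x) = w.count (.core y) := by
  obtain ⟨L, n, m, -, -, rfl, hL⟩ := exists_blocks_of_mem_csdStrings h
  simp only [sepPairs, Set.mem_insert_iff, Prod.mk.injEq, Set.mem_singleton_iff] at hxy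
  rcases hxy with ⟨rfl, rfl⟩ | ⟨rfl, rfl⟩ | ⟨rfl, rfl⟩ | ⟨rfl, rfl⟩ <;>
    simp [count_core_flatMap_blockTokens, hL, List.count_replicate]

theorem core_mem_of_mem_csdStrings {w : List Token} (h : w ∈ csdStrings) (z : Core) :
    .core z ∈ w := by
  obtain ⟨L, n, m, hn, hm, rfl, hL⟩ := exists_blocks_of_mem_csdStrings h
  rw [← List.count_pos_iff, count_core_flatMap_blockTokens, hL]
  cases z <;> simp [List.count_replicate] <;> omega

/-! ## The barred letters after the last core letter -/

/-- The number of tokens `ȳ` after the last token `y`, or of all tokens `ȳ` if there is no `y`. -/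
def barsAfterLast (y : Core) (w : List Token) : ℕ :=
  (w.reverse.takeWhile fun p => decide (p ≠ .core y)).count (.bar y)

section BarsAfterLast

variable {y : Core} {u v w : List Token}

theorem barsAfterLast_append_of_notMem (h : .core y ∉ v) :
    barsAfterLast y (u ++ v) = barsAfterLast y u + v.count (.bar y) := by
  unfold barsAfterLast
  rw [List.reverse_append, List.takeWhile_append_of_pos, List.count_append, List.count_reverse,
    Nat.add_comm]
  intro p hp
  have : p ≠ .core y := by rintro rfl; exact h (List.mem_reverse.1 hp)
  simpa

theorem barsAfterLast_append_of_mem (h : .core y ∈ v) :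
    barsAfterLast y (u ++ v) = barsAfterLast y v := by
  unfold barsAfterLast
  rw [List.reverse_append, List.takeWhile_append, if_neg]
  intro hlen
  have hall := (List.takeWhile_sublist _).eq_of_length hlen
  rw [List.takeWhile_eq_self_iff] at hall
  simpa using hall _ (List.mem_reverse.2 h)

theorem barsAfterLast_append_cons_of_notMem (h : .core y ∉ v) :
    barsAfterLast y (u ++ .core y :: v) = v.count (.bar y) := by
  rw [List.append_cons, barsAfterLast_append_of_notMem h, barsAfterLast_append_of_mem (by simp)]
  simp [barsAfterLast]

theorem barsAfterLast_insert {P : List Token} (h : .core y ∉ P) :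
    barsAfterLast y (u ++ v) ≤ barsAfterLast y (u ++ (P ++ v)) ∧
      barsAfterLast y (u ++ (P ++ v)) ≤ barsAfterLast y (u ++ v) + P.count (.bar y) := by
  rw [← List.append_assoc]
  by_cases hv : .core y ∈ v
  · simp only [barsAfterLast_append_of_mem hv]
    omega
  · simp only [barsAfterLast_append_of_notMem hv, barsAfterLast_append_of_notMem h]
    omega

theorem exists_last_of_mem {p : Token} (h : p ∈ w) : ∃ u v, w = u ++ p :: v ∧ p ∉ v := by
  obtain ⟨u, v, hw, hu⟩ := List.eq_append_cons_of_mem (List.mem_reverse.2 h)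
  refine ⟨v.reverse, u.reverse, ?_, by simpa using hu⟩
  rw [← List.reverse_reverse w, hw]
  simp

theorem le_lastRun {z : Token} (n : ℕ) (h : z ∉ v) :
    n ≤ lastRun z (u ++ (List.replicate n z ++ v)) := by
  rcases n with _ | n
  · exact Nat.zero_le _
  have hv : ∀ p ∈ v.reverse, decide (p ≠ z) = true := by
    rintro p hp
    have : p ≠ z := by rintro rfl; exact h (List.mem_reverse.1 hp)
    simpa
  simp only [lastRun, List.reverse_append, List.reverse_replicate, List.append_assoc,
    List.dropWhile_append_of_pos hv]
  rw [List.replicate_succ, List.cons_append, List.dropWhile_cons_of_neg (by simp),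
    ← List.cons_append, ← List.replicate_succ, List.takeWhile_append_of_pos (by simp)]
  simp

theorem IsBlockString.eq_bar_of_between {m : List Token} (hw : IsBlockString w)
    (h : w = u ++ .bar y :: (m ++ .bar y :: v)) (hm : .core y ∉ m) {p : Token} (hp : p ∈ m) :
    p = .bar y := by
  have letter_eq {q : Token} (hq : q ∈ m) {z : Core} (hz : q.letter = some z) : z = y :=
    le_antisymm
      (hw.letters_sorted (u := u ++ .bar y :: m) (v := .bar y :: v) (q := .bar y) (by simp [h])
        (by simp [hq]) (by simp) hz rfl)
      (hw.letters_sorted (u := u ++ [.bar y]) (v := m ++ .bar y :: v) (p := .bar y)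
        (by simp [h]) (by simp) (by simp [hq]) rfl hz)
  have hphase := hw.phase_sorted (u := u) (m := .bar y :: (m ++ [.bar y])) (v := v) (by simp [h])
    fun z hz => by
      have hzm : .core z ∈ m := by simpa using hz
      exact hm (letter_eq hzm rfl ▸ hzm)
  rw [List.pairwise_cons, List.pairwise_append] at hphase
  have hlow := hphase.1 p (by simp [hp])
  have hhigh := hphase.2.2.2 p hp (.bar y) (by simp)
  rcases p with z | z | _ | _
  · simp [Token.phase] at hlow
  · rw [letter_eq hp rfl]
  · simp [Token.phase] at hlow
  · simp [Token.phase] at hhigh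

theorem IsBlockString.eq_bar_of_square {P : List Token} (hw : IsBlockString w)
    (h : w = u ++ (P ++ (P ++ v))) (hb : .bar y ∈ P) (hy : .core y ∉ P) {p : Token}
    (hp : p ∈ P) : p = .bar y := by
  obtain ⟨α, β, rfl⟩ := List.append_of_mem hb
  have eq_bar {q : Token} (hq : q ∈ β ++ α) : q = .bar y :=
    hw.eq_bar_of_between (u := u ++ α) (v := β ++ v) (by simp [h])
      (by simp only [List.mem_append, List.mem_cons] at hy ⊢; tauto) hq
  simp only [List.mem_append, List.mem_cons] at hp eq_bar
  rcases hp with hp | hp | hp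
  exacts [eq_bar (.inr hp), hp, eq_bar (.inl hp)]

theorem IsBlockString.exists_replicate_bar (hw : IsBlockString w) (h : w = u ++ v)
    (hy : .core y ∉ v) : ∃ v₁ v₂, v = v₁ ++ (List.replicate (v.count (.bar y)) (.bar y) ++ v₂) ∧
      .bar y ∉ v₂ := by
  by_cases hb : .bar y ∈ v
  swap
  · exact ⟨[], v, by simp [List.count_eq_zero_of_not_mem hb], hb⟩
  obtain ⟨m, v₂, rfl, hv₂⟩ := exists_last_of_mem hb
  by_cases hbm : .bar y ∈ m
  · obtain ⟨v₁, m, rfl, hv₁⟩ := List.eq_append_cons_of_mem hbm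
    have hm : m = List.replicate m.length (.bar y) := List.eq_replicate_iff.2 ⟨rfl, fun p hp =>
      hw.eq_bar_of_between (u := u ++ v₁) (v := v₂) (by simp [h])
        (fun hm => hy (by simp [hm])) hp⟩
    have hcount : (v₁ ++ .bar y :: m ++ .bar y :: v₂).count (.bar y) = m.length + 1 + 1 := by
      rw [hm]
      simp [List.count_eq_zero_of_not_mem hv₁, List.count_eq_zero_of_not_mem hv₂]
    refine ⟨v₁, v₂, ?_, hv₂⟩
    rw [hcount, List.replicate_succ, List.replicate_succ', ← hm]
    simp
  · exact ⟨m, v₂, by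
      simp [List.count_eq_zero_of_not_mem hbm, List.count_eq_zero_of_not_mem hv₂], hv₂⟩

theorem IsBlockString.barsAfterLast_le_lastRun (hw : IsBlockString w) (hy : .core y ∈ w) :
    barsAfterLast y w ≤ lastRun (.bar y) w := by
  obtain ⟨u, v, rfl, hv⟩ := exists_last_of_mem hy
  obtain ⟨v₁, v₂, heq, hv₂⟩ := hw.exists_replicate_bar (List.append_cons u _ v) hv
  rw [barsAfterLast_append_cons_of_notMem hv]
  conv_rhs => rw [heq, ← List.cons_append, ← List.append_assoc]
  exact le_lastRun _ hv₂

end BarsAfterLast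

/-! ## Pumped families of strings -/

theorem le_of_forall_add_mul_le {a b c d : ℕ} (h : ∀ i, c + i * a ≤ d + i * b) : a ≤ b := by
  by_contra hab
  have hd := h (d + 1)
  have := Nat.mul_le_mul_left (d + 1) (show b + 1 ≤ a by omega)
  nlinarith

/-- The string `s₁ P₁ⁱ s₂ P₂ⁱ ⋯` for the list `[(s₁, P₁), (s₂, P₂), …]`. -/
def pumpedWord (L : List (List Token × List Token)) (i : ℕ) : List Token :=
  L.flatMap fun S => S.1 ++ (List.replicate i S.2).flatten

section PumpedWord

variable {L M : List (List Token × List Token)}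

theorem pumpedWord_append (i : ℕ) : pumpedWord (L ++ M) i = pumpedWord L i ++ pumpedWord M i :=
  List.flatMap_append

theorem countP_pumpedWord (f : Token → Bool) (L : List (List Token × List Token)) (i : ℕ) :
    (pumpedWord L i).countP f =
      (L.flatMap Prod.fst).countP f + i * (L.flatMap Prod.snd).countP f := by
  induction L with
  | nil => simp [pumpedWord]
  | cons S L ih =>
    rw [pumpedWord] at ih
    simp only [pumpedWord, List.flatMap_cons, List.countP_append, ih, List.countP_flatten,
      List.map_replicate, List.sum_replicate, smul_eq_mul]
    ring

theorem count_pumpedWord (p : Token) (L : List (List Token × List Token)) (i : ℕ) :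
    (pumpedWord L i).count p =
      (L.flatMap Prod.fst).count p + i * (L.flatMap Prod.snd).count p :=
  countP_pumpedWord _ L i

theorem barCount_pumpedWord (L : List (List Token × List Token)) (i : ℕ) :
    barCount (pumpedWord L i) =
      barCount (L.flatMap Prod.fst) + i * barCount (L.flatMap Prod.snd) :=
  countP_pumpedWord _ L i

theorem pumped_prefix_le (h : ∀ i, IsBlockString (pumpedWord (L ++ M) i)) :
    (L.flatMap Prod.snd).count .rbr ≤ barCount (L.flatMap Prod.snd) ∧
      barCount (L.flatMap Prod.snd) ≤ (L.flatMap Prod.snd).count .lbr := by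
  have hi i := (h i).prefix_le (pumpedWord_append i)
  simp only [count_pumpedWord, barCount_pumpedWord] at hi
  exact ⟨le_of_forall_add_mul_le fun i => (hi i).1, le_of_forall_add_mul_le fun i => (hi i).2⟩

theorem pumped_balanced (h : ∀ i, IsBlockString (pumpedWord L i)) :
    (L.flatMap Prod.snd).count .rbr = barCount (L.flatMap Prod.snd) ∧
      barCount (L.flatMap Prod.snd) = (L.flatMap Prod.snd).count .lbr := by
  have h0 := (h 0).balanced
  have h1 := (h 1).balanced
  simp only [count_pumpedWord, barCount_pumpedWord] at h0 h1
  omega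

theorem pumped_balanced_before_core {s P : List Token} {z : Core}
    (h : ∀ i, IsBlockString (pumpedWord (L ++ (s, P) :: M) i)) (hz : .core z ∈ s ++ P) :
    (L.flatMap Prod.snd).count .rbr = barCount (L.flatMap Prod.snd) ∧
      barCount (L.flatMap Prod.snd) = (L.flatMap Prod.snd).count .lbr := by
  obtain ⟨α, β, hs⟩ := List.append_of_mem hz
  have balanced (i : ℕ) := (h (i + 1)).balanced_before_core (z := z)
    (u := pumpedWord L (i + 1) ++ α)
    (v := β ++ ((List.replicate i P).flatten ++ pumpedWord M (i + 1))) (by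
      rw [pumpedWord_append, List.append_assoc, ← List.cons_append, ← List.append_assoc α, ← hs]
      simp [pumpedWord, List.replicate_succ])
  have h0 := balanced 0
  have h1 := balanced 1
  simp only [List.count_append, barCount_append, count_pumpedWord, barCount_pumpedWord] at h0 h1
  omega

theorem eq_bar_of_pumped {S : List Token × List Token} {y : Core} {p : Token}
    (h : ∀ i, IsBlockString (pumpedWord L i)) (hS : S ∈ L) (hb : .bar y ∈ S.2)
    (hy : .core y ∉ S.2) (hp : p ∈ S.2) : p = .bar y := by
  obtain ⟨L₁, L₂, rfl⟩ := List.append_of_mem hS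
  exact (h 2).eq_bar_of_square (u := pumpedWord L₁ 2 ++ S.1) (v := pumpedWord L₂ 2)
    (by simp [pumpedWord, List.replicate_succ]) hb hy hp

end PumpedWord

/-- The strings of the family `s₁ P₁ⁱ s₂ P₂ⁱ s₃ P₃ⁱ s₄ P₄ⁱ s₅`: the yields of the trees
`C₁[v^i[t₅]]` when `C₁`, `C₂`, `C₃`, `C₄` yield `(s₁, s₅)`, `(P₁, P₄)`, `(s₂, s₄)`, `(P₂, P₃)` and
`t₅` yields `s₃`. -/
structure PumpedFamily where
  (s₁ P₁ s₂ P₂ s₃ P₃ s₄ P₄ s₅ : List Token)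

namespace PumpedFamily

/-- The `i`-th string `s₁ P₁ⁱ s₂ P₂ⁱ s₃ P₃ⁱ s₄ P₄ⁱ s₅` of the family. -/
def word (F : PumpedFamily) : ℕ → List Token :=
  pumpedWord [(F.s₁, F.P₁), (F.s₂, F.P₂), (F.s₃, F.P₃), (F.s₄, F.P₄), (F.s₅, [])]

/-- The tokens added by one round of pumping. -/
def pumped (F : PumpedFamily) : List Token := F.P₁ ++ (F.P₂ ++ (F.P₃ ++ F.P₄))

/-- The yield of the pumped context `C₂[C₃[C₄]]`. -/
def context (F : PumpedFamily) : List Token :=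
  F.P₁ ++ (F.s₂ ++ (F.P₂ ++ (F.P₃ ++ (F.s₄ ++ F.P₄))))

variable {F : PumpedFamily} {y : Core}

theorem word_zero (F : PumpedFamily) :
    F.word 0 = F.s₁ ++ (F.s₂ ++ (F.s₃ ++ (F.s₄ ++ F.s₅))) := by
  simp [word, pumpedWord]

theorem word_one (F : PumpedFamily) :
    F.word 1 = F.s₁ ++ (F.P₁ ++ (F.s₂ ++ (F.P₂ ++ (F.s₃ ++ (F.P₃ ++
      (F.s₄ ++ (F.P₄ ++ F.s₅))))))) := by
  simp [word, pumpedWord]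

theorem countP_word_one (F : PumpedFamily) (f : Token → Bool) :
    (F.word 1).countP f = (F.word 0).countP f + F.pumped.countP f := by
  simp only [word_one, word_zero, pumped, List.countP_append]
  omega

theorem count_word_one (F : PumpedFamily) (p : Token) :
    (F.word 1).count p = (F.word 0).count p + F.pumped.count p :=
  F.countP_word_one _

theorem balanced (hF : ∀ i, IsBlockString (F.word i)) :
    F.pumped.count .rbr = barCount F.pumped ∧ barCount F.pumped = F.pumped.count .lbr := by
  simpa [pumped] using pumped_balanced hF

theorem two_mul_barCount_pumped_le (hF : ∀ i, IsBlockString (F.word i)) :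
    2 * barCount F.pumped ≤ F.context.length := by
  have hbal := balanced hF
  have hlen := count_rbr_add_barCount_le_length F.pumped
  simp only [pumped, context, List.length_append] at *
  omega

theorem prefix_one (hF : ∀ i, IsBlockString (F.word i)) :
    F.P₁.count .rbr ≤ barCount F.P₁ ∧ barCount F.P₁ ≤ F.P₁.count .lbr := by
  simpa using pumped_prefix_le (L := [(F.s₁, F.P₁)]) hF

theorem prefix_two (hF : ∀ i, IsBlockString (F.word i)) :
    (F.P₁ ++ F.P₂).count .rbr ≤ barCount (F.P₁ ++ F.P₂) ∧
      barCount (F.P₁ ++ F.P₂) ≤ (F.P₁ ++ F.P₂).count .lbr := by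
  simpa using pumped_prefix_le (L := [(F.s₁, F.P₁), (F.s₂, F.P₂)]) hF

theorem prefix_three (hF : ∀ i, IsBlockString (F.word i)) :
    (F.P₁ ++ (F.P₂ ++ F.P₃)).count .rbr ≤ barCount (F.P₁ ++ (F.P₂ ++ F.P₃)) ∧
      barCount (F.P₁ ++ (F.P₂ ++ F.P₃)) ≤ (F.P₁ ++ (F.P₂ ++ F.P₃)).count .lbr := by
  simpa using pumped_prefix_le (L := [(F.s₁, F.P₁), (F.s₂, F.P₂), (F.s₃, F.P₃)]) hF

theorem balanced_of_core_mem_s₂ (hF : ∀ i, IsBlockString (F.word i)) (hy : .core y ∈ F.s₂) :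
    F.P₁.count .rbr = barCount F.P₁ ∧ barCount F.P₁ = F.P₁.count .lbr := by
  simpa using pumped_balanced_before_core (L := [(F.s₁, F.P₁)]) hF (List.mem_append_left _ hy)

theorem balanced_of_core_mem_s₃ (hF : ∀ i, IsBlockString (F.word i)) (hy : .core y ∈ F.s₃) :
    (F.P₁ ++ F.P₂).count .rbr = barCount (F.P₁ ++ F.P₂) ∧
      barCount (F.P₁ ++ F.P₂) = (F.P₁ ++ F.P₂).count .lbr := by
  simpa using pumped_balanced_before_core (L := [(F.s₁, F.P₁), (F.s₂, F.P₂)]) hF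
    (List.mem_append_left _ hy)

theorem balanced_of_core_mem_s₄ (hF : ∀ i, IsBlockString (F.word i))
    (hy : .core y ∈ F.s₄ ++ F.P₄) :
    (F.P₁ ++ (F.P₂ ++ F.P₃)).count .rbr = barCount (F.P₁ ++ (F.P₂ ++ F.P₃)) ∧
      barCount (F.P₁ ++ (F.P₂ ++ F.P₃)) = (F.P₁ ++ (F.P₂ ++ F.P₃)).count .lbr := by
  simpa using pumped_balanced_before_core
    (L := [(F.s₁, F.P₁), (F.s₂, F.P₂), (F.s₃, F.P₃)]) hF hy

theorem eq_bar_of_mem (hF : ∀ i, IsBlockString (F.word i)) {P : List Token}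
    (hP : P ∈ [F.P₁, F.P₂, F.P₃, F.P₄]) (hb : .bar y ∈ P) (hy : .core y ∉ P) {p : Token}
    (hp : p ∈ P) : p = .bar y := by
  simp only [List.mem_cons, List.not_mem_nil, or_false] at hP
  rcases hP with rfl | rfl | rfl | rfl
  · exact eq_bar_of_pumped (S := (F.s₁, F.P₁)) hF (by simp) hb hy hp
  · exact eq_bar_of_pumped (S := (F.s₂, F.P₂)) hF (by simp) hb hy hp
  · exact eq_bar_of_pumped (S := (F.s₃, F.P₃)) hF (by simp) hb hy hp
  · exact eq_bar_of_pumped (S := (F.s₄, F.P₄)) hF (by simp) hb hy hp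

theorem homogeneous (hF : ∀ i, IsBlockString (F.word i)) {P : List Token}
    (hP : P ∈ [F.P₁, F.P₂, F.P₃, F.P₄]) (hb : .bar y ∈ P) (hy : .core y ∉ P) :
    P.count .lbr = 0 ∧ P.count .rbr = 0 ∧ 1 ≤ barCount P :=
  ⟨List.count_eq_zero.2 fun h => by simpa using eq_bar_of_mem hF hP hb hy h,
    List.count_eq_zero.2 fun h => by simpa using eq_bar_of_mem hF hP hb hy h,
    List.countP_pos_iff.2 ⟨_, hb, rfl⟩⟩

theorem inner_of_bar_pumped (hF : ∀ i, IsBlockString (F.word i)) (h₁ : .core y ∉ F.P₁)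
    (h₄ : .core y ∉ F.P₄) : .bar y ∉ F.P₁ ∧ .bar y ∉ F.P₄ := by
  have hone := prefix_one hF
  have hthree := prefix_three hF
  have hbal := balanced hF
  simp only [pumped, List.count_append, barCount_append] at *
  constructor <;> intro hb
  · have := homogeneous hF (P := F.P₁) (by simp) hb h₁
    omega
  · have := homogeneous hF (P := F.P₄) (by simp) hb h₄
    omega

theorem core_notMem_s₃ (hF : ∀ i, IsBlockString (F.word i)) (h₂ : .core y ∉ F.P₂)
    (h₃ : .core y ∉ F.P₃) (hb : .bar y ∈ F.P₂ ++ F.P₃) (z : Core) : .core z ∉ F.s₃ := by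
  intro hz
  have hone := prefix_one hF
  have hthree := prefix_three hF
  have hbal := balanced_of_core_mem_s₃ hF hz
  simp only [List.count_append, barCount_append] at *
  rcases List.mem_append.1 hb with hb | hb
  · have := homogeneous hF (P := F.P₂) (by simp) hb h₂
    omega
  · have := homogeneous hF (P := F.P₃) (by simp) hb h₃
    omega

section BarPumped

variable (hF : ∀ i, IsBlockString (F.word i)) (hs₁ : .core y ∉ F.s₁) (h₁ : .core y ∉ F.P₁)
  (h₂ : .core y ∉ F.P₂) (h₃ : .core y ∉ F.P₃) (hb : .bar y ∈ F.P₂ ++ F.P₃)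

include hF hs₁ h₁ h₂ h₃ hb

theorem core_mem_s₂ : .core y ∈ F.s₂ := by
  have hmem : .core y ∈ F.s₁ ++ (F.P₁ ++ (F.s₂ ++ (F.P₂ ++ (F.s₃ ++ F.P₃)))) :=
    (hF 1).core_mem_of_bar_mem (v := F.s₄ ++ (F.P₄ ++ F.s₅)) (by simp [word_one])
      (by simp only [List.mem_append] at hb ⊢; tauto)
  have := core_notMem_s₃ hF h₂ h₃ hb y
  simp only [List.mem_append] at hmem
  tauto

theorem bar_mem_P₃ : .bar y ∈ F.P₃ := by
  refine (List.mem_append.1 hb).resolve_left fun hb₂ => ?_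
  have htwo := prefix_two hF
  have hbal := balanced_of_core_mem_s₂ hF (core_mem_s₂ hF hs₁ h₁ h₂ h₃ hb)
  have := homogeneous hF (P := F.P₂) (by simp) hb₂ h₂
  simp only [List.count_append, barCount_append] at htwo
  omega

theorem core_notMem_s₄ (z : Core) : .core z ∉ F.s₄ ++ F.P₄ := by
  intro hz
  have hbal := balanced_of_core_mem_s₄ hF hz
  have htwo := prefix_two hF
  have := homogeneous hF (P := F.P₃) (by simp) (bar_mem_P₃ hF hs₁ h₁ h₂ h₃ hb) h₃
  simp only [List.count_append, barCount_append] at hbal htwo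
  omega

theorem core_notMem_of_lt {z : Core} (hz : y < z) :
    .core z ∉ F.s₁ ++ (F.P₁ ++ (F.s₂ ++ (F.P₂ ++ (F.s₃ ++ (F.P₃ ++ (F.s₄ ++ F.P₄)))))) := by
  have hb₃ := bar_mem_P₃ hF hs₁ h₁ h₂ h₃ hb
  have before : .core z ∉ F.s₁ ++ (F.P₁ ++ (F.s₂ ++ (F.P₂ ++ F.s₃))) := fun hmem =>
    hz.not_ge ((hF 1).letters_sorted (u := F.s₁ ++ (F.P₁ ++ (F.s₂ ++ (F.P₂ ++ F.s₃))))
      (v := F.P₃ ++ (F.s₄ ++ (F.P₄ ++ F.s₅))) (by simp [word_one]) hmem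
      (List.mem_append_left _ hb₃) rfl rfl)
  have inside : .core z ∉ F.P₃ := fun hmem => by
    simpa using eq_bar_of_mem hF (P := F.P₃) (by simp) hb₃ h₃ hmem
  have after := core_notMem_s₄ hF hs₁ h₁ h₂ h₃ hb z
  simp only [List.mem_append] at before after ⊢
  tauto

theorem count_rbr_s₃_eq_zero : F.s₃.count .rbr = 0 := by
  have hb₃ := bar_mem_P₃ hF hs₁ h₁ h₂ h₃ hb
  have hphase := (hF 1).phase_sorted (u := F.s₁ ++ (F.P₁ ++ (F.s₂ ++ F.P₂)))
    (m := F.s₃ ++ F.P₃) (v := F.s₄ ++ (F.P₄ ++ F.s₅)) (by simp [word_one]) fun z hz => by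
      rcases List.mem_append.1 hz with hz | hz
      · exact core_notMem_s₃ hF h₂ h₃ hb z hz
      · simpa using eq_bar_of_mem hF (P := F.P₃) (by simp) hb₃ h₃ hz
  exact List.count_eq_zero.2 fun hr =>
    absurd ((List.pairwise_append.1 hphase).2.2 _ hr _ hb₃) (by simp [Token.phase])

end BarPumped

end PumpedFamily

/-! ## Closing brackets to the right of a context -/

/-- The number of tokens `⟩` of `r`, minus the number of its barred letters other than `ȳ`. -/
def closingSurplus (y : Core) (r : List Token) : ℤ :=
  r.count .rbr + r.count (.bar y) - barCount r

theorem closingSurplus_append (y : Core) (u v : List Token) :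
    closingSurplus y (u ++ v) = closingSurplus y u + closingSurplus y v := by
  simp only [closingSurplus, List.count_append, barCount_append]
  push_cast
  ring

/-- No letter after `y` in the alphabetical order occurs in `u`. -/
def NoLetterAfter (y : Core) (u : List Token) : Prop :=
  ∀ z : Core, y < z → .core z ∉ u

/-- The number of barred letters after `ȳ` in the alphabetical order. -/
def laterBarCount (y : Core) (w : List Token) : ℕ :=
  w.countP fun | .bar z => decide (y < z) | _ => false

theorem laterBarCount_add_count_bar_le (y : Core) (w : List Token) :
    laterBarCount y w + w.count (.bar y) ≤ barCount w := by
  induction w with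
  | nil => simp [laterBarCount, barCount]
  | cons p w ih =>
    simp only [laterBarCount, barCount] at ih
    simp only [laterBarCount, barCount, List.countP_cons, List.count_cons]
    rcases p with z | z | _ | _
    · simpa [Token.isBar] using ih
    · by_cases hzy : z = y
      · simp [Token.isBar, hzy]
        omega
      · by_cases hlt : y < z <;> simp [Token.isBar, hzy, hlt] <;> omega
    · simpa [Token.isBar] using ih
    · simpa [Token.isBar] using ih

namespace IsBlockString

variable {y : Core} {w u v q r : List Token}

theorem barCount_eq_count_bar (hw : IsBlockString w) (h : w = u ++ (q ++ v)) (hy : .core y ∈ u)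
    (hu : NoLetterAfter y (u ++ q)) : barCount q = q.count (.bar y) := by
  refine List.countP_congr fun p hp => ?_
  rcases p with z | z | _ | _ <;> simp only [Token.isBar, beq_iff_eq, reduceCtorEq, true_iff]
  have hyz : y ≤ z := hw.letters_sorted h hy (List.mem_append_left _ hp) rfl rfl
  have hz : .core z ∈ u ++ q :=
    hw.core_mem_of_bar_mem (v := v) (by simpa using h) (List.mem_append_right _ hp)
  rw [hyz.antisymm (not_lt.1 fun hlt => hu z hlt hz)]

theorem balanced_after_core (hw : IsBlockString w) (h : w = u ++ .core y :: v) :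
    v.count .rbr = barCount v := by
  have hbefore := hw.balanced_before_core h
  have hall := hw.balanced
  simp only [h, barCount, List.count_append, List.countP_append, List.count_cons,
    List.countP_cons] at hbefore hall ⊢
  simp [Token.isBar] at hall
  omega

theorem barCount_suffix_le (hw : IsBlockString (u ++ r)) : barCount r ≤ r.count .rbr := by
  have hprefix := hw.prefix_le rfl
  have hall := hw.balanced
  simp only [List.count_append, barCount_append] at hall
  omega

theorem closingSurplus_le_barsAfterLast (hw : IsBlockString (u ++ r)) (hy : .core y ∈ u)
    (hr : .core y ∉ r) (hu : NoLetterAfter y u) :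
    closingSurplus y r ≤ barsAfterLast y (u ++ r) := by
  obtain ⟨α, v, rfl, hv⟩ := exists_last_of_mem hy
  have hbal := hw.balanced_after_core (u := α) (v := v ++ r) (y := y) (by simp)
  have hbar := hw.barCount_eq_count_bar (u := α ++ [.core y]) (q := v) (v := r) (y := y)
    (by simp) (by simp) (by simpa using hu)
  rw [barsAfterLast_append_of_notMem hr, barsAfterLast_append_cons_of_notMem hv, closingSurplus]
  simp only [List.count_append, barCount_append] at hbal
  omega

theorem noLetterAfter_of_bar_mem (hw : IsBlockString (u ++ r)) (hb : .bar y ∈ r) :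
    NoLetterAfter y u := fun _ hz hzu => hz.not_ge (hw.letters_sorted rfl hzu hb rfl rfl)

theorem count_rbr_eq_zero_of_lbr {α v₁ v₂ v₃ : List Token} (hw : IsBlockString w)
    (h : w = α ++ .core y :: (u ++ (v₁ ++ .lbr :: (v₂ ++ .bar y :: v₃))))
    (hy : .core y ∉ u ++ (v₁ ++ v₂)) : u.count .rbr = 0 := by
  have hphase := hw.phase_sorted (u := α ++ [.core y]) (m := u ++ (v₁ ++ .lbr :: v₂))
    (v := .bar y :: v₃) (by simp [h]) fun z hz => by
      have hyz : y ≤ z := hw.letters_sorted (u := α ++ [.core y])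
        (v := u ++ (v₁ ++ .lbr :: v₂) ++ .bar y :: v₃) (by simp [h]) (p := .core y) (by simp)
        (List.mem_append_left _ hz) rfl rfl
      have hzy : z ≤ y := hw.letters_sorted
        (u := α ++ .core y :: (u ++ (v₁ ++ .lbr :: v₂))) (v := .bar y :: v₃) (by simp [h])
        (p := .core z) (by simp only [List.mem_append, List.mem_cons] at hz ⊢; tauto)
        (q := .bar y) (by simp) rfl rfl
      obtain rfl := hyz.antisymm hzy
      exact hy (by simpa using hz)
  exact List.count_eq_zero.2 fun hr =>
    absurd ((List.pairwise_append.1 hphase).2.2 _ hr .lbr (by simp)) (by simp [Token.phase])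

theorem count_bar_le_of_first {α : List Token} (hw : IsBlockString w)
    (h : w = α ++ .core y :: (v ++ r)) (hα : .core y ∉ α) :
    w.count (.bar y) ≤ v.count .rbr + closingSurplus y r := by
  have hbar : .bar y ∉ α := fun hb => hα (hw.core_mem_of_bar_mem h hb)
  have hbal := hw.balanced_after_core h
  have hle := count_bar_le_barCount y v
  rw [h, closingSurplus]
  simp only [List.count_append, barCount_append, List.count_cons, beq_iff_eq, reduceCtorEq,
    if_false, List.count_eq_zero_of_not_mem hbar] at hbal ⊢
  omega

end IsBlockString

/-! ## One pumping step seen from a context -/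

/-- A string `left mid right`, where `left` and `right` are generated by a context with `edges`
edges of a fixed label. -/
structure Cut where
  (left mid right : List Token)
  (edges : ℕ)

/-- `PumpedCut F e₂ e₄ c₀ c₁`: the cut `c₁` of `F.word 1` becomes the cut `c₀` of `F.word 0` when
the pumped part is removed. The contexts that yield `(P₁, P₄)` and `(P₂, P₃)` have `e₂` and `e₄`
edges. There is one case for each position of the hole of the cutting context. -/
inductive PumpedCut (F : PumpedFamily) (e₂ e₄ : ℕ) : Cut → Cut → Prop
  | left (α m r : List Token) (e : ℕ) (h : F.s₅ = α ++ (m ++ r)) :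
      PumpedCut F e₂ e₄ ⟨F.s₁ ++ (F.s₂ ++ (F.s₃ ++ (F.s₄ ++ α))), m, r, e⟩
        ⟨F.s₁ ++ (F.P₁ ++ (F.s₂ ++ (F.P₂ ++ (F.s₃ ++ (F.P₃ ++ (F.s₄ ++ (F.P₄ ++ α))))))), m, r,
          e + e₂ + e₄⟩
  | right (l m α : List Token) (e : ℕ) (h : F.s₁ = l ++ (m ++ α)) :
      PumpedCut F e₂ e₄ ⟨l, m, α ++ (F.s₂ ++ (F.s₃ ++ (F.s₄ ++ F.s₅))), e⟩
        ⟨l, m, α ++ (F.P₁ ++ (F.s₂ ++ (F.P₂ ++ (F.s₃ ++ (F.P₃ ++ (F.s₄ ++ (F.P₄ ++ F.s₅))))))),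
          e + e₂ + e₄⟩
  | above (l α β r : List Token) (e : ℕ) (h₁ : F.s₁ = l ++ α) (h₅ : F.s₅ = β ++ r) :
      PumpedCut F e₂ e₄ ⟨l, α ++ (F.s₂ ++ (F.s₃ ++ (F.s₄ ++ β))), r, e⟩
        ⟨l, α ++ (F.P₁ ++ (F.s₂ ++ (F.P₂ ++ (F.s₃ ++ (F.P₃ ++ (F.s₄ ++ (F.P₄ ++ β))))))), r, e⟩
  | outer (p p' q' q : List Token) (e d : ℕ) (h₁ : F.P₁ = p ++ p') (h₄ : F.P₄ = q' ++ q)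
      (hd : d ≤ e₂) :
      PumpedCut F e₂ e₄ ⟨F.s₁, F.s₂ ++ (F.s₃ ++ F.s₄), F.s₅, e⟩
        ⟨F.s₁ ++ p, p' ++ (F.s₂ ++ (F.P₂ ++ (F.s₃ ++ (F.P₃ ++ (F.s₄ ++ q'))))), q ++ F.s₅, e + d⟩
  | between (p p' q' q : List Token) (e : ℕ) (h₂ : F.s₂ = p ++ p') (h₄ : F.s₄ = q' ++ q) :
      PumpedCut F e₂ e₄ ⟨F.s₁ ++ p, p' ++ (F.s₃ ++ q'), q ++ F.s₅, e⟩
        ⟨F.s₁ ++ (F.P₁ ++ p), p' ++ (F.P₂ ++ (F.s₃ ++ (F.P₃ ++ q'))), q ++ (F.P₄ ++ F.s₅), e + e₂⟩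
  | inner (p p' q' q : List Token) (e d : ℕ) (h₂ : F.P₂ = p ++ p') (h₃ : F.P₃ = q' ++ q)
      (hd : d ≤ e₄) :
      PumpedCut F e₂ e₄ ⟨F.s₁ ++ F.s₂, F.s₃, F.s₄ ++ F.s₅, e⟩
        ⟨F.s₁ ++ (F.P₁ ++ (F.s₂ ++ p)), p' ++ (F.s₃ ++ q'), q ++ (F.s₄ ++ (F.P₄ ++ F.s₅)),
          e + e₂ + d⟩
  | below (p m q : List Token) (e : ℕ) (h₃ : F.s₃ = p ++ (m ++ q)) :
      PumpedCut F e₂ e₄ ⟨F.s₁ ++ (F.s₂ ++ p), m, q ++ (F.s₄ ++ F.s₅), e⟩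
        ⟨F.s₁ ++ (F.P₁ ++ (F.s₂ ++ (F.P₂ ++ p))), m, q ++ (F.P₃ ++ (F.s₄ ++ (F.P₄ ++ F.s₅))),
          e + e₂ + e₄⟩

namespace PumpedCut

variable {F : PumpedFamily} {e₂ e₄ : ℕ} {c₀ c₁ : Cut}

theorem word_zero (H : PumpedCut F e₂ e₄ c₀ c₁) :
    F.word 0 = c₀.left ++ c₀.mid ++ c₀.right := by
  rw [F.word_zero]
  cases H <;> simp_all

theorem word_one (H : PumpedCut F e₂ e₄ c₀ c₁) : F.word 1 = c₁.left ++ c₁.mid ++ c₁.right := by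
  rw [F.word_one]
  cases H <;> simp_all

theorem count_left_le (H : PumpedCut F e₂ e₄ c₀ c₁) (p : Token) :
    c₀.left.count p ≤ c₁.left.count p := by
  cases H <;> simp only [List.count_append] <;> omega

theorem count_right_le (H : PumpedCut F e₂ e₄ c₀ c₁) (p : Token) :
    c₀.right.count p ≤ c₁.right.count p := by
  cases H <;> simp only [List.count_append] <;> omega

theorem count_le (H : PumpedCut F e₂ e₄ c₀ c₁) (p : Token) :
    c₁.left.count p + c₁.right.count p ≤
      c₀.left.count p + c₀.right.count p + F.pumped.count p := by
  cases H <;> simp only [PumpedFamily.pumped, List.count_append, *] <;> omega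

theorem edges_le_edges (H : PumpedCut F e₂ e₄ c₀ c₁) : c₀.edges ≤ c₁.edges := by
  cases H <;> simp only <;> omega

theorem edges_le (H : PumpedCut F e₂ e₄ c₀ c₁) : c₁.edges ≤ c₀.edges + e₂ + e₄ := by
  cases H <;> simp only <;> omega

theorem core_notMem_of_notMem (H : PumpedCut F e₂ e₄ c₀ c₁) {y : Core}
    (hl : .core y ∉ c₁.left) (hr : .core y ∉ c₁.right) :
    .core y ∉ c₀.left ∧ .core y ∉ c₀.right := by
  have := H.count_left_le (.core y)
  have := H.count_right_le (.core y)
  simp only [← List.count_eq_zero] at *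
  omega

end PumpedCut

namespace PumpedFamily

variable {F : PumpedFamily} {y : Core}

theorem barsAfterLast_word_le (hy : .core y ∉ F.pumped) :
    barsAfterLast y (F.word 0) ≤ barsAfterLast y (F.word 1) := by
  simp only [pumped, List.mem_append, not_or] at hy
  obtain ⟨h₁, h₂, h₃, h₄⟩ := hy
  rw [F.word_zero, F.word_one]
  have i₁ := (barsAfterLast_insert h₁ (u := F.s₁) (v := F.s₂ ++ (F.s₃ ++ (F.s₄ ++ F.s₅)))).1
  have i₂ := (barsAfterLast_insert h₂ (u := F.s₁ ++ (F.P₁ ++ F.s₂))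
    (v := F.s₃ ++ (F.s₄ ++ F.s₅))).1
  have i₃ := (barsAfterLast_insert h₃ (u := F.s₁ ++ (F.P₁ ++ (F.s₂ ++ (F.P₂ ++ F.s₃))))
    (v := F.s₄ ++ F.s₅)).1
  have i₄ := (barsAfterLast_insert h₄
    (u := F.s₁ ++ (F.P₁ ++ (F.s₂ ++ (F.P₂ ++ (F.s₃ ++ (F.P₃ ++ F.s₄)))))) (v := F.s₅)).1
  simp only [List.append_assoc] at i₂ i₃ i₄
  exact ((i₁.trans i₂).trans i₃).trans i₄

theorem exists_lbr_before_bar (hF : ∀ i, IsBlockString (F.word i)) (h₂ : .core y ∉ F.P₂)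
    (h₃ : .core y ∉ F.P₃) (hb : .bar y ∈ F.P₂ ++ F.P₃) :
    ∃ v₁ v₂ v₃, F.P₁ ++ (F.s₂ ++ (F.P₂ ++ (F.s₃ ++ (F.P₃ ++ (F.s₄ ++ (F.P₄ ++ F.s₅)))))) =
      v₁ ++ .lbr :: (v₂ ++ .bar y :: v₃) := by
  have htwo := prefix_two hF
  have hthree := prefix_three hF
  simp only [List.count_append, barCount_append] at htwo hthree
  rcases List.mem_append.1 hb with hb | hb
  · have hhom := homogeneous hF (P := F.P₂) (by simp) hb h₂
    have hlbr : 0 < F.P₁.count .lbr := by omega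
    obtain ⟨α, β, h₁⟩ := List.append_of_mem (List.count_pos_iff.1 hlbr)
    obtain ⟨γ, δ, h₂⟩ := List.append_of_mem hb
    exact ⟨α, β ++ (F.s₂ ++ γ), δ ++ (F.s₃ ++ (F.P₃ ++ (F.s₄ ++ (F.P₄ ++ F.s₅)))),
      by simp [h₁, h₂]⟩
  · have hhom := homogeneous hF (P := F.P₃) (by simp) hb h₃
    have hlbr : .lbr ∈ F.P₁ ++ (F.s₂ ++ F.P₂) := by
      rw [← List.count_pos_iff, List.count_append, List.count_append]
      omega
    obtain ⟨α, β, h₁⟩ := List.append_of_mem hlbr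
    obtain ⟨γ, δ, h₃⟩ := List.append_of_mem hb
    refine ⟨α, β ++ (F.s₃ ++ γ), δ ++ (F.s₄ ++ (F.P₄ ++ F.s₅)), ?_⟩
    rw [h₃, ← List.append_assoc F.s₂, ← List.append_assoc F.P₁, h₁]
    simp

theorem closingSurplus_le_of_later_core (hF : ∀ i, IsBlockString (F.word i)) {z : Core}
    {u r α v : List Token} (h₀ : F.word 0 = u ++ r) (hu : NoLetterAfter y u)
    (h₁ : F.word 1 = α ++ .core z :: v) (hz : y < z) (hv : r.count .rbr ≤ v.count .rbr) :
    closingSurplus y r ≤ barCount F.pumped := by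
  have hbal := (hF 1).balanced_after_core h₁
  have hlater : barCount v ≤ laterBarCount y (F.word 1) := by
    have hv : barCount v ≤ laterBarCount y v := List.countP_mono_left fun p hp hbar => by
      rcases p with z' | z' | _ | _ <;> simp only [Token.isBar, Bool.false_eq_true] at hbar
      have hzz' : z ≤ z' := (hF 1).letters_sorted (u := α ++ [.core z]) (v := v)
        (p := .core z) (q := .bar z') (by simp [h₁]) (by simp) hp rfl rfl
      exact decide_eq_true (hz.trans_le hzz')
    refine hv.trans (List.Sublist.countP_le ?_)
    rw [h₁]
    exact (List.sublist_cons_self _ _).trans (List.sublist_append_right _ _)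
  have hword : laterBarCount y (F.word 1) =
      laterBarCount y u + laterBarCount y r + laterBarCount y F.pumped := by
    rw [laterBarCount, F.countP_word_one, h₀, List.countP_append]
    rfl
  have hzero : laterBarCount y u = 0 := List.countP_eq_zero.2 fun p hp hbar => by
    rcases p with z' | z' | _ | _ <;> simp only [decide_eq_true_eq, Bool.false_eq_true] at hbar
    exact hu z' hbar ((hF 0).core_mem_of_bar_mem h₀ hp)
  have := laterBarCount_add_count_bar_le y r
  have := laterBarCount_add_count_bar_le y F.pumped
  rw [closingSurplus]
  omega

end PumpedFamily

namespace PumpedCut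

variable {F : PumpedFamily} {y : Core} {e₂ e₄ : ℕ} {c₀ c₁ : Cut}

theorem exists_suffix (hF : ∀ i, IsBlockString (F.word i)) (H : PumpedCut F e₂ e₄ c₀ c₁)
    (y : Core) : ∃ q s, c₁.right = q ++ s ∧ c₀.right.count .rbr ≤ s.count .rbr ∧
      closingSurplus y c₀.right ≤ closingSurplus y s := by
  have htwo := PumpedFamily.prefix_two hF
  have hthree := PumpedFamily.prefix_three hF
  have hbal := PumpedFamily.balanced hF
  simp only [PumpedFamily.pumped, List.count_append, barCount_append] at htwo hthree hbal
  cases H with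
  | left α m r e h => exact ⟨[], r, rfl, le_rfl, le_rfl⟩
  | above l α β r e h₁ h₅ => exact ⟨[], r, rfl, le_rfl, le_rfl⟩
  | outer p p' q' q e d h₁ h₄ hd => exact ⟨q, F.s₅, rfl, le_rfl, le_rfl⟩
  | inner p p' q' q e d h₂ h₃ hd =>
    refine ⟨q, F.s₄ ++ (F.P₄ ++ F.s₅), rfl, ?_, ?_⟩ <;>
      simp only [closingSurplus, List.count_append, barCount_append] <;> omega
  | _ =>
    refine ⟨[], _, (List.nil_append _).symm, ?_, ?_⟩ <;>
      simp only [closingSurplus, List.count_append, barCount_append] <;> omega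

theorem closingSurplus_mono_or_le (hF : ∀ i, IsBlockString (F.word i))
    (H : PumpedCut F e₂ e₄ c₀ c₁) (hy : .core y ∈ c₁.left ++ c₁.mid)
    (hu : NoLetterAfter y (c₀.left ++ c₀.mid)) :
    (NoLetterAfter y (c₁.left ++ c₁.mid) ∧
      closingSurplus y c₀.right ≤ closingSurplus y c₁.right) ∨
      closingSurplus y c₀.right ≤ barCount F.pumped := by
  obtain ⟨q, s, hright, hrbr, hsurplus⟩ := H.exists_suffix hF y
  have hword : F.word 1 = c₁.left ++ c₁.mid ++ (q ++ s) := hright ▸ H.word_one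
  by_cases hq : NoLetterAfter y (c₁.left ++ c₁.mid ++ q)
  · refine .inl ⟨fun z hz hmem => hq z hz (List.mem_append_left _ hmem), hsurplus.trans ?_⟩
    have := (hF 1).barCount_eq_count_bar hword hy hq
    rw [hright, closingSurplus_append, closingSurplus, closingSurplus]
    omega
  · right
    simp only [NoLetterAfter, not_forall, not_not] at hq
    obtain ⟨z, hz, hmem⟩ := hq
    obtain ⟨α, β, hαβ⟩ := List.append_of_mem hmem
    refine PumpedFamily.closingSurplus_le_of_later_core hF H.word_zero hu (α := α)
      (v := β ++ s) ?_ hz ?_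
    · rw [hword, ← List.append_assoc, hαβ]
      simp
    · rw [List.count_append]
      omega

end PumpedCut

section Step

variable {F : PumpedFamily} {x y : Core} {e₂ e₄ l₀ : ℕ} {c₀ c₁ : Cut}

theorem notMem_pumped_of_count_eq
    (hxy : ∀ i, (F.word i).count (.core x) = (F.word i).count (.core y))
    (hx : .core x ∉ F.pumped) : .core y ∉ F.pumped := by
  have h0 := hxy 0
  have h1 := hxy 1
  rw [F.count_word_one, F.count_word_one] at h1
  rw [← List.count_eq_zero] at hx ⊢
  omega

theorem count_mul_add_le_of_mem_pumped (hx : .core x ∈ F.pumped) :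
    (F.word 0).count (.core x) * l₀ + l₀ ≤ (F.word 1).count (.core x) * l₀ := by
  rw [F.count_word_one, Nat.add_mul]
  have := Nat.le_mul_of_pos_left l₀ (List.count_pos_iff.2 hx)
  omega

theorem count_eq_of_notMem_pumped (hx : .core x ∉ F.pumped) :
    (F.word 1).count (.core x) = (F.word 0).count (.core x) := by
  rw [F.count_word_one, List.count_eq_zero_of_not_mem hx, add_zero]

-- If `x̄` is pumped but `x` is not, then all pumped tokens `x̄` are in `P₂` or `P₃`, and no core
-- letter separates these two strings, while the part `mid` in the hole contains a `y`. So the hole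
-- is neither in `C₄` nor below it, and tokens and edges `x̄` are removed from the context together.
theorem bars_le_edges_of_notMem_pumped (hF : ∀ i, IsBlockString (F.word i))
    (H : PumpedCut F e₂ e₄ c₀ c₁) (he : e₂ + e₄ = F.pumped.count (.bar x))
    (hx : .core x ∉ F.pumped) (hb : .bar x ∈ F.pumped) (hy : .core y ∉ F.pumped)
    (hmid : .core y ∈ c₁.mid) {A : ℕ}
    (ih : c₀.left.count (.bar x) + c₀.right.count (.bar x) ≤ c₀.edges + A) :
    c₁.left.count (.bar x) + c₁.right.count (.bar x) ≤ c₁.edges + A := by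
  simp only [PumpedFamily.pumped, List.mem_append, not_or, List.count_append] at hx hb hy he
  obtain ⟨x₁, x₂, x₃, x₄⟩ := hx
  obtain ⟨b₁, b₄⟩ := PumpedFamily.inner_of_bar_pumped hF x₁ x₄
  have hs₃ := PumpedFamily.core_notMem_s₃ hF x₂ x₃ (by simp only [List.mem_append]; tauto) y
  rw [← List.count_eq_zero] at b₁ b₄
  cases H with
  | inner p p' q' q e d h₂ h₃ hd =>
    simp only [h₂, h₃, List.mem_append] at hy hmid
    tauto
  | below p m q e h₃ =>
    simp only [h₃, List.mem_append] at hs₃ hmid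
    tauto
  | outer p p' q' q e d h₁ h₄ hd =>
    simp only [h₁, h₄, List.count_append] at b₁ b₄ ih ⊢
    omega
  | _ =>
    simp only [List.count_append] at ih ⊢
    omega

theorem bars_le_edges_step (hF : ∀ i, IsBlockString (F.word i))
    (hxy : ∀ i, (F.word i).count (.core x) = (F.word i).count (.core y))
    (H : PumpedCut F e₂ e₄ c₀ c₁) (he : e₂ + e₄ = F.pumped.count (.bar x))
    (hl₀ : F.context.length ≤ l₀) (hmid : .core y ∈ c₁.mid)
    (ih : c₀.left.count (.bar x) + c₀.right.count (.bar x) ≤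
      c₀.edges + (F.word 0).count (.core x) * l₀) :
    c₁.left.count (.bar x) + c₁.right.count (.bar x) ≤
      c₁.edges + (F.word 1).count (.core x) * l₀ := by
  have hcount := H.count_le (.bar x)
  have hedges := H.edges_le_edges
  by_cases hx : .core x ∈ F.pumped
  · have hA := count_mul_add_le_of_mem_pumped (l₀ := l₀) hx
    have := count_bar_le_barCount x F.pumped
    have := PumpedFamily.two_mul_barCount_pumped_le hF
    omega
  rw [count_eq_of_notMem_pumped hx]
  by_cases hb : .bar x ∈ F.pumped
  · exact bars_le_edges_of_notMem_pumped hF H he hx hb (notMem_pumped_of_count_eq hxy hx) hmid ih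
  · rw [← List.count_eq_zero] at hb
    omega

end Step

/-! ## Edges of a context without `y` -/

/-- The invariant of the induction that bounds the number `e` of edges `ȳ` of a context without
tokens `y`. The context generates `r` on the right and is a part of a tree that generates `u r`;
the parameter `A` is the number of tokens `x`, times `l₀`. The bound in terms of `barsAfterLast` is
the one that is needed in the end, but it survives a pumping step only together with the second
one. -/
def EdgeBound (y : Core) (l₀ A e : ℕ) (u r : List Token) : Prop :=
  e ≤ A + barsAfterLast y (u ++ r) ∧
    ((NoLetterAfter y u ∧ (e : ℤ) ≤ A + closingSurplus y r) ∨ 2 * e ≤ 2 * A + l₀)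

section EdgeBound

variable {y : Core} {l₀ A e : ℕ} {u r : List Token}

theorem edgeBound_of_closingSurplus (hw : IsBlockString (u ++ r)) (hy : .core y ∈ u)
    (hr : .core y ∉ r) (hu : NoLetterAfter y u) (he : (e : ℤ) ≤ A + closingSurplus y r) :
    EdgeBound y l₀ A e u r := by
  have := hw.closingSurplus_le_barsAfterLast hy hr hu
  exact ⟨by omega, .inl ⟨hu, he⟩⟩

theorem edgeBound_of_count_bar (hw : IsBlockString (u ++ r)) (hr : .core y ∉ r)
    (he : e ≤ A + r.count (.bar y)) : EdgeBound y l₀ A e u r := by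
  refine ⟨?_, ?_⟩
  · rw [barsAfterLast_append_of_notMem hr]
    omega
  by_cases hb : .bar y ∈ r
  · have := hw.barCount_suffix_le
    refine .inl ⟨hw.noLetterAfter_of_bar_mem hb, ?_⟩
    rw [closingSurplus]
    omega
  · rw [List.count_eq_zero_of_not_mem hb] at he
    exact .inr (by omega)

theorem edgeBound_of_lbr_before_bar {v₁ v₂ v₃ : List Token} (hw : IsBlockString (u ++ r))
    (hy : .core y ∈ u) (hr : .core y ∉ r) (h : r = v₁ ++ .lbr :: (v₂ ++ .bar y :: v₃))
    (he : e ≤ A + barsAfterLast y (u ++ r)) : EdgeBound y l₀ A e u r := by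
  refine ⟨he, .inl ⟨hw.noLetterAfter_of_bar_mem (by simp [h]), ?_⟩⟩
  obtain ⟨α, v, rfl, hv⟩ := exists_last_of_mem hy
  rw [barsAfterLast_append_of_notMem hr, barsAfterLast_append_cons_of_notMem hv] at he
  have hbal := hw.balanced_after_core (u := α) (y := y) (v := v ++ r) (by simp)
  have hrbr : v.count .rbr = 0 := by
    refine hw.count_rbr_eq_zero_of_lbr (α := α) (y := y) (v₁ := v₁) (v₂ := v₂) (v₃ := v₃)
      (by simp [h]) ?_
    simp only [h, List.mem_append, List.mem_cons] at hr ⊢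
    tauto
  have := count_bar_le_barCount y v
  simp only [List.count_append, barCount_append] at hbal
  rw [closingSurplus]
  omega

end EdgeBound

-- The hole of the context is between the pumped tokens `ȳ`: the first `y` is in `s₂`, and all
-- closing brackets between this token and the end of the context are among those of the pumped
-- context.
theorem PumpedFamily.edgeBound_of_inside {F : PumpedFamily} {y : Core} {l₀ A e : ℕ}
    {v r β : List Token} (hF : ∀ i, IsBlockString (F.word i)) (hs₁ : .core y ∉ F.s₁)
    (h₁ : .core y ∉ F.P₁) (h₂ : .core y ∉ F.P₂) (h₃ : .core y ∉ F.P₃)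
    (hb : .bar y ∈ F.P₂ ++ F.P₃) (hw : F.word 1 = F.s₁ ++ (F.P₁ ++ (F.s₂ ++ v)) ++ r)
    (hv : v ++ β = F.P₂ ++ (F.s₃ ++ (F.P₃ ++ (F.s₄ ++ F.P₄)))) (hr : .core y ∉ r)
    (hl₀ : F.context.length ≤ l₀) (hA : l₀ ≤ A) (he : e ≤ (F.word 1).count (.bar y)) :
    EdgeBound y l₀ A e (F.s₁ ++ (F.P₁ ++ (F.s₂ ++ v))) r := by
  have hy := core_mem_s₂ hF hs₁ h₁ h₂ h₃ hb
  have hlater : NoLetterAfter y (F.s₁ ++ (F.P₁ ++ (F.s₂ ++ v))) := fun z hz hmem => by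
    refine core_notMem_of_lt hF hs₁ h₁ h₂ h₃ hb hz ?_
    rw [← hv]
    simp only [List.mem_append] at hmem ⊢
    tauto
  obtain ⟨σ, τ, hs₂, hσ⟩ := List.eq_append_cons_of_mem hy
  have hfirst := (hF 1).count_bar_le_of_first (α := F.s₁ ++ (F.P₁ ++ σ)) (v := τ ++ v) (r := r)
    (y := y) (by simp [hw, hs₂]) (by simp only [List.mem_append]; tauto)
  have hrbr : (τ ++ v).count .rbr ≤ F.context.length := by
    have hs₃ := count_rbr_s₃_eq_zero hF hs₁ h₁ h₂ h₃ hb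
    have hlen : F.context.count .rbr ≤ F.context.length := List.count_le_length
    have hcount := congrArg (List.count Token.rbr) hv
    have hcount₂ := congrArg (List.count Token.rbr) hs₂
    simp only [context, List.count_append, List.count_cons] at hlen hcount hcount₂ ⊢
    omega
  refine edgeBound_of_closingSurplus (hw ▸ hF 1) ?_ hr hlater (by omega)
  simp only [List.mem_append]
  tauto

section EdgeBoundStep

variable {F : PumpedFamily} {x y : Core} {e₂ e₄ l₀ : ℕ} {c₀ c₁ : Cut}

theorem edgeBound_step_of_mem_pumped (hF : ∀ i, IsBlockString (F.word i))
    (H : PumpedCut F e₂ e₄ c₀ c₁) (he : e₂ + e₄ = F.pumped.count (.bar y))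
    (hl₀ : F.context.length ≤ l₀) (hx : .core x ∈ F.pumped)
    (hy : .core y ∈ c₁.left ++ c₁.mid) (hr : .core y ∉ c₁.right)
    (ih : EdgeBound y l₀ ((F.word 0).count (.core x) * l₀) c₀.edges (c₀.left ++ c₀.mid)
      c₀.right) :
    EdgeBound y l₀ ((F.word 1).count (.core x) * l₀) c₁.edges (c₁.left ++ c₁.mid) c₁.right := by
  have hA := count_mul_add_le_of_mem_pumped (l₀ := l₀) hx
  have hedges := H.edges_le
  have hbars := count_bar_le_barCount y F.pumped
  have hpumped := PumpedFamily.two_mul_barCount_pumped_le hF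
  rcases ih.2 with ⟨hu, h⟩ | h
  · rcases H.closingSurplus_mono_or_le hF hy hu with ⟨hu, hle⟩ | hle
    · exact edgeBound_of_closingSurplus (H.word_one ▸ hF 1) hy hr hu (by omega)
    · exact ⟨by omega, .inr (by omega)⟩
  · exact ⟨by omega, .inr (by omega)⟩

theorem edgeBound_step_of_edges_le (hF : ∀ i, IsBlockString (F.word i))
    (H : PumpedCut F e₂ e₄ c₀ c₁) (hl₀ : F.context.length ≤ l₀) (hx : .core x ∉ F.pumped)
    (hyF : .core y ∉ F.pumped) (hy : .core y ∈ c₁.left ++ c₁.mid) (he : c₁.edges ≤ c₀.edges)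
    (ih : EdgeBound y l₀ ((F.word 0).count (.core x) * l₀) c₀.edges (c₀.left ++ c₀.mid)
      c₀.right) :
    EdgeBound y l₀ ((F.word 1).count (.core x) * l₀) c₁.edges (c₁.left ++ c₁.mid) c₁.right := by
  have hpumped := PumpedFamily.two_mul_barCount_pumped_le hF
  have hbars := PumpedFamily.barsAfterLast_word_le hyF
  rw [H.word_zero, H.word_one] at hbars
  rw [count_eq_of_notMem_pumped hx]
  obtain ⟨ih₁, ih₂⟩ := ih
  refine ⟨by omega, ?_⟩
  rcases ih₂ with ⟨hu, h⟩ | h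
  · rcases H.closingSurplus_mono_or_le hF hy hu with ⟨hu, hle⟩ | hle
    · exact .inl ⟨hu, by omega⟩
    · exact .inr (by omega)
  · exact .inr (by omega)

theorem edgeBound_step_of_bar_mem_pumped (hF : ∀ i, IsBlockString (F.word i))
    (H : PumpedCut F e₂ e₄ c₀ c₁) (he : e₂ + e₄ = F.pumped.count (.bar y))
    (hl₀ : F.context.length ≤ l₀) {A : ℕ} (hA : l₀ ≤ A) (hyF : .core y ∉ F.pumped)
    (hb : .bar y ∈ F.pumped) (hl : .core y ∉ c₁.left) (hm : .core y ∈ c₁.mid)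
    (hr : .core y ∉ c₁.right) (hcount : c₁.edges ≤ (F.word 1).count (.bar y))
    (ih : c₀.edges ≤ A + barsAfterLast y (c₀.left ++ c₀.mid ++ c₀.right))
    (hsame : c₁.edges ≤ c₀.edges →
      EdgeBound y l₀ A c₁.edges (c₁.left ++ c₁.mid) c₁.right) :
    EdgeBound y l₀ A c₁.edges (c₁.left ++ c₁.mid) c₁.right := by
  have hw := H.word_one
  simp only [PumpedFamily.pumped, List.mem_append, not_or] at hyF hb
  obtain ⟨h₁, h₂, h₃, h₄⟩ := hyF
  obtain ⟨b₁, b₄⟩ := PumpedFamily.inner_of_bar_pumped hF h₁ h₄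
  replace hb : .bar y ∈ F.P₂ ++ F.P₃ := by
    simp only [List.mem_append]
    tauto
  have hs₃ := PumpedFamily.core_notMem_s₃ hF h₂ h₃ hb y
  cases H with
  | left α m r e h =>
    refine absurd ((hF 1).core_mem_of_bar_mem (by simpa using hw) ?_) hl
    simp only [List.mem_append] at hb ⊢
    tauto
  | right l m α e h =>
    obtain ⟨v₁, v₂, v₃, hv⟩ := PumpedFamily.exists_lbr_before_bar hF h₂ h₃ hb
    refine edgeBound_of_lbr_before_bar (v₁ := α ++ v₁) (v₂ := v₂) (v₃ := v₃) (hw ▸ hF 1)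
      (List.mem_append_right _ hm) hr (by rw [hv]; simp) ?_
    rw [barsAfterLast_append_of_notMem hr]
    rw [barsAfterLast_append_of_notMem (by simp only [List.mem_append] at hr ⊢; tauto)] at ih
    simp only [PumpedFamily.pumped, List.count_append] at he ih ⊢
    omega
  | above l α β r e h h' => exact hsame le_rfl
  | outer p p' q' q e d h h' hd =>
    have hu : F.s₁ ++ p ++ (p' ++ (F.s₂ ++ (F.P₂ ++ (F.s₃ ++ (F.P₃ ++ (F.s₄ ++ q')))))) =
      F.s₁ ++ (F.P₁ ++ (F.s₂ ++ (F.P₂ ++ (F.s₃ ++ (F.P₃ ++ (F.s₄ ++ q')))))) := by simp [h]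
    rw [hu] at hw ⊢
    exact PumpedFamily.edgeBound_of_inside hF (fun hs => hl (List.mem_append_left _ hs)) h₁ h₂ h₃
      hb hw (β := q) (by simp [h']) hr hl₀ hA hcount
  | between p p' q' q e h h' =>
    have hu : F.s₁ ++ (F.P₁ ++ p) ++ (p' ++ (F.P₂ ++ (F.s₃ ++ (F.P₃ ++ q')))) =
      F.s₁ ++ (F.P₁ ++ (F.s₂ ++ (F.P₂ ++ (F.s₃ ++ (F.P₃ ++ q'))))) := by simp [h]
    rw [hu] at hw ⊢
    exact PumpedFamily.edgeBound_of_inside hF (fun hs => hl (List.mem_append_left _ hs)) h₁ h₂ h₃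
      hb hw (β := q ++ F.P₄) (by simp [h']) hr hl₀ hA hcount
  | inner p p' q' q e d h h' hd =>
    simp only [h, h', List.mem_append] at h₂ h₃ hm
    tauto
  | below p m q e h =>
    simp only [h, List.mem_append] at hs₃
    tauto

theorem edgeBound_step (hF : ∀ i, IsBlockString (F.word i))
    (hxy : ∀ i, (F.word i).count (.core x) = (F.word i).count (.core y))
    (H : PumpedCut F e₂ e₄ c₀ c₁) (he : e₂ + e₄ = F.pumped.count (.bar y))
    (hl₀ : F.context.length ≤ l₀) (hl : .core y ∉ c₁.left) (hm : .core y ∈ c₁.mid)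
    (hr : .core y ∉ c₁.right) (hcount : c₁.edges ≤ (F.word 1).count (.bar y))
    (ih : EdgeBound y l₀ ((F.word 0).count (.core x) * l₀) c₀.edges (c₀.left ++ c₀.mid)
      c₀.right) :
    EdgeBound y l₀ ((F.word 1).count (.core x) * l₀) c₁.edges (c₁.left ++ c₁.mid) c₁.right := by
  have hu : .core y ∈ c₁.left ++ c₁.mid := List.mem_append_right _ hm
  by_cases hx : .core x ∈ F.pumped
  · exact edgeBound_step_of_mem_pumped hF H he hl₀ hx hu hr ih
  have hyF := notMem_pumped_of_count_eq hxy hx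
  have hsame (h : c₁.edges ≤ c₀.edges) := edgeBound_step_of_edges_le hF H hl₀ hx hyF hu h ih
  by_cases hb : .bar y ∈ F.pumped
  · refine edgeBound_step_of_bar_mem_pumped hF H he hl₀ ?_ hyF hb hl hm hr hcount
      (by rw [count_eq_of_notMem_pumped hx]; exact ih.1) hsame
    refine Nat.le_mul_of_pos_left l₀ ?_
    rw [hxy, List.count_pos_iff, H.word_one]
    exact List.mem_append_left _ hu
  · have hedges := H.edges_le
    rw [← List.count_eq_zero] at hb
    exact hsame (by omega)

end EdgeBoundStep

/-! ## Trees and contexts -/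

theorem sum_dite_eq_add {ι M : Type*} [Fintype ι] [DecidableEq ι] [AddCommMonoid M] (i : ι) (a : M)
    (f : ∀ j, j ≠ i → M) : (∑ j, if hj : j = i then a else f j hj) =
      a + ∑ j, if hj : j = i then 0 else f j hj := by
  calc _ = ∑ j, ((if j = i then a else 0) + if hj : j = i then 0 else f j hj) :=
        Finset.sum_congr rfl fun j _ => by by_cases hj : j = i <;> simp [hj]
    _ = _ := by rw [Finset.sum_add_distrib, Finset.sum_ite_eq', if_pos (Finset.mem_univ i)]

/-- Number of nodes of a tree: the measure of the induction along pumping decompositions. -/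
def RTree.nodes {Δ : Signature} : RTree Δ → ℕ
  | .node _ ts => 1 + ∑ i, (ts i).nodes

namespace Ctx

variable {Δ : Signature}

/-- Number of nodes of a context; the hole does not count. -/
def nodes : Ctx Δ → ℕ
  | .hole => 0
  | .node _ i ts c => 1 + (c.nodes + ∑ j, if hj : j = i then 0 else (ts j hj).nodes)

theorem nodes_plug (C : Ctx Δ) (t : RTree Δ) : (C.plug t).nodes = C.nodes + t.nodes := by
  induction C with
  | hole => simp [plug, nodes]
  | node f i ts c ih =>
    simp only [plug, nodes, RTree.nodes, apply_dite RTree.nodes]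
    rw [sum_dite_eq_add, ih]
    omega

theorem nodes_pos_of_height_pos {C : Ctx Δ} (h : 0 < C.height) : 0 < C.nodes := by
  cases C with
  | hole => exact h
  | node f i ts c =>
    rw [nodes]
    omega

theorem plug_comp (C C' : Ctx Δ) (t : RTree Δ) : (C.comp C').plug t = C.plug (C'.plug t) := by
  induction C with
  | hole => rfl
  | node f i ts c ih => simp only [comp, plug, ih]

theorem height_le_height_plug (C : Ctx Δ) (t : RTree Δ) : C.height ≤ (C.plug t).height := by
  induction C with
  | hole => exact Nat.zero_le _
  | node f i ts c ih =>
    simp only [height, plug, RTree.height]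
    refine Nat.add_le_add_left (Finset.sup_mono_fun fun j _ => ?_) 1
    by_cases hj : j = i <;> simp [hj, ih]

/-- The context `f(t₁, …, c, …, tₙ)` with `c` at the child `i`, for a family `t₁, …, tₙ` of which
`tᵢ` is ignored. -/
def branch (f : Δ.Sym) (ts : Fin (Δ.rank f) → RTree Δ) (i : Fin (Δ.rank f)) (c : Ctx Δ) : Ctx Δ :=
  .node f i (fun j _ => ts j) c

theorem plug_branch (f : Δ.Sym) (ts : Fin (Δ.rank f) → RTree Δ) (i : Fin (Δ.rank f)) (c : Ctx Δ)
    (t : RTree Δ) : (branch f ts i c).plug t = .node f (Function.update ts i (c.plug t)) := by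
  rw [branch, plug]
  congr 1
  funext j
  by_cases hj : j = i <;> simp [hj]

theorem node_eq_branch (f : Δ.Sym) (i : Fin (Δ.rank f)) (ts : ∀ j, j ≠ i → RTree Δ) (c : Ctx Δ)
    (t : RTree Δ) : node f i ts c = branch f (fun j => if hj : j = i then t else ts j hj) i c := by
  rw [branch]
  congr 1
  funext j hj
  simp [hj]

end Ctx

/-- A tree with two holes in different subtrees: the root of `outer` has its hole replaced by
`f(t₁, …, tₙ)`, where `c` and `d` stand at the children `i` and `j` instead of `tᵢ` and `tⱼ`. -/
structure Fork (Δ : Signature) where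
  outer : Ctx Δ
  f : Δ.Sym
  ts : Fin (Δ.rank f) → RTree Δ
  (i j : Fin (Δ.rank f))
  (c d : Ctx Δ)
  ne : i ≠ j

namespace Fork

variable {Δ : Signature} (K : Fork Δ)

/-- The context that remains when the hole of `d` is filled. -/
def fillRight (t : RTree Δ) : Ctx Δ :=
  K.outer.comp (.branch K.f (Function.update K.ts K.j (K.d.plug t)) K.i K.c)

/-- The context that remains when the hole of `c` is filled. -/
def fillLeft (s : RTree Δ) : Ctx Δ :=
  K.outer.comp (.branch K.f (Function.update K.ts K.i (K.c.plug s)) K.j K.d)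

theorem plug_fillRight (s t : RTree Δ) : (K.fillRight t).plug s = (K.fillLeft s).plug t := by
  simp only [fillRight, fillLeft, Ctx.plug_comp, Ctx.plug_branch]
  rw [Function.update_comm K.ne.symm]

end Fork

theorem Ctx.exists_fork_of_ne {Δ : Signature} {f : Δ.Sym} {i j : Fin (Δ.rank f)} (hij : i ≠ j)
    {ts : ∀ m, m ≠ i → RTree Δ} {ts' : ∀ m, m ≠ j → RTree Δ} {C D : Ctx Δ} {s t : RTree Δ}
    (h : (Ctx.node f i ts C).plug s = (Ctx.node f j ts' D).plug t) :
    ∃ K : Fork Δ, Ctx.node f i ts C = K.fillRight t ∧ Ctx.node f j ts' D = K.fillLeft s := by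
  simp only [plug, RTree.node.injEq, heq_eq_eq, true_and] at h
  refine ⟨⟨.hole, f, fun m => if hm : m = i then C.plug s else ts m hm, i, j, C, D, hij⟩, ?_, ?_⟩
  · rw [node_eq_branch f i ts C (C.plug s), Fork.fillRight, comp, eq_comm]
    congr 1
    rw [Function.update_eq_self_iff, h]
    simp
  · rw [node_eq_branch f j ts' D (D.plug t), Fork.fillLeft, comp, eq_comm]
    simp only [h]
    congr 1
    rw [Function.update_eq_self_iff]
    simpa using congrFun h i

theorem Ctx.plug_eq_plug {Δ : Signature} {C D : Ctx Δ} {s t : RTree Δ}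
    (h : C.plug s = D.plug t) :
    (∃ D', D = C.comp D' ∧ s = D'.plug t) ∨ (∃ C', C = D.comp C' ∧ t = C'.plug s) ∨
      ∃ K : Fork Δ, C = K.fillRight t ∧ D = K.fillLeft s := by
  induction C generalizing D with
  | hole => exact .inl ⟨D, rfl, h⟩
  | node f i ts c ih =>
    cases D with
    | hole => exact .inr (.inl ⟨_, rfl, h.symm⟩)
    | node f' j ts' d =>
      obtain rfl : f = f' := by
        simp only [plug, RTree.node.injEq] at h
        exact h.1
      by_cases hij : i = j
      · subst hij
        simp only [plug, RTree.node.injEq, heq_eq_eq, true_and] at h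
        have hcd : c.plug s = d.plug t := by simpa using congrFun h i
        obtain rfl : ts = ts' := by
          funext m hm
          simpa [hm] using congrFun h m
        rcases ih hcd with ⟨D', rfl, hD'⟩ | ⟨C', rfl, hC'⟩ | ⟨K, rfl, rfl⟩
        · exact .inl ⟨D', rfl, hD'⟩
        · exact .inr (.inl ⟨C', rfl, hC'⟩)
        · exact .inr (.inr ⟨{ K with outer := .node f i ts K.outer }, rfl, rfl⟩)
      · exact .inr (.inr (exists_fork_of_ne hij h))

/-! ## Yields of contexts -/

theorem flatMap_finRange_split {n : ℕ} {β : Type*} (i : Fin n) (g : Fin n → List β) :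
    (List.finRange n).flatMap g =
      ((List.finRange n).flatMap fun j => if j < i then g j else []) ++
        (g i ++ (List.finRange n).flatMap fun j => if i < j then g j else []) := by
  obtain ⟨l₁, l₂, h⟩ := List.append_of_mem (List.mem_finRange i)
  have hlt := List.pairwise_lt_finRange n
  rw [h, List.pairwise_append, List.pairwise_cons] at hlt
  have h₁ : ∀ j ∈ l₁, j < i := fun j hj => hlt.2.2 j hj i (by simp)
  have h₂ : ∀ j ∈ l₂, i < j := hlt.2.1.1
  have before₁ : (l₁.flatMap fun j => if j < i then g j else []) = l₁.flatMap g :=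
    List.flatMap_congr fun j hj => if_pos (h₁ j hj)
  have before₂ : (l₂.flatMap fun j => if j < i then g j else []) = [] :=
    List.flatMap_eq_nil_iff.2 fun j hj => if_neg (h₂ j hj).not_gt
  have after₁ : (l₁.flatMap fun j => if i < j then g j else []) = [] :=
    List.flatMap_eq_nil_iff.2 fun j hj => if_neg (h₁ j hj).not_gt
  have after₂ : (l₂.flatMap fun j => if i < j then g j else []) = l₂.flatMap g :=
    List.flatMap_congr fun j hj => if_pos (h₂ j hj)
  simp [h, List.flatMap_append, List.flatMap_cons, before₁, before₂, after₁, after₂]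

namespace ProjYield

variable {Δ : Signature} (yd : ProjYield Δ)

/-- The part of the yield of `f(t₁, …, tₙ)` that belongs to the children in `S`: the strings
`wⱼ uⱼ` for `j ∈ S`. -/
def children (f : Δ.Sym) (S : Fin (Δ.rank f) → Prop) [DecidablePred S]
    (ts : Fin (Δ.rank f) → RTree Δ) : List Token :=
  (List.finRange (Δ.rank f)).flatMap fun j =>
    if S j then yd.tree (ts j) ++ yd.pieces f j.succ else []

section Children

variable {f : Δ.Sym} {S : Fin (Δ.rank f) → Prop} [DecidablePred S]
  {ts : Fin (Δ.rank f) → RTree Δ} {i : Fin (Δ.rank f)} {s : RTree Δ}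

theorem children_update_of_not (hi : ¬S i) :
    yd.children f S (Function.update ts i s) = yd.children f S ts :=
  List.flatMap_congr fun j _ => by
    by_cases hj : j = i
    · simp [hj, hi]
    · rw [Function.update_of_ne hj]

theorem children_update (hi : S i) : yd.children f S (Function.update ts i s) =
    yd.children f (fun j => S j ∧ j < i) ts ++ (yd.tree s ++ (yd.pieces f i.succ ++
      yd.children f (fun j => S j ∧ i < j) ts)) := by
  rw [children, flatMap_finRange_split i, if_pos hi, Function.update_self, List.append_assoc]
  congr 1
  · refine List.flatMap_congr fun j _ => ?_
    by_cases hj : j < i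
    · simp [hj, hj.ne]
    · simp [hj]
  · congr 2
    refine List.flatMap_congr fun j _ => ?_
    by_cases hj : i < j
    · simp [hj, hj.ne']
    · simp [hj]

theorem left_branch (c : Ctx Δ) : yd.left (.branch f ts i c) =
    yd.pieces f 0 ++ (yd.children f (· < i) ts ++ yd.left c) := by
  simp [Ctx.branch, left, children]

theorem right_branch (c : Ctx Δ) : yd.right (.branch f ts i c) =
    yd.right c ++ (yd.pieces f i.succ ++ yd.children f (i < ·) ts) := by
  simp [Ctx.branch, right, children]

end Children

theorem tree_node (f : Δ.Sym) (ts : Fin (Δ.rank f) → RTree Δ) :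
    yd.tree (.node f ts) = yd.pieces f 0 ++ yd.children f (fun _ => True) ts := by
  simp [tree, children]

theorem tree_plug (C : Ctx Δ) (t : RTree Δ) :
    yd.tree (C.plug t) = yd.left C ++ (yd.tree t ++ yd.right C) := by
  induction C with
  | hole => simp [Ctx.plug, left, right]
  | node f i ts c ih =>
    rw [Ctx.node_eq_branch f i ts c t, Ctx.plug_branch, tree_node, left_branch, right_branch,
      yd.children_update trivial, ih]
    simp only [true_and, List.append_assoc]

theorem left_comp (C C' : Ctx Δ) : yd.left (C.comp C') = yd.left C ++ yd.left C' := by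
  induction C with
  | hole => rfl
  | node f i ts c ih => simp only [Ctx.comp, left, ih, List.append_assoc]

theorem right_comp (C C' : Ctx Δ) : yd.right (C.comp C') = yd.right C' ++ yd.right C := by
  induction C with
  | hole => simp [Ctx.comp, right]
  | node f i ts c ih => simp only [Ctx.comp, right, ih, List.append_assoc]

end ProjYield

theorem Fork.yield_fillLeft {Δ : Signature} (yd : ProjYield Δ) (K : Fork Δ) :
    (∃ α β γ, ∀ s, yd.left (K.fillLeft s) = α ++ (yd.tree s ++ β) ∧
      yd.right (K.fillLeft s) = γ) ∨
    ∃ α β γ, ∀ s, yd.left (K.fillLeft s) = α ∧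
      yd.right (K.fillLeft s) = β ++ (yd.tree s ++ γ) := by
  obtain ⟨outer, f, ts, i, j, c, d, ne⟩ := K
  simp only [fillLeft, yd.left_comp, yd.right_comp, yd.left_branch, yd.right_branch]
  rcases ne.lt_or_gt with hij | hij
  · refine .inl ⟨yd.left outer ++ (yd.pieces f 0 ++
      (yd.children f (fun m => m < j ∧ m < i) ts ++ yd.left c)), yd.right c ++
      (yd.pieces f i.succ ++ (yd.children f (fun m => m < j ∧ i < m) ts ++ yd.left d)),
      yd.right d ++ (yd.pieces f j.succ ++ yd.children f (j < ·) ts) ++ yd.right outer,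
      fun s => ⟨?_, ?_⟩⟩
    · rw [yd.children_update (S := (· < j)) hij, yd.tree_plug]
      simp only [List.append_assoc]
    · rw [yd.children_update_of_not (S := (j < ·)) hij.not_gt]
  · refine .inr ⟨yd.left outer ++ (yd.pieces f 0 ++ (yd.children f (· < j) ts ++ yd.left d)),
      yd.right d ++ (yd.pieces f j.succ ++
        (yd.children f (fun m => j < m ∧ m < i) ts ++ yd.left c)),
      yd.right c ++ (yd.pieces f i.succ ++
        (yd.children f (fun m => j < m ∧ i < m) ts ++ yd.right outer)),
      fun s => ⟨?_, ?_⟩⟩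
    · rw [yd.children_update_of_not (S := (· < j)) hij.not_gt]
    · rw [yd.children_update (S := (j < ·)) hij, yd.tree_plug]
      simp only [List.append_assoc]

theorem Fork.count_tree_le {Δ : Signature} (yd : ProjYield Δ) (K : Fork Δ) (t : RTree Δ)
    (p : Token) : (yd.tree t).count p ≤ (yd.ctx (K.fillRight t)).count p := by
  have hplug := congrArg (fun u => (yd.tree u).count p) (K.plug_fillRight t t)
  simp only [yd.tree_plug, List.count_append] at hplug
  rw [ProjYield.ctx, List.count_append]
  rcases K.yield_fillLeft yd with ⟨α, β, γ, h⟩ | ⟨α, β, γ, h⟩ <;>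
  · simp only [(h t).1, (h t).2, List.count_append] at hplug
    omega

/-! ## Edges of contexts -/

namespace SGraph

variable {k : ℕ} {L : Type}

theorem edgeCount_par (G H : SGraph k L) (z : L) :
    (G.par H).edgeCount z = G.edgeCount z + H.edgeCount z := by
  have := G.finite_E
  have := H.finite_E
  rw [edgeCount, edgeCount, edgeCount, ← Nat.card_sum]
  exact Nat.card_congr (Equiv.subtypeSum (α := G.E) (β := H.E) (p := fun e => _ = z))

theorem edgeCount_empty (z : L) : (empty : SGraph k L).edgeCount z = 0 := by
  have : IsEmpty {e : (empty : SGraph k L).E // (empty : SGraph k L).label e = z} :=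
    ⟨fun e => Empty.elim e.1⟩
  exact Nat.card_of_isEmpty

theorem edgeCount_le_size (G : SGraph k L) (z : L) : G.edgeCount z ≤ G.size := by
  have := G.finite_E
  exact Finite.card_subtype_le _

end SGraph

theorem HRTerm.exists_edgeCount_eval {k : ℕ} {L : Type} {n : ℕ} (s : HRTerm k L n) (z : L) :
    ∃ c, ∀ env : Fin n → SGraph k L,
      (s.eval env).edgeCount z = c + ∑ m, s.occ m * (env m).edgeCount z := by
  induction s with
  | var i => exact ⟨0, fun env => by simp [eval, occ]⟩
  | const G => exact ⟨G.edgeCount z, fun env => by simp [eval, occ]⟩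
  | par s t ihs iht =>
    obtain ⟨c, hc⟩ := ihs
    obtain ⟨d, hd⟩ := iht
    refine ⟨c + d, fun env => ?_⟩
    simp only [eval, occ, SGraph.edgeCount_par, hc, hd, add_mul, Finset.sum_add_distrib]
    ring
  | forget _ _ ih => exact ih
  | rename _ _ _ ih => exact ih

namespace HRHom

variable {Δ : Signature} {k : ℕ} {L : Type} (h : HRHom Δ k L)

theorem exists_edgeCount_image (f : Δ.Sym) (z : L) : ∃ c, ∀ env : Fin (Δ.rank f) → SGraph k L,
    ((h.image f).eval env).edgeCount z = c + ∑ m, (env m).edgeCount z := by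
  obtain ⟨c, hc⟩ := (h.image f).exists_edgeCount_eval z
  exact ⟨c, fun env => by simp [hc, h.linear]⟩

theorem exists_edgeCount_node (f : Δ.Sym) (i : Fin (Δ.rank f)) (ts : ∀ j, j ≠ i → RTree Δ)
    (z : L) : ∃ d, ∀ c, (h.ctx (.node f i ts c)).edgeCount z = d + (h.ctx c).edgeCount z ∧
      ∀ t, (h.tree ((Ctx.node f i ts c).plug t)).edgeCount z =
        d + (h.tree (c.plug t)).edgeCount z := by
  obtain ⟨d, hd⟩ := h.exists_edgeCount_image f z
  refine ⟨d + ∑ j, if hj : j = i then 0 else (h.tree (ts j hj)).edgeCount z,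
    fun c => ⟨?_, fun t => ?_⟩⟩
  · simp only [ctx, hd, apply_dite (SGraph.edgeCount · z)]
    rw [sum_dite_eq_add]
    omega
  · simp only [Ctx.plug, tree, hd, apply_dite h.tree, apply_dite (SGraph.edgeCount · z)]
    rw [sum_dite_eq_add]
    omega

theorem edgeCount_plug (C : Ctx Δ) (t : RTree Δ) (z : L) :
    (h.tree (C.plug t)).edgeCount z = (h.ctx C).edgeCount z + (h.tree t).edgeCount z := by
  induction C with
  | hole => simp [Ctx.plug, ctx, SGraph.edgeCount_empty]
  | node f i ts c ih =>
    obtain ⟨d, hd⟩ := h.exists_edgeCount_node f i ts z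
    rw [(hd c).2, (hd c).1, ih, Nat.add_assoc]

theorem edgeCount_comp (C C' : Ctx Δ) (z : L) :
    (h.ctx (C.comp C')).edgeCount z = (h.ctx C).edgeCount z + (h.ctx C').edgeCount z := by
  induction C with
  | hole => simp [Ctx.comp, ctx, SGraph.edgeCount_empty]
  | node f i ts c ih =>
    obtain ⟨d, hd⟩ := h.exists_edgeCount_node f i ts z
    rw [Ctx.comp, (hd _).1, (hd c).1, ih, Nat.add_assoc]

theorem edgeCount_child_le {f : Δ.Sym} {ts : Fin (Δ.rank f) → RTree Δ} {i j : Fin (Δ.rank f)}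
    (hij : j ≠ i) (c : Ctx Δ) (z : L) :
    (h.tree (ts j)).edgeCount z ≤ (h.ctx (.branch f ts i c)).edgeCount z := by
  obtain ⟨d, hd⟩ := h.exists_edgeCount_image f z
  rw [Ctx.branch, ctx, hd]
  refine le_add_left (le_of_eq_of_le ?_ (Finset.single_le_sum (fun _ _ => Nat.zero_le _)
    (Finset.mem_univ j)))
  simp [hij]

theorem edgeCount_tree_le_fillRight (K : Fork Δ) (t : RTree Δ) (z : L) :
    (h.tree t).edgeCount z ≤ (h.ctx (K.fillRight t)).edgeCount z := by
  have hchild := h.edgeCount_child_le (ts := Function.update K.ts K.j (K.d.plug t)) K.ne.symm K.c z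
  rw [Function.update_self, h.edgeCount_plug] at hchild
  rw [Fork.fillRight, h.edgeCount_comp]
  omega

theorem edgeCount_fillLeft (K : Fork Δ) (s t : RTree Δ) (z : L) :
    (h.ctx (K.fillLeft s)).edgeCount z + (h.tree t).edgeCount z =
      (h.ctx (K.fillRight t)).edgeCount z + (h.tree s).edgeCount z := by
  rw [← h.edgeCount_plug, ← h.edgeCount_plug, K.plug_fillRight]

end HRHom

/-! ## Pumping decompositions of trees -/

/-- The cut of the yield of `D[t₀]` at the hole of `D`, with the number of `z`-edges of `D`. -/
noncomputable def Ctx.cut {Δ : Signature} {k : ℕ} {L : Type} (D : Ctx Δ) (t₀ : RTree Δ)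
    (yd : ProjYield Δ) (h : HRHom Δ k L) (z : L) : Cut :=
  ⟨yd.left D, yd.tree t₀, yd.right D, (h.ctx D).edgeCount z⟩

/-- The parts of the tree `C₁[C₂[C₃[C₄[t₅]]]]`, in which `C₂` and `C₄` are to be pumped. -/
structure PumpedTree (Δ : Signature) where
  (C₁ C₂ C₃ C₄ : Ctx Δ)
  t₅ : RTree Δ

theorem ProjYield.left_pump {Δ : Signature} (yd : ProjYield Δ) (C₂ C₃ C₄ : Ctx Δ) (i : ℕ) :
    yd.left (pump C₂ C₃ C₄ i) = (List.replicate i (yd.left C₂)).flatten ++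
      (yd.left C₃ ++ (List.replicate i (yd.left C₄)).flatten) := by
  induction i with
  | zero => simp [pump]
  | succ i ih =>
    rw [pump, yd.left_comp, yd.left_comp, ih, List.replicate_succ, List.replicate_succ']
    simp

theorem ProjYield.right_pump {Δ : Signature} (yd : ProjYield Δ) (C₂ C₃ C₄ : Ctx Δ) (i : ℕ) :
    yd.right (pump C₂ C₃ C₄ i) = (List.replicate i (yd.right C₄)).flatten ++
      (yd.right C₃ ++ (List.replicate i (yd.right C₂)).flatten) := by
  induction i with
  | zero => simp [pump]
  | succ i ih =>
    rw [pump, yd.right_comp, yd.right_comp, ih, List.replicate_succ, List.replicate_succ']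
    simp

namespace PumpedTree

variable {Δ : Signature}

/-- The tree `C₁[vⁱ[t₅]]`. -/
def tree (P : PumpedTree Δ) (i : ℕ) : RTree Δ := P.C₁.plug ((pump P.C₂ P.C₃ P.C₄ i).plug P.t₅)

/-- The context `C₂[C₃[C₄]]`. -/
def context (P : PumpedTree Δ) : Ctx Δ := P.C₂.comp (P.C₃.comp P.C₄)

theorem tree_one (P : PumpedTree Δ) :
    P.tree 1 = P.C₁.plug (P.C₂.plug (P.C₃.plug (P.C₄.plug P.t₅))) := by
  rw [tree, pump, pump, Ctx.plug_comp, Ctx.plug_comp]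

theorem nodes_tree_zero_lt {P : PumpedTree Δ} (h : 0 < P.C₂.height + P.C₄.height) :
    (P.tree 0).nodes < (P.tree 1).nodes := by
  rw [tree_one, tree, pump]
  simp only [Ctx.nodes_plug]
  rcases Nat.eq_zero_or_pos P.C₂.height with h₂ | h₂
  · have := P.C₄.nodes_pos_of_height_pos (by omega)
    omega
  · have := P.C₂.nodes_pos_of_height_pos h₂
    omega

theorem edgeCount_tree_one {k : ℕ} {L : Type} (P : PumpedTree Δ) (h : HRHom Δ k L) (z : L) :
    (h.tree (P.tree 1)).edgeCount z = (h.tree (P.tree 0)).edgeCount z +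
      ((h.ctx P.C₂).edgeCount z + (h.ctx P.C₄).edgeCount z) := by
  rw [tree_one, tree, pump]
  simp only [h.edgeCount_plug]
  omega

section Family

variable (P : PumpedTree Δ) (yd : ProjYield Δ) (s₁ s₅ : List Token)

/-- The pumped family of the strings `s₁ yd(vⁱ[t₅]) s₅`. -/
def family : PumpedFamily where
  s₁ := s₁
  P₁ := yd.left P.C₂
  s₂ := yd.left P.C₃
  P₂ := yd.left P.C₄
  s₃ := yd.tree P.t₅
  P₃ := yd.right P.C₄
  s₄ := yd.right P.C₃
  P₄ := yd.right P.C₂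
  s₅ := s₅

theorem word_family (i : ℕ) : (P.family yd s₁ s₅).word i =
    s₁ ++ (yd.tree ((pump P.C₂ P.C₃ P.C₄ i).plug P.t₅) ++ s₅) := by
  rw [yd.tree_plug, yd.left_pump, yd.right_pump]
  simp [PumpedFamily.word, pumpedWord, family]

theorem word_family_yield (i : ℕ) :
    (P.family yd (yd.left P.C₁) (yd.right P.C₁)).word i = yd.tree (P.tree i) := by
  rw [word_family, tree, yd.tree_plug P.C₁]

theorem length_context_family :
    (P.family yd s₁ s₅).context.length = (yd.ctx P.context).length := by
  simp only [PumpedFamily.context, context, family, ProjYield.ctx, yd.left_comp, yd.right_comp,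
    List.length_append]
  omega

end Family

/-- The cut of `P.tree 1 = D[t₀]` at the hole of `D` becomes a cut of `P.tree 0` when the pumped
contexts are removed. -/
def Removable {k : ℕ} {L : Type} (P : PumpedTree Δ) (yd : ProjYield Δ) (h : HRHom Δ k L) (z : L)
    (D : Ctx Δ) (t₀ : RTree Δ) : Prop :=
  ∃ (F : PumpedFamily) (D' : Ctx Δ) (t₀' : RTree Δ), (∀ i, F.word i = yd.tree (P.tree i)) ∧
    F.context.length = (yd.ctx P.context).length ∧ P.tree 0 = D'.plug t₀' ∧
    PumpedCut F ((h.ctx P.C₂).edgeCount z) ((h.ctx P.C₄).edgeCount z)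
      (D'.cut t₀' yd h z) (D.cut t₀ yd h z)

section Removable

variable {k : ℕ} {L : Type} (yd : ProjYield Δ) (h : HRHom Δ k L) (z : L)

theorem Removable.of_pumpedCut {yd : ProjYield Δ} {h : HRHom Δ k L} {z : L} {P : PumpedTree Δ}
    {D : Ctx Δ} {t₀ : RTree Δ} (D' : Ctx Δ) (t₀' : RTree Δ) (h₀ : P.tree 0 = D'.plug t₀')
    (H : PumpedCut (P.family yd (yd.left P.C₁) (yd.right P.C₁)) ((h.ctx P.C₂).edgeCount z)
      ((h.ctx P.C₄).edgeCount z) (D'.cut t₀' yd h z) (D.cut t₀ yd h z)) :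
    P.Removable yd h z D t₀ :=
  ⟨_, D', t₀', P.word_family_yield yd, P.length_context_family yd _ _, h₀, H⟩

theorem removable_above (D C C₂ C₃ C₄ : Ctx Δ) (t₅ : RTree Δ) :
    Removable ⟨D.comp C, C₂, C₃, C₄, t₅⟩ yd h z D
      (C.plug (C₂.plug (C₃.plug (C₄.plug t₅)))) := by
  refine .of_pumpedCut D (C.plug (C₃.plug t₅)) (Ctx.plug_comp _ _ _) ?_
  simp only [Ctx.cut, yd.tree_plug, List.append_assoc]
  exact .above (yd.left D) (yd.left C) (yd.right C) (yd.right D) _ (yd.left_comp _ _)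
    (yd.right_comp _ _)

theorem removable_beside (K : Fork Δ) (C₂ C₃ C₄ : Ctx Δ) (t₅ t₀ : RTree Δ) :
    Removable ⟨K.fillRight t₀, C₂, C₃, C₄, t₅⟩ yd h z
      (K.fillLeft (C₂.plug (C₃.plug (C₄.plug t₅)))) t₀ := by
  have hedges : (h.ctx (K.fillLeft (C₂.plug (C₃.plug (C₄.plug t₅))))).edgeCount z =
      (h.ctx (K.fillLeft (C₃.plug t₅))).edgeCount z + (h.ctx C₂).edgeCount z +
        (h.ctx C₄).edgeCount z := by
    have h₁ := h.edgeCount_fillLeft K (C₂.plug (C₃.plug (C₄.plug t₅))) t₀ z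
    have h₀ := h.edgeCount_fillLeft K (C₃.plug t₅) t₀ z
    simp only [h.edgeCount_plug] at h₁ h₀
    omega
  have hword (s : RTree Δ) := congrArg yd.tree (K.plug_fillRight s t₀)
  rcases K.yield_fillLeft yd with ⟨α, β, γ, hK⟩ | ⟨α, β, γ, hK⟩
  · refine ⟨family _ yd α (β ++ (yd.tree t₀ ++ γ)), K.fillLeft (C₃.plug t₅), t₀, fun i => ?_,
      length_context_family _ yd _ _, K.plug_fillRight _ _, ?_⟩
    · rw [word_family, tree, hword, yd.tree_plug (K.fillLeft _), (hK _).1, (hK _).2]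
      simp only [List.append_assoc]
    · simp only [Ctx.cut, hedges, hK, yd.tree_plug, List.append_assoc]
      exact .left β (yd.tree t₀) γ _ rfl
  · refine ⟨family _ yd (α ++ (yd.tree t₀ ++ β)) γ, K.fillLeft (C₃.plug t₅), t₀, fun i => ?_,
      length_context_family _ yd _ _, K.plug_fillRight _ _, ?_⟩
    · rw [word_family, tree, hword, yd.tree_plug (K.fillLeft _), (hK _).1, (hK _).2]
      simp only [List.append_assoc]
    · simp only [Ctx.cut, hedges, hK, yd.tree_plug, List.append_assoc]
      exact .right α (yd.tree t₀) β _ rfl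

theorem removable_outer (C₁ D C C₃ C₄ : Ctx Δ) (t₅ : RTree Δ) :
    Removable ⟨C₁, D.comp C, C₃, C₄, t₅⟩ yd h z (C₁.comp D)
      (C.plug (C₃.plug (C₄.plug t₅))) := by
  refine .of_pumpedCut C₁ (C₃.plug t₅) rfl ?_
  simp only [Ctx.cut, yd.tree_plug, yd.left_comp, yd.right_comp, h.edgeCount_comp,
    List.append_assoc]
  exact .outer (yd.left D) (yd.left C) (yd.right C) (yd.right D) _ _ (yd.left_comp _ _)
    (yd.right_comp _ _) (Nat.le_add_right _ _)

theorem removable_between (C₁ C₂ D C C₄ : Ctx Δ) (t₅ : RTree Δ) :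
    Removable ⟨C₁, C₂, D.comp C, C₄, t₅⟩ yd h z (C₁.comp (C₂.comp D))
      (C.plug (C₄.plug t₅)) := by
  refine .of_pumpedCut (C₁.comp D) (C.plug t₅) (by simp only [tree, pump, Ctx.plug_comp]) ?_
  simp only [Ctx.cut, yd.tree_plug, yd.left_comp, yd.right_comp, h.edgeCount_comp,
    List.append_assoc]
  rw [Nat.add_comm (SGraph.edgeCount (h.ctx C₂) z), ← Nat.add_assoc]
  exact .between (yd.left D) (yd.left C) (yd.right C) (yd.right D) _ (yd.left_comp _ _)
    (yd.right_comp _ _)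

theorem removable_inner (C₁ C₂ C₃ D C : Ctx Δ) (t₅ : RTree Δ) :
    Removable ⟨C₁, C₂, C₃, D.comp C, t₅⟩ yd h z (C₁.comp (C₂.comp (C₃.comp D)))
      (C.plug t₅) := by
  refine .of_pumpedCut (C₁.comp C₃) t₅ (by simp only [tree, pump, Ctx.plug_comp]) ?_
  have hedges : (h.ctx (C₁.comp (C₂.comp (C₃.comp D)))).edgeCount z =
      (h.ctx (C₁.comp C₃)).edgeCount z + (h.ctx C₂).edgeCount z + (h.ctx D).edgeCount z := by
    simp only [h.edgeCount_comp]
    omega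
  simp only [Ctx.cut, hedges, yd.tree_plug, yd.left_comp, yd.right_comp, h.edgeCount_comp D,
    List.append_assoc]
  exact .inner (yd.left D) (yd.left C) (yd.right C) (yd.right D) _ _ (yd.left_comp _ _)
    (yd.right_comp _ _) (Nat.le_add_right _ _)

theorem removable_below (C₁ C₂ C₃ C₄ D : Ctx Δ) (t₀ : RTree Δ) :
    Removable ⟨C₁, C₂, C₃, C₄, D.plug t₀⟩ yd h z
      (C₁.comp (C₂.comp (C₃.comp (C₄.comp D)))) t₀ := by
  refine .of_pumpedCut (C₁.comp (C₃.comp D)) t₀ (by simp only [tree, pump, Ctx.plug_comp]) ?_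
  have hedges : (h.ctx (C₁.comp (C₂.comp (C₃.comp (C₄.comp D))))).edgeCount z =
      (h.ctx (C₁.comp (C₃.comp D))).edgeCount z + (h.ctx C₂).edgeCount z +
        (h.ctx C₄).edgeCount z := by
    simp only [h.edgeCount_comp]
    omega
  simp only [Ctx.cut, hedges, yd.left_comp, yd.right_comp, List.append_assoc]
  exact .below (yd.left D) (yd.tree t₀) (yd.right D) _ (yd.tree_plug _ _)

theorem removable_or_le {P : PumpedTree Δ} {D : Ctx Δ} {t₀ : RTree Δ}
    (heq : P.tree 1 = D.plug t₀) (p : Token) :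
    P.Removable yd h z D t₀ ∨ ((yd.tree t₀).count p ≤ (yd.ctx P.context).count p ∧
      (h.tree t₀).edgeCount z ≤ (h.ctx P.context).edgeCount z) := by
  obtain ⟨C₁, C₂, C₃, C₄, t₅⟩ := P
  replace heq : C₁.plug (C₂.plug (C₃.plug (C₄.plug t₅))) = D.plug t₀ := (tree_one _).symm.trans heq
  simp only [context, ProjYield.ctx, yd.left_comp, yd.right_comp, h.edgeCount_comp,
    List.count_append]
  have small (K : Fork Δ) := K.count_tree_le yd t₀ p
  have small' (K : Fork Δ) := h.edgeCount_tree_le_fillRight K t₀ z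
  simp only [ProjYield.ctx, List.count_append] at small
  rcases Ctx.plug_eq_plug heq with ⟨D₁, rfl, heq₁⟩ | ⟨C, rfl, rfl⟩ | ⟨K, rfl, rfl⟩
  case inr.inl => exact .inl (removable_above yd h z ..)
  case inr.inr => exact .inl (removable_beside yd h z ..)
  rcases Ctx.plug_eq_plug heq₁ with ⟨D₂, rfl, heq₂⟩ | ⟨C, rfl, rfl⟩ | ⟨K, rfl, rfl⟩
  case inr.inl => exact .inl (removable_outer yd h z ..)
  case inr.inr =>
    have := small K
    have := small' K
    omega
  rcases Ctx.plug_eq_plug heq₂ with ⟨D₃, rfl, heq₃⟩ | ⟨C, rfl, rfl⟩ | ⟨K, rfl, rfl⟩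
  case inr.inl => exact .inl (removable_between yd h z ..)
  case inr.inr =>
    have := small K
    have := small' K
    omega
  rcases Ctx.plug_eq_plug heq₃ with ⟨D₄, rfl, rfl⟩ | ⟨C, rfl, rfl⟩ | ⟨K, rfl, rfl⟩
  case inl => exact .inl (removable_below yd h z ..)
  case inr.inl => exact .inl (removable_inner yd h z ..)
  case inr.inr =>
    have := small K
    have := small' K
    omega

end Removable

end PumpedTree

/-! ## Induction along pumping decompositions -/

section Induction

variable {Δ : Signature} {k : ℕ} {L : Type} {yd : ProjYield Δ} {h : HRHom Δ k L}
  {T : Set (RTree Δ)} {p l₀ : ℕ} {x y : Core} {z : L} {D : Ctx Δ} {t₀ : RTree Δ}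

/-- The tokens `τ` and the edges of a cut differ by at most `l₀`: the base case of the induction
along pumping decompositions. -/
def Cut.IsBalanced (c : Cut) (τ : Token) (l₀ : ℕ) : Prop :=
  c.left.count τ + c.right.count τ ≤ c.edges + l₀ ∧ c.edges ≤ c.left.count τ + c.right.count τ + l₀

theorem Cut.isBalanced_of_height_le (hl₀ : IsGenerationBound yd h p l₀) (hD : D.height ≤ p)
    (t₀ : RTree Δ) (τ : Token) : (D.cut t₀ yd h z).IsBalanced τ l₀ := by
  have hlen := (hl₀ D hD).1
  have hsize := (SGraph.edgeCount_le_size _ z).trans (hl₀ D hD).2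
  have hcount := List.count_le_length (a := τ) (l := yd.ctx D)
  rw [ProjYield.ctx, List.count_append] at hcount
  rw [ProjYield.ctx] at hlen
  simp only [Cut.IsBalanced, Ctx.cut]
  omega

theorem Cut.isBalanced_of_le {τ : Token}
    (hedge : (h.tree (D.plug t₀)).edgeCount z = (yd.tree (D.plug t₀)).count τ)
    (htokens : (yd.tree t₀).count τ ≤ l₀) (hedges : (h.tree t₀).edgeCount z ≤ l₀) :
    (D.cut t₀ yd h z).IsBalanced τ l₀ := by
  rw [h.edgeCount_plug, yd.tree_plug, List.count_append, List.count_append] at hedge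
  simp only [Cut.IsBalanced, Ctx.cut]
  omega

theorem context_induction (hp : IsPumpingHeight T p) (hl₀ : IsGenerationBound yd h p l₀)
    {W : Set (List Token)} (hT : ∀ t ∈ T, yd.tree t ∈ W) {τ : Token}
    (hedge : ∀ t ∈ T, (h.tree t).edgeCount z = (yd.tree t).count τ) {Q : Cut → Prop}
    (base : ∀ c : Cut, c.left ++ c.mid ++ c.right ∈ W → .core y ∉ c.left → .core y ∉ c.right →
      c.IsBalanced τ l₀ → Q c)
    (step : ∀ (F : PumpedFamily) (e₂ e₄ : ℕ) (c₀ c₁ : Cut), (∀ i, F.word i ∈ W) →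
      PumpedCut F e₂ e₄ c₀ c₁ → e₂ + e₄ = F.pumped.count τ → F.context.length ≤ l₀ →
      .core y ∉ c₁.left → .core y ∉ c₁.right → c₁.edges ≤ (F.word 1).count τ → Q c₀ → Q c₁)
    (ht : D.plug t₀ ∈ T) (hl : .core y ∉ yd.left D) (hr : .core y ∉ yd.right D) :
    Q (D.cut t₀ yd h z) := by
  induction hn : (D.plug t₀).nodes using Nat.strong_induction_on generalizing D t₀ with
  | _ n ih =>
  have base := base (D.cut t₀ yd h z) (by simpa [Ctx.cut, yd.tree_plug] using hT _ ht) hl hr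
  rcases le_or_gt (D.plug t₀).height p with hht | hht
  · exact base (Cut.isBalanced_of_height_le hl₀ ((D.height_le_height_plug t₀).trans hht) _ _)
  obtain ⟨C₁, C₂, C₃, C₄, t₅, heq, hCp, hpos, hpump⟩ := hp _ ht hht
  let P : PumpedTree Δ := ⟨C₁, C₂, C₃, C₄, t₅⟩
  replace heq : P.tree 1 = D.plug t₀ := P.tree_one.trans heq.symm
  obtain ⟨hlen, hsize⟩ := hl₀ _ hCp
  rcases P.removable_or_le yd h z heq τ with ⟨F, D', t₀', hF, hF', h₀, H⟩ | ⟨htok, hedg⟩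
  · obtain ⟨hl', hr'⟩ := H.core_notMem_of_notMem hl hr
    refine step F _ _ _ _ (fun i => hF i ▸ hT _ (hpump i)) H ?_ (hF'.trans_le hlen) hl hr ?_
      (ih _ ?_ (h₀ ▸ hpump 0) hl' hr' rfl)
    · have hone : (h.tree (P.tree 1)).edgeCount z = (F.word 1).count τ := hF 1 ▸ hedge _ (hpump 1)
      have hzero : (h.tree (P.tree 0)).edgeCount z = (F.word 0).count τ := hF 0 ▸ hedge _ (hpump 0)
      have hcount := F.count_word_one τ
      have hedges := P.edgeCount_tree_one h z
      omega
    · rw [hF, heq, ← hedge _ ht, h.edgeCount_plug]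
      exact Nat.le_add_right _ _
    · rw [← hn, ← h₀, ← heq]
      exact P.nodes_tree_zero_lt hpos
  · exact base (Cut.isBalanced_of_le (hedge _ ht) (htok.trans (List.count_le_length.trans hlen))
      (hedg.trans ((SGraph.edgeCount_le_size _ z).trans hsize)))

theorem le_count_mul_of_mem_csdStrings {w : List Token} (h : w ∈ csdStrings) (x : Core) (l₀ : ℕ) :
    l₀ ≤ w.count (.core x) * l₀ :=
  Nat.le_mul_of_pos_left l₀ (List.count_pos_iff.2 (core_mem_of_mem_csdStrings h x))

theorem edgeCount_tree_le_of_core_notMem (hp : IsPumpingHeight T p)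
    (hl₀ : IsGenerationBound yd h p l₀) (hT : ∀ t ∈ T, yd.tree t ∈ csdStrings)
    (hxy : (x, y) ∈ sepPairs)
    (hedge : ∀ t ∈ T, (h.tree t).edgeCount z = (yd.tree t).count (.bar x))
    (ht : D.plug t₀ ∈ T) (hl : .core y ∉ yd.left D) (hr : .core y ∉ yd.right D) :
    (h.tree t₀).edgeCount z ≤
      (yd.tree t₀).count (.bar x) + (yd.tree (D.plug t₀)).count (.core x) * l₀ := by
  have hcut := context_induction (Q := fun c => c.left.count (.bar x) + c.right.count (.bar x) ≤
      c.edges + (c.left ++ c.mid ++ c.right).count (.core x) * l₀) hp hl₀ hT hedge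
    (fun c hc _ _ hbal => hbal.1.trans
      (Nat.add_le_add_left (le_count_mul_of_mem_csdStrings hc x l₀) _))
    (fun F e₂ e₄ c₀ c₁ hF H he hlen hl hr _ ih => by
      have hmid := core_mem_of_mem_csdStrings (hF 1) y
      rw [H.word_one, List.mem_append, List.mem_append] at hmid
      rw [← H.word_zero] at ih
      rw [← H.word_one]
      exact bars_le_edges_step (fun i => isBlockString_of_mem_csdStrings (hF i))
        (fun i => count_core_eq_of_mem_csdStrings (hF i) hxy) H he hlen (by tauto) ih)
    ht hl hr
  have htotal := hedge _ ht
  rw [h.edgeCount_plug, yd.tree_plug] at htotal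
  rw [yd.tree_plug]
  simp only [Ctx.cut, List.count_append, List.append_assoc] at hcut htotal ⊢
  omega

theorem edgeCount_context_le_of_core_notMem (hp : IsPumpingHeight T p)
    (hl₀ : IsGenerationBound yd h p l₀) (hT : ∀ t ∈ T, yd.tree t ∈ csdStrings)
    (hxy : (x, y) ∈ sepPairs)
    (hedge : ∀ t ∈ T, (h.tree t).edgeCount z = (yd.tree t).count (.bar y))
    (ht : D.plug t₀ ∈ T) (hl : .core y ∉ yd.left D) (hr : .core y ∉ yd.right D) :
    (h.ctx D).edgeCount z ≤ (yd.tree (D.plug t₀)).count (.core x) * l₀ +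
      lastRun (.bar y) (yd.tree (D.plug t₀)) := by
  have hcut := context_induction (Q := fun c => EdgeBound y l₀
      ((c.left ++ c.mid ++ c.right).count (.core x) * l₀) c.edges (c.left ++ c.mid) c.right)
    hp hl₀ hT hedge
    (fun c hc hl hr hbal => by
      have hw := isBlockString_of_mem_csdStrings hc
      have hleft : c.left.count (.bar y) = 0 := List.count_eq_zero.2 fun hb =>
        hl (hw.core_mem_of_bar_mem (List.append_assoc _ _ _) hb)
      have := le_count_mul_of_mem_csdStrings hc x l₀
      exact edgeBound_of_count_bar hw hr (by have := hbal.2; omega))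
    (fun F e₂ e₄ c₀ c₁ hF H he hlen hl hr hcount ih => by
      have hmid := core_mem_of_mem_csdStrings (hF 1) y
      rw [H.word_one, List.mem_append, List.mem_append] at hmid
      rw [← H.word_zero] at ih
      rw [← H.word_one]
      exact edgeBound_step (fun i => isBlockString_of_mem_csdStrings (hF i))
        (fun i => count_core_eq_of_mem_csdStrings (hF i) hxy) H he hlen hl (by tauto) hr hcount ih)
    ht hl hr
  have hbound := hcut.1
  simp only [Ctx.cut, List.append_assoc, ← yd.tree_plug] at hbound
  exact hbound.trans (Nat.add_le_add_left ((isBlockString_of_mem_csdStrings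
    (hT _ ht)).barsAfterLast_le_lastRun (core_mem_of_mem_csdStrings (hT _ ht) y)) _)

end Induction

/-! ## The pumping lemma for linear monadic context-free tree grammars -/

theorem exists_eq_one_of_sum_eq_one {ι : Type*} [Fintype ι] {f : ι → ℕ} (h : ∑ i, f i = 1) :
    ∃ i, f i = 1 ∧ ∀ j ≠ i, f j = 0 := by
  classical
  obtain ⟨i, hi, hne⟩ := Finset.exists_ne_zero_of_sum_ne_zero (h.trans_ne one_ne_zero)
  rw [← Finset.add_sum_erase _ f hi] at h
  have hzero : ∑ j ∈ Finset.univ.erase i, f j = 0 := by omega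
  exact ⟨i, by omega, fun j hj => Finset.sum_eq_zero_iff.1 hzero j (by simpa using hj)⟩

theorem sup_dite_le_sup_dite_add {n : ℕ} {i : Fin n} (g : ∀ j, j ≠ i → ℕ) {a b m : ℕ}
    (h : b ≤ a + m) : (Finset.univ.sup fun j => if hj : j = i then b else g j hj) ≤
      (Finset.univ.sup fun j => if hj : j = i then a else g j hj) + m := by
  refine Finset.sup_le fun j hj => ?_
  have := Finset.le_sup (f := fun j => if hj : j = i then a else g j hj) hj
  by_cases hj : j = i <;> simp only [hj, dite_true, dite_false] at this ⊢ <;> omega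

namespace Ctx

variable {Δ : Signature}

theorem comp_assoc (C C' C'' : Ctx Δ) : (C.comp C').comp C'' = C.comp (C'.comp C'') := by
  induction C with
  | hole => rfl
  | node f i ts c ih => simp only [comp, ih]

theorem comp_hole (C : Ctx Δ) : C.comp .hole = C := by
  induction C with
  | hole => rfl
  | node f i ts c ih => simp only [comp, ih]

theorem height_plug_le (C : Ctx Δ) (t : RTree Δ) : (C.plug t).height ≤ C.height + t.height := by
  induction C with
  | hole => simp [plug, height]
  | node f i ts c ih =>
    simp only [height, plug, RTree.height, apply_dite RTree.height, Nat.add_assoc]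
    exact Nat.add_le_add_left (sup_dite_le_sup_dite_add _ ih) 1

theorem height_comp_le (C C' : Ctx Δ) : (C.comp C').height ≤ C.height + C'.height := by
  induction C with
  | hole => simp [comp, height]
  | node f i ts c ih =>
    simp only [height, comp, Nat.add_assoc]
    exact Nat.add_le_add_left (sup_dite_le_sup_dite_add _ ih) 1

theorem height_pos {C : Ctx Δ} (h : C ≠ .hole) : 0 < C.height := by
  cases C with
  | hole => exact absurd rfl h
  | node f i ts c => exact Nat.add_pos_left Nat.one_pos _

end Ctx

namespace SForm

variable {Δ : Signature} {N₀ N₁ : Type}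

theorem subst_var (r : SForm Δ N₀ N₁) : r.subst .var = r := by
  induction r with
  | var => rfl
  | term f ts ih => simp only [subst, ih]
  | nt0 A => rfl
  | nt1 B s ih => simp only [subst, ih]

theorem subst_of_varCount_eq_zero {r : SForm Δ N₀ N₁} (h : r.varCount = 0) (u : SForm Δ N₀ N₁) :
    r.subst u = r := by
  induction r with
  | var => simp [varCount] at h
  | term f ts ih =>
    simp only [varCount, Finset.sum_eq_zero_iff, Finset.mem_univ, true_implies] at h
    simp only [subst, ih _ (h _)]
  | nt0 A => rfl
  | nt1 B s ih => simp only [subst, ih h]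

/-- The set of subterms of a sentential form, including the form itself. -/
def subforms : SForm Δ N₀ N₁ → Set (SForm Δ N₀ N₁)
  | .var => {.var}
  | .term f ts => insert (.term f ts) (⋃ i, (ts i).subforms)
  | .nt0 A => {.nt0 A}
  | .nt1 B s => insert (.nt1 B s) s.subforms

theorem self_mem_subforms (r : SForm Δ N₀ N₁) : r ∈ r.subforms := by
  cases r <;> simp [subforms]

theorem finite_subforms (r : SForm Δ N₀ N₁) : r.subforms.Finite := by
  induction r with
  | var => exact Set.finite_singleton _
  | term f ts ih => exact (Set.finite_iUnion ih).insert _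
  | nt0 A => exact Set.finite_singleton _
  | nt1 B s ih => exact ih.insert _

theorem subforms_subset {r s : SForm Δ N₀ N₁} (h : s ∈ r.subforms) : s.subforms ⊆ r.subforms := by
  induction r with
  | var => rw [Set.mem_singleton_iff.1 h]
  | term f ts ih =>
    rcases h with rfl | h
    · exact subset_rfl
    · obtain ⟨i, hi⟩ := Set.mem_iUnion.1 h
      exact (ih i hi).trans ((Set.subset_iUnion (fun i => (ts i).subforms) i).trans
        (Set.subset_insert _ _))
  | nt0 A => rw [Set.mem_singleton_iff.1 h]
  | nt1 B s ih =>
    rcases h with rfl | h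
    · exact subset_rfl
    · exact (ih h).trans (Set.subset_insert _ _)

end SForm

/-- The sentential form obtained by filling the hole of a context with a sentential form. -/
def Ctx.fill {Δ : Signature} {N₀ N₁ : Type} : Ctx Δ → SForm Δ N₀ N₁ → SForm Δ N₀ N₁
  | .hole, u => u
  | .node f i ts c, u => .term f fun j => if hj : j = i then c.fill u else (ts j hj).toSForm

theorem Ctx.fill_comp {Δ : Signature} {N₀ N₁ : Type} (C C' : Ctx Δ) (u : SForm Δ N₀ N₁) :
    (C.comp C').fill u = C.fill (C'.fill u) := by
  induction C with
  | hole => rfl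
  | node f i ts c ih => simp only [comp, fill, ih]

theorem Ctx.fill_toSForm {Δ : Signature} {N₀ N₁ : Type} (C : Ctx Δ) (t : RTree Δ) :
    (C.fill t.toSForm : SForm Δ N₀ N₁) = (C.plug t).toSForm := by
  induction C with
  | hole => rfl
  | node f i ts c ih => simp only [fill, plug, RTree.toSForm, ih, apply_dite RTree.toSForm]

namespace LMCFTG

variable {Δ : Signature} (G : LMCFTG Δ)

/-- `G.Derives n s o`: the form `s` derives the object `o` by a derivation tree of height at most
`n`. The object is a tree if the variable does not survive in the derivation, and a context, whose
hole stands for the variable, otherwise. -/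
inductive Derives : ℕ → SForm Δ G.N₀ G.N₁ → RTree Δ ⊕ Ctx Δ → Prop
  | term (n : ℕ) (f : Δ.Sym) (ts : Fin (Δ.rank f) → SForm Δ G.N₀ G.N₁)
      (us : Fin (Δ.rank f) → RTree Δ) :
      (∀ i, Derives n (ts i) (.inl (us i))) → Derives (n + 1) (.term f ts) (.inl (.node f us))
  | nt0 (n : ℕ) (A : G.N₀) (r : SForm Δ G.N₀ G.N₁) (t : RTree Δ) : (A, r) ∈ G.rules₀ →
      Derives n r (.inl t) → Derives (n + 1) (.nt0 A) (.inl t)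
  | nt1 (n : ℕ) (B : G.N₁) (r s : SForm Δ G.N₀ G.N₁) (C : Ctx Δ) (t : RTree Δ) :
      (B, r) ∈ G.rules₁ → Derives n r (.inr C) → Derives n s (.inl t) →
      Derives (n + 1) (.nt1 B s) (.inl (C.plug t))
  | nt1Const (n : ℕ) (B : G.N₁) (r s : SForm Δ G.N₀ G.N₁) (t : RTree Δ) :
      (B, r) ∈ G.rules₁ → Derives n r (.inl t) → Derives (n + 1) (.nt1 B s) (.inl t)
  | var (n : ℕ) : Derives n .var (.inr .hole)
  | termCtx (n : ℕ) (f : Δ.Sym) (ts : Fin (Δ.rank f) → SForm Δ G.N₀ G.N₁)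
      (us : Fin (Δ.rank f) → RTree Δ) (i : Fin (Δ.rank f)) (C : Ctx Δ) :
      Derives n (ts i) (.inr C) → (∀ j ≠ i, Derives n (ts j) (.inl (us j))) →
      Derives (n + 1) (.term f ts) (.inr (.branch f us i C))
  | nt1Ctx (n : ℕ) (B : G.N₁) (r s : SForm Δ G.N₀ G.N₁) (C C' : Ctx Δ) :
      (B, r) ∈ G.rules₁ → Derives n r (.inr C) → Derives n s (.inr C') →
      Derives (n + 1) (.nt1 B s) (.inr (C.comp C'))

variable {G}

theorem Derives.succ {n : ℕ} {s : SForm Δ G.N₀ G.N₁} {o : RTree Δ ⊕ Ctx Δ}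
    (h : G.Derives n s o) : G.Derives (n + 1) s o := by
  induction h with
  | term n f ts us _ ih => exact .term _ f ts us ih
  | nt0 n A r t hr _ ih => exact .nt0 _ A r t hr ih
  | nt1 n B r s C t hr _ _ ih ih' => exact .nt1 _ B r s C t hr ih ih'
  | nt1Const n B r s t hr _ ih => exact .nt1Const _ B r s t hr ih
  | var n => exact .var _
  | termCtx n f ts us i C _ _ ih ih' => exact .termCtx _ f ts us i C ih ih'
  | nt1Ctx n B r s C C' hr _ _ ih ih' => exact .nt1Ctx _ B r s C C' hr ih ih'

theorem Derives.mono {n m : ℕ} {s : SForm Δ G.N₀ G.N₁} {o : RTree Δ ⊕ Ctx Δ}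
    (h : G.Derives n s o) (hnm : n ≤ m) : G.Derives m s o := by
  induction hnm with
  | refl => exact h
  | step _ ih => exact ih.succ

/-- The height of a derived object, be it a tree or a context. -/
def objHeight (o : RTree Δ ⊕ Ctx Δ) : ℕ :=
  o.elim RTree.height Ctx.height

theorem Derives.height_lt {n : ℕ} {s : SForm Δ G.N₀ G.N₁} {o : RTree Δ ⊕ Ctx Δ}
    (h : G.Derives n s o) : objHeight o < 2 ^ n := by
  induction h with
  | term n f _ us _ ih =>
    have : (Finset.univ.sup fun i => (us i).height) < 2 ^ n :=
      (Finset.sup_lt_iff (Nat.two_pow_pos n)).2 fun i _ => ih i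
    simp only [objHeight, Sum.elim_inl, RTree.height, pow_succ]
    omega
  | nt0 n A r t hr _ ih =>
    rw [pow_succ]
    omega
  | nt1 n B r s C t hr _ _ ih ih' =>
    simp only [objHeight, Sum.elim_inl, Sum.elim_inr, pow_succ] at ih ih' ⊢
    have := C.height_plug_le t
    omega
  | nt1Const n B r s t hr _ ih =>
    rw [pow_succ]
    exact Nat.lt_of_lt_of_le ih (by omega)
  | var n => exact Nat.two_pow_pos n
  | termCtx n f _ us i C _ _ ih ih' =>
    have : (Finset.univ.sup fun j => if j = i then C.height else (us j).height) < 2 ^ n :=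
      (Finset.sup_lt_iff (Nat.two_pow_pos n)).2 fun j _ => by
        split_ifs with hj
        exacts [ih, ih' j hj]
    simp only [objHeight, Sum.elim_inr, Ctx.branch, Ctx.height, dite_eq_ite, pow_succ]
    omega
  | nt1Ctx n B r s C C' hr _ _ ih ih' =>
    simp only [objHeight, Sum.elim_inr, pow_succ] at ih ih' ⊢
    have := C.height_comp_le C'
    omega

/-! ### Derivability and rewriting -/

variable (G) in
/-- The form `s` derives the object `o`, by a derivation tree of any height. -/
def Derivable (s : SForm Δ G.N₀ G.N₁) (o : RTree Δ ⊕ Ctx Δ) : Prop :=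
  ∃ n, G.Derives n s o

theorem Derives.derivable {n : ℕ} {s : SForm Δ G.N₀ G.N₁} {o : RTree Δ ⊕ Ctx Δ}
    (h : G.Derives n s o) : G.Derivable s o :=
  ⟨n, h⟩

namespace Derivable

variable {f : Δ.Sym} {ts : Fin (Δ.rank f) → SForm Δ G.N₀ G.N₁} {us : Fin (Δ.rank f) → RTree Δ}
  {i : Fin (Δ.rank f)} {A : G.N₀} {B : G.N₁} {r s : SForm Δ G.N₀ G.N₁} {t : RTree Δ} {C C' : Ctx Δ}

theorem exists_common {ι : Type*} [Finite ι] {s : ι → SForm Δ G.N₀ G.N₁}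
    {o : ι → RTree Δ ⊕ Ctx Δ} (h : ∀ i, G.Derivable (s i) (o i)) :
    ∃ n, ∀ i, G.Derives n (s i) (o i) := by
  cases nonempty_fintype ι
  choose n hn using h
  exact ⟨Finset.univ.sup n, fun i => (hn i).mono (Finset.le_sup (Finset.mem_univ i))⟩

theorem term (h : ∀ i, G.Derivable (ts i) (.inl (us i))) :
    G.Derivable (.term f ts) (.inl (.node f us)) := by
  obtain ⟨n, hn⟩ := exists_common h
  exact ⟨_, .term n f ts us hn⟩

theorem nt0 (hr : (A, r) ∈ G.rules₀) (h : G.Derivable r (.inl t)) :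
    G.Derivable (.nt0 A) (.inl t) := by
  obtain ⟨n, hn⟩ := h
  exact ⟨_, .nt0 n A r t hr hn⟩

theorem nt1 (hr : (B, r) ∈ G.rules₁) (h : G.Derivable r (.inr C)) (h' : G.Derivable s (.inl t)) :
    G.Derivable (.nt1 B s) (.inl (C.plug t)) := by
  obtain ⟨n, hn⟩ := h
  obtain ⟨m, hm⟩ := h'
  exact ⟨_, .nt1 (max n m) B r s C t hr (hn.mono (le_max_left _ _)) (hm.mono (le_max_right _ _))⟩

theorem nt1Const (hr : (B, r) ∈ G.rules₁) (h : G.Derivable r (.inl t)) :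
    G.Derivable (.nt1 B s) (.inl t) := by
  obtain ⟨n, hn⟩ := h
  exact ⟨_, .nt1Const n B r s t hr hn⟩

theorem nt1Ctx (hr : (B, r) ∈ G.rules₁) (h : G.Derivable r (.inr C))
    (h' : G.Derivable s (.inr C')) : G.Derivable (.nt1 B s) (.inr (C.comp C')) := by
  obtain ⟨n, hn⟩ := h
  obtain ⟨m, hm⟩ := h'
  exact ⟨_, .nt1Ctx (max n m) B r s C C' hr (hn.mono (le_max_left _ _))
    (hm.mono (le_max_right _ _))⟩

theorem termCtx (h : G.Derivable (ts i) (.inr C))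
    (h' : ∀ j ≠ i, G.Derivable (ts j) (.inl (us j))) :
    G.Derivable (.term f ts) (.inr (.branch f us i C)) := by
  obtain ⟨n, hn⟩ := h
  obtain ⟨m, hm⟩ := exists_common (ι := {j // j ≠ i}) fun j => h' j.1 j.2
  exact ⟨_, .termCtx (max n m) f ts us i C (hn.mono (le_max_left _ _))
    fun j hj => (hm ⟨j, hj⟩).mono (le_max_right _ _)⟩

theorem exists_node_of_term (h : G.Derivable (.term f ts) (.inl t)) :
    ∃ us, t = .node f us ∧ ∀ i, G.Derivable (ts i) (.inl (us i)) := by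
  obtain ⟨_, _ | _⟩ := h
  case term n us h => exact ⟨us, rfl, fun i => (h i).derivable⟩

theorem exists_rule_of_nt1 (h : G.Derivable (.nt1 B s) (.inl t)) :
    ∃ r, (B, r) ∈ G.rules₁ ∧ (G.Derivable r (.inl t) ∨
      ∃ C t', G.Derivable r (.inr C) ∧ G.Derivable s (.inl t') ∧ t = C.plug t') := by
  obtain ⟨_, h⟩ := h
  cases h with
  | nt1 n _ r _ C t' hr hC ht' => exact ⟨r, hr, .inr ⟨C, t', hC.derivable, ht'.derivable, rfl⟩⟩
  | nt1Const n _ r _ _ hr ht => exact ⟨r, hr, .inl ht.derivable⟩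

end Derivable

theorem steps_update {f : Δ.Sym} {ts : Fin (Δ.rank f) → SForm Δ G.N₀ G.N₁} (i : Fin (Δ.rank f))
    {v : SForm Δ G.N₀ G.N₁} (h : Relation.ReflTransGen G.Step (ts i) v) :
    Relation.ReflTransGen G.Step (.term f ts) (.term f (Function.update ts i v)) := by
  have hlift := h.lift (p := G.Step) (fun w => .term f (Function.update ts i w)) fun u w huw => by
    simpa using Step.inTerm f (Function.update ts i u) i w (by simpa using huw)
  simpa [Function.onFun] using hlift

theorem steps_term {f : Δ.Sym} {ts us : Fin (Δ.rank f) → SForm Δ G.N₀ G.N₁}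
    (h : ∀ i, Relation.ReflTransGen G.Step (ts i) (us i)) :
    Relation.ReflTransGen G.Step (.term f ts) (.term f us) := by
  suffices ∀ S : Finset (Fin (Δ.rank f)),
      Relation.ReflTransGen G.Step (.term f ts) (.term f (S.piecewise us ts)) by
    simpa using this Finset.univ
  intro S
  induction S using Finset.induction_on with
  | empty => simpa using Relation.ReflTransGen.refl
  | insert i S hi ih =>
    rw [Finset.piecewise_insert]
    refine ih.trans (steps_update i ?_)
    rw [Finset.piecewise_eq_of_notMem _ _ _ hi]
    exact h i

theorem steps_fill (C : Ctx Δ) {u v : SForm Δ G.N₀ G.N₁} (h : Relation.ReflTransGen G.Step u v) :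
    Relation.ReflTransGen G.Step (C.fill u) (C.fill v) := by
  induction C with
  | hole => exact h
  | node f i ts c ih =>
    refine steps_term fun j => ?_
    split_ifs
    exacts [ih, .refl]

theorem Derives.steps {n : ℕ} {s : SForm Δ G.N₀ G.N₁} {o : RTree Δ ⊕ Ctx Δ}
    (h : G.Derives n s o) (u : SForm Δ G.N₀ G.N₁) :
    Relation.ReflTransGen G.Step (s.subst u) (o.elim RTree.toSForm fun C => C.fill u) := by
  induction h generalizing u with
  | term _ f ts us _ ih => exact steps_term fun i => ih i u
  | nt0 _ A r t hr _ ih =>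
    have hrt := ih .var
    rw [SForm.subst_var] at hrt
    exact hrt.head (Step.rule₀ A r hr)
  | nt1 _ B r s C t hr _ _ ih ih' =>
    refine Relation.ReflTransGen.head (Step.rule₁ B r _ hr) ((ih _).trans ?_)
    simp only [Sum.elim_inr, Sum.elim_inl, ← Ctx.fill_toSForm]
    exact steps_fill C (ih' u)
  | nt1Const _ B r s t hr _ ih => exact (ih _).head (Step.rule₁ B r _ hr)
  | var _ => exact .refl
  | termCtx _ f ts us i C _ _ ih ih' =>
    refine steps_term fun j => ?_
    split_ifs with hj
    exacts [hj ▸ ih u, ih' j hj u]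
  | nt1Ctx _ B r s C C' hr _ _ ih ih' =>
    refine Relation.ReflTransGen.head (Step.rule₁ B r _ hr) ((ih _).trans ?_)
    simp only [Sum.elim_inr, Ctx.fill_comp]
    exact steps_fill C (ih' u)

theorem derivable_toSForm (t : RTree Δ) : G.Derivable t.toSForm (.inl t) := by
  induction t with
  | node f ts ih => exact .term ih

theorem Derivable.of_subst {r : SForm Δ G.N₀ G.N₁} (hr : r.varCount ≤ 1)
    {s : SForm Δ G.N₀ G.N₁} {t : RTree Δ} (h : G.Derivable (r.subst s) (.inl t)) :
    G.Derivable r (.inl t) ∨ ∃ C t', G.Derivable r (.inr C) ∧ G.Derivable s (.inl t') ∧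
      t = C.plug t' := by
  induction r generalizing t with
  | var => exact .inr ⟨.hole, t, ⟨0, .var 0⟩, h, rfl⟩
  | nt0 A => exact .inl h
  | nt1 B r ih =>
    obtain ⟨q, hq, hqt | ⟨C, t', hqC, ht', rfl⟩⟩ := h.exists_rule_of_nt1
    · exact .inl (.nt1Const hq hqt)
    rcases ih hr ht' with hr' | ⟨C', t'', hC', ht'', rfl⟩
    · exact .inl (.nt1 hq hqC hr')
    · exact .inr ⟨C.comp C', t'', .nt1Ctx hq hqC hC', ht'', (C.plug_comp C' t'').symm⟩
  | term f ts ih =>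
    rcases Nat.le_one_iff_eq_zero_or_eq_one.1 hr with hzero | hone
    · rw [SForm.subst_of_varCount_eq_zero hzero] at h
      exact .inl h
    obtain ⟨i, hi, hother⟩ := exists_eq_one_of_sum_eq_one hone
    obtain ⟨us, rfl, hus⟩ := h.exists_node_of_term
    have hus' (j) (hj : j ≠ i) : G.Derivable (ts j) (.inl (us j)) := by
      have := hus j
      rwa [SForm.subst_of_varCount_eq_zero (hother j hj)] at this
    rcases ih i hi.le (hus i) with hti | ⟨C, t', hC, ht', hplug⟩
    · exact .inl (.term fun j => if hj : j = i then hj ▸ hti else hus' j hj)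
    · refine .inr ⟨.branch f us i C, t', .termCtx hC hus', ht', ?_⟩
      rw [Ctx.plug_branch, ← hplug, Function.update_eq_self]

theorem Derivable.of_step {s s' : SForm Δ G.N₀ G.N₁} (hs : G.Step s s') {t : RTree Δ}
    (h : G.Derivable s' (.inl t)) : G.Derivable s (.inl t) := by
  induction hs generalizing t with
  | rule₀ A r hr => exact .nt0 hr h
  | rule₁ B r s hr =>
    rcases Derivable.of_subst (G.linear₁ _ hr) h with hrt | ⟨C, t', hC, ht', rfl⟩
    · exact .nt1Const hr hrt
    · exact .nt1 hr hC ht'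
  | inTerm f ts i u _ ih =>
    obtain ⟨us, rfl, hus⟩ := h.exists_node_of_term
    rw [Function.forall_update_iff ts fun j s => G.Derivable s (.inl (us j))] at hus
    exact .term fun j => if hj : j = i then hj ▸ ih hus.1 else hus.2 j hj
  | inNt1 B s u _ ih =>
    obtain ⟨r, hr, hrt | ⟨C, t', hC, ht', rfl⟩⟩ := h.exists_rule_of_nt1
    · exact .nt1Const hr hrt
    · exact .nt1 hr hC (ih ht')

theorem mem_language_iff {t : RTree Δ} :
    t ∈ G.language ↔ G.Derivable (.nt0 G.start) (.inl t) := by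
  constructor
  · intro h
    exact Relation.ReflTransGen.head_induction_on
      (motive := fun s _ => G.Derivable s (.inl t)) h (derivable_toSForm t)
      fun hs _ ih => ih.of_step hs
  · rintro ⟨n, h⟩
    exact h.steps .var

/-! ### Paths in derivation trees -/

variable (G) in
/-- The object `o'` is derived from `s'` inside a derivation of `o` from `s`, and may be exchanged
there for every other object of its kind that is derived from `s'`. -/
def Inside (s s' : SForm Δ G.N₀ G.N₁) : RTree Δ ⊕ Ctx Δ → RTree Δ ⊕ Ctx Δ → Prop
  | .inl t, .inl t' => ∃ D : Ctx Δ, t = D.plug t' ∧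
      ∀ u, G.Derivable s' (.inl u) → G.Derivable s (.inl (D.plug u))
  | .inl t, .inr C => ∃ (D : Ctx Δ) (v : RTree Δ), t = D.plug (C.plug v) ∧
      ∀ C', G.Derivable s' (.inr C') → G.Derivable s (.inl (D.plug (C'.plug v)))
  | .inr C, .inl t => ∃ K : Fork Δ, C = K.fillRight t ∧
      ∀ u, G.Derivable s' (.inl u) → G.Derivable s (.inr (K.fillRight u))
  | .inr C, .inr C' => ∃ D E : Ctx Δ, C = D.comp (C'.comp E) ∧
      ∀ C'', G.Derivable s' (.inr C'') → G.Derivable s (.inr (D.comp (C''.comp E)))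

namespace Inside

section Basic

variable {s s' s'' : SForm Δ G.N₀ G.N₁}

theorem refl (s : SForm Δ G.N₀ G.N₁) (o : RTree Δ ⊕ Ctx Δ) : G.Inside s s o o := by
  rcases o with t | C
  · exact ⟨.hole, rfl, fun _ h => h⟩
  · exact ⟨.hole, .hole, (Ctx.comp_hole C).symm, fun C' h => (Ctx.comp_hole C').symm ▸ h⟩

theorem trans_tree {t : RTree Δ} {o' o'' : RTree Δ ⊕ Ctx Δ} (h : G.Inside s s' (.inl t) o')
    (h' : G.Inside s' s'' o' o'') : G.Inside s s'' (.inl t) o'' := by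
  rcases o' with t' | C' <;> rcases o'' with t'' | C''
  · obtain ⟨D, rfl, hD⟩ := h
    obtain ⟨E, rfl, hE⟩ := h'
    exact ⟨D.comp E, (D.plug_comp E _).symm, fun u hu => (D.plug_comp E u).symm ▸ hD _ (hE _ hu)⟩
  · obtain ⟨D, rfl, hD⟩ := h
    obtain ⟨E, v, rfl, hE⟩ := h'
    exact ⟨D.comp E, v, (D.plug_comp E _).symm,
      fun u hu => (D.plug_comp E _).symm ▸ hD _ (hE _ hu)⟩
  · obtain ⟨D, v, rfl, hD⟩ := h
    obtain ⟨K, rfl, hK⟩ := h'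
    refine ⟨D.comp (K.fillLeft v), ?_, fun u hu => ?_⟩ <;>
      rw [Ctx.plug_comp, ← Fork.plug_fillRight]
    exact hD _ (hK u hu)
  · obtain ⟨D, v, rfl, hD⟩ := h
    obtain ⟨E, E', rfl, hE⟩ := h'
    refine ⟨D.comp E, E'.plug v, by simp only [Ctx.plug_comp], fun u hu => ?_⟩
    simpa only [Ctx.plug_comp] using hD _ (hE u hu)

theorem trans_ctx {C C' C'' : Ctx Δ} (h : G.Inside s s' (.inr C) (.inr C'))
    (h' : G.Inside s' s'' (.inr C') (.inr C'')) : G.Inside s s'' (.inr C) (.inr C'') := by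
  obtain ⟨D, E, rfl, hD⟩ := h
  obtain ⟨D', E', rfl, hD'⟩ := h'
  refine ⟨D.comp D', E'.comp E, by simp only [Ctx.comp_assoc], fun u hu => ?_⟩
  simpa only [Ctx.comp_assoc] using hD _ (hD' u hu)

end Basic

section Children

variable {f : Δ.Sym} {ts : Fin (Δ.rank f) → SForm Δ G.N₀ G.N₁} {us : Fin (Δ.rank f) → RTree Δ}
  {i j : Fin (Δ.rank f)} {A : G.N₀} {B : G.N₁} {r s : SForm Δ G.N₀ G.N₁} {t : RTree Δ}
  {C C' : Ctx Δ}

theorem term (h : ∀ j, G.Derivable (ts j) (.inl (us j))) (i : Fin (Δ.rank f)) :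
    G.Inside (.term f ts) (ts i) (.inl (.node f us)) (.inl (us i)) := by
  refine ⟨.branch f us i .hole, ?_, fun u hu => ?_⟩ <;> rw [Ctx.plug_branch, Ctx.plug]
  · rw [Function.update_eq_self]
  · exact .term ((Function.forall_update_iff us fun j u => G.Derivable (ts j) (.inl u)).2
      ⟨hu, fun j _ => h j⟩)

theorem nt0 (hr : (A, r) ∈ G.rules₀) : G.Inside (.nt0 A) r (.inl t) (.inl t) :=
  ⟨.hole, rfl, fun _ hu => .nt0 hr hu⟩

theorem nt1_rhs (hr : (B, r) ∈ G.rules₁) (h : G.Derivable s (.inl t)) :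
    G.Inside (.nt1 B s) r (.inl (C.plug t)) (.inr C) :=
  ⟨.hole, t, rfl, fun C' hC' => .nt1 (C := C') hr hC' h⟩

theorem nt1_arg (hr : (B, r) ∈ G.rules₁) (h : G.Derivable r (.inr C)) :
    G.Inside (.nt1 B s) s (.inl (C.plug t)) (.inl t) :=
  ⟨C, rfl, fun _ hu => .nt1 hr h hu⟩

theorem nt1Const (hr : (B, r) ∈ G.rules₁) : G.Inside (.nt1 B s) r (.inl t) (.inl t) :=
  ⟨.hole, rfl, fun _ hu => .nt1Const hr hu⟩

theorem termCtx_hole (h : ∀ j ≠ i, G.Derivable (ts j) (.inl (us j))) :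
    G.Inside (.term f ts) (ts i) (.inr (.branch f us i C)) (.inr C) := by
  refine ⟨.branch f us i .hole, .hole, ?_, fun C' hC' => ?_⟩ <;>
    simp only [Ctx.branch, Ctx.comp, Ctx.comp_hole]
  exact .termCtx hC' h

theorem termCtx_of_ne (h : G.Derivable (ts i) (.inr C))
    (h' : ∀ j ≠ i, G.Derivable (ts j) (.inl (us j))) (hj : j ≠ i) :
    G.Inside (.term f ts) (ts j) (.inr (.branch f us i C)) (.inl (us j)) := by
  refine ⟨⟨.hole, f, us, i, j, C, .hole, hj.symm⟩, ?_, fun u hu => .termCtx h fun l hl => ?_⟩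
  · simp only [Fork.fillRight, Ctx.comp, Ctx.plug, Function.update_eq_self]
  · rcases eq_or_ne l j with rfl | hlj
    · simpa [Ctx.plug] using hu
    · simpa [hlj] using h' l hl

theorem nt1Ctx_rhs (hr : (B, r) ∈ G.rules₁) (h : G.Derivable s (.inr C')) :
    G.Inside (.nt1 B s) r (.inr (C.comp C')) (.inr C) :=
  ⟨.hole, C', rfl, fun C'' hC'' => .nt1Ctx (C := C'') hr hC'' h⟩

theorem nt1Ctx_arg (hr : (B, r) ∈ G.rules₁) (h : G.Derivable r (.inr C)) :
    G.Inside (.nt1 B s) s (.inr (C.comp C')) (.inr C') := by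
  refine ⟨C, .hole, ?_, fun C'' hC'' => ?_⟩ <;> rw [Ctx.comp_hole]
  exact .nt1Ctx hr h hC''

end Children

end Inside

variable (G) in
/-- The start symbol and the subforms of the right-hand sides: the finitely many forms that occur
in derivations from the start symbol. -/
def allForms : Set (SForm Δ G.N₀ G.N₁) :=
  insert (.nt0 G.start) ((⋃ r ∈ G.rules₀, r.2.subforms) ∪ ⋃ r ∈ G.rules₁, r.2.subforms)

variable (G) in
theorem finite_allForms : G.allForms.Finite :=
  ((G.finite_rules₀.biUnion fun r _ => r.2.finite_subforms).union
    (G.finite_rules₁.biUnion fun r _ => r.2.finite_subforms)).insert _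

theorem rhs₀_mem_allForms {A : G.N₀} {r : SForm Δ G.N₀ G.N₁} (h : (A, r) ∈ G.rules₀) :
    r ∈ G.allForms :=
  .inr (.inl (Set.mem_biUnion h r.self_mem_subforms))

theorem rhs₁_mem_allForms {B : G.N₁} {r : SForm Δ G.N₀ G.N₁} (h : (B, r) ∈ G.rules₁) :
    r ∈ G.allForms :=
  .inr (.inr (Set.mem_biUnion h r.self_mem_subforms))

theorem subforms_subset_allForms {s : SForm Δ G.N₀ G.N₁} (h : s ∈ G.allForms) :
    s.subforms ⊆ G.allForms := by
  rcases h with rfl | h | h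
  · exact Set.singleton_subset_iff.2 (.inl rfl)
  · obtain ⟨r, hr, h⟩ := Set.mem_iUnion₂.1 h
    exact fun u hu => .inr (.inl (Set.mem_biUnion hr (SForm.subforms_subset h hu)))
  · obtain ⟨r, hr, h⟩ := Set.mem_iUnion₂.1 h
    exact fun u hu => .inr (.inr (Set.mem_biUnion hr (SForm.subforms_subset h hu)))

theorem term_child_mem_allForms {f : Δ.Sym} {ts : Fin (Δ.rank f) → SForm Δ G.N₀ G.N₁}
    (h : SForm.term f ts ∈ G.allForms) (i : Fin (Δ.rank f)) : ts i ∈ G.allForms :=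
  subforms_subset_allForms h (.inr (Set.mem_iUnion.2 ⟨i, (ts i).self_mem_subforms⟩))

theorem nt1_child_mem_allForms {B : G.N₁} {s : SForm Δ G.N₀ G.N₁}
    (h : SForm.nt1 B s ∈ G.allForms) : s ∈ G.allForms :=
  subforms_subset_allForms h (.inr s.self_mem_subforms)

variable (G) in
/-- The least height of a derivation tree of `o` from `s` is `n + 1`. -/
def MinDerives (n : ℕ) (s : SForm Δ G.N₀ G.N₁) (o : RTree Δ ⊕ Ctx Δ) : Prop :=
  G.Derives (n + 1) s o ∧ ¬G.Derives n s o

theorem Derivable.exists_minDerives {s : SForm Δ G.N₀ G.N₁} {t : RTree Δ}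
    (h : G.Derivable s (.inl t)) : ∃ n, G.MinDerives n s (.inl t) := by
  classical
  obtain ⟨n, hn, hn'⟩ := Nat.exists_not_and_succ_of_not_zero_of_exists
    (p := fun n => G.Derives n s (.inl t)) nofun h
  exact ⟨n, hn', hn⟩

theorem MinDerives.exists_inside {n : ℕ} {s : SForm Δ G.N₀ G.N₁} {o : RTree Δ ⊕ Ctx Δ}
    (hs : s ∈ G.allForms) (h : G.MinDerives (n + 1) s o) :
    ∃ s' o', s' ∈ G.allForms ∧ G.MinDerives n s' o' ∧ G.Inside s s' o o' := by
  obtain ⟨h, hmin⟩ := h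
  by_contra! hcon
  have lower {s' o'} (hs' : s' ∈ G.allForms) (h' : G.Derives (n + 1) s' o')
      (hin : G.Inside s s' o o') : G.Derives n s' o' := by
    by_contra hn
    exact hcon s' o' hs' ⟨h', hn⟩ hin
  refine hmin ?_
  cases h with
  | term _ f ts us h =>
    exact .term _ _ _ _ fun i =>
      lower (term_child_mem_allForms hs i) (h i) (.term (fun j => (h j).derivable) i)
  | nt0 _ A r t hr h =>
    exact .nt0 _ _ _ _ hr (lower (rhs₀_mem_allForms hr) h (.nt0 hr))
  | nt1 _ B r s C t hr h h' =>
    exact .nt1 _ _ _ _ _ _ hr (lower (rhs₁_mem_allForms hr) h (.nt1_rhs hr h'.derivable))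
      (lower (nt1_child_mem_allForms hs) h' (.nt1_arg hr h.derivable))
  | nt1Const _ B r s t hr h =>
    exact .nt1Const _ _ _ _ _ hr (lower (rhs₁_mem_allForms hr) h (.nt1Const hr))
  | var => exact .var _
  | termCtx _ f ts us i C h h' =>
    exact .termCtx _ _ _ _ _ _
      (lower (term_child_mem_allForms hs i) h (.termCtx_hole fun j hj => (h' j hj).derivable))
      fun j hj => lower (term_child_mem_allForms hs j) (h' j hj)
        (.termCtx_of_ne h.derivable (fun j hj => (h' j hj).derivable) hj)
  | nt1Ctx _ B r s C C' hr h h' =>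
    exact .nt1Ctx _ _ _ _ _ _ hr (lower (rhs₁_mem_allForms hr) h (.nt1Ctx_rhs hr h'.derivable))
      (lower (nt1_child_mem_allForms hs) h' (.nt1Ctx_arg hr h.derivable))

variable (G) in
/-- `σ` and `ω` list the forms and the derived objects along a path of a derivation tree, from the
bottom to the top; the least height of a derivation increases by one at each step. -/
structure IsPath (N : ℕ) (σ : ℕ → SForm Δ G.N₀ G.N₁) (ω : ℕ → RTree Δ ⊕ Ctx Δ) : Prop where
  mem_allForms : ∀ i ≤ N, σ i ∈ G.allForms
  minDerives : ∀ i ≤ N, G.MinDerives i (σ i) (ω i)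
  inside : ∀ i < N, G.Inside (σ (i + 1)) (σ i) (ω (i + 1)) (ω i)

theorem MinDerives.exists_isPath {N : ℕ} {s : SForm Δ G.N₀ G.N₁} {o : RTree Δ ⊕ Ctx Δ}
    (hs : s ∈ G.allForms) (h : G.MinDerives N s o) :
    ∃ σ ω, σ N = s ∧ ω N = o ∧ G.IsPath N σ ω := by
  induction N generalizing s o with
  | zero =>
    refine ⟨fun _ => s, fun _ => o, rfl, rfl, fun _ _ => hs, fun i hi => ?_, nofun⟩
    rwa [Nat.le_zero.1 hi]
  | succ N ih =>
    obtain ⟨s', o', hs', h', hin⟩ := h.exists_inside hs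
    obtain ⟨σ, ω, rfl, rfl, hpath⟩ := ih hs' h'
    refine ⟨Function.update σ (N + 1) s, Function.update ω (N + 1) o, by simp, by simp,
      fun i hi => ?_, fun i hi => ?_, fun i hi => ?_⟩
    · rcases hi.eq_or_lt with rfl | hlt
      · simpa using hs
      · simpa [hlt.ne] using hpath.mem_allForms i (by omega)
    · rcases hi.eq_or_lt with rfl | hlt
      · simpa using h
      · simpa [hlt.ne] using hpath.minDerives i (by omega)
    · rcases (Nat.le_of_lt_succ hi).eq_or_lt with rfl | hlt
      · simpa using hin
      · simpa [hi.ne, hlt.ne] using hpath.inside i hlt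

namespace IsPath

variable {N : ℕ} {σ : ℕ → SForm Δ G.N₀ G.N₁} {ω : ℕ → RTree Δ ⊕ Ctx Δ} {i j : ℕ}

theorem inside_of_isLeft (h : G.IsPath N σ ω) (hj : j ≤ N) (hleft : (ω j).isLeft) (hij : i ≤ j) :
    G.Inside (σ j) (σ i) (ω j) (ω i) := by
  obtain ⟨t, ht⟩ := Sum.isLeft_iff.1 hleft
  induction hij using Nat.decreasingInduction with
  | self => exact .refl _ _
  | of_succ i hi ih =>
    rw [ht] at ih ⊢
    exact ih.trans_tree (h.inside i (by omega))

theorem inside_of_forall_isRight (h : G.IsPath N σ ω) (hj : j ≤ N) (hij : i ≤ j)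
    (hright : ∀ m, i ≤ m → m ≤ j → (ω m).isRight) : G.Inside (σ j) (σ i) (ω j) (ω i) := by
  induction hij using Nat.decreasingInduction with
  | self => exact .refl _ _
  | of_succ i hi ih =>
    obtain ⟨C, hC⟩ := Sum.isRight_iff.1 (hright i le_rfl (by omega))
    obtain ⟨C', hC'⟩ := Sum.isRight_iff.1 (hright (i + 1) (by omega) (by omega))
    obtain ⟨C'', hC''⟩ := Sum.isRight_iff.1 (hright j (by omega) le_rfl)
    have hstep := h.inside i (by omega)
    have hrest := ih fun m hm => hright m (by omega)
    rw [hC'] at hstep hrest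
    rw [hC] at hstep ⊢
    rw [hC''] at hrest ⊢
    exact hrest.trans_ctx hstep

theorem object_ne (h : G.IsPath N σ ω) (hij : i < j) (hj : j ≤ N) (hσ : σ i = σ j) : ω i ≠ ω j := by
  intro hω
  have hmin := h.minDerives i (by omega)
  rw [hσ, hω] at hmin
  exact (h.minDerives j hj).2 (hmin.1.mono hij)

end IsPath

end LMCFTG

/-! ### Repetitions along a path -/

section Repetition

variable {α : Type*} {S : Set α}

theorem exists_lt_map_eq (hS : S.Finite) {g : ℕ → α} (hg : ∀ i ≤ S.ncard, g i ∈ S) :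
    ∃ i j, i < j ∧ j ≤ S.ncard ∧ g i = g j := by
  obtain ⟨i, hi, j, hj, hij, heq⟩ := Set.exists_ne_map_eq_of_ncard_lt_of_maps_to
    (s := Set.Iic S.ncard) (t := S) (f := g) (by simp [Set.ncard_eq_toFinset_card'])
    (fun i hi => hg i hi) hS
  rcases hij.lt_or_gt with hlt | hlt
  exacts [⟨i, j, hlt, hj, heq⟩, ⟨j, i, hlt, hi, heq.symm⟩]

-- The indices form `S.ncard + 1` blocks of length `S.ncard + 1`. Two equal values are found in a
-- block without marked indices, or among the values at one marked index chosen in each block.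
theorem exists_repetition (hS : S.Finite) {f : ℕ → α} (marked : ℕ → Prop)
    (hf : ∀ i < (S.ncard + 1) * (S.ncard + 1), f i ∈ S) :
    ∃ i j, i < j ∧ j < (S.ncard + 1) * (S.ncard + 1) ∧ f i = f j ∧
      (marked i ∧ marked j ∨ ∀ m, i ≤ m → m ≤ j → ¬marked m) := by
  set K := S.ncard
  have hlt {b c : ℕ} (hb : b ≤ K) (hc : c ≤ K) : b * (K + 1) + c < (K + 1) * (K + 1) := by
    have := Nat.mul_le_mul_right (K + 1) hb
    rw [Nat.add_one_mul K]
    omega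
  by_cases hblock : ∃ b ≤ K, ∀ c ≤ K, ¬marked (b * (K + 1) + c)
  · obtain ⟨b, hb, hunmarked⟩ := hblock
    obtain ⟨c, c', hcc', hc', heq⟩ := exists_lt_map_eq hS (g := fun c => f (b * (K + 1) + c))
      fun c hc => hf _ (hlt hb hc)
    refine ⟨_, _, Nat.add_lt_add_left hcc' _, hlt hb hc', heq, .inr fun m hm hm' => ?_⟩
    have := hunmarked (m - b * (K + 1)) (by omega)
    rwa [Nat.add_sub_cancel' (by omega)] at this
  · push Not at hblock
    choose! c hc hmarked using hblock
    obtain ⟨b, b', hbb', hb', heq⟩ := exists_lt_map_eq hS (g := fun b => f (b * (K + 1) + c b))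
      fun b hb => hf _ (hlt hb (hc b hb))
    refine ⟨_, _, ?_, hlt hb' (hc b' hb'), heq,
      .inl ⟨hmarked b (hbb'.le.trans hb'), hmarked b' hb'⟩⟩
    have hnext := Nat.mul_le_mul_right (K + 1) (Nat.succ_le_of_lt hbb')
    have := hc b (hbb'.le.trans hb')
    rw [Nat.succ_mul] at hnext
    omega

end Repetition

namespace LMCFTG

variable {Δ : Signature} {G : LMCFTG Δ} {s : SForm Δ G.N₀ G.N₁} {t : RTree Δ} {p : ℕ}

theorem exists_isPumpingDecomposition_of_tree {u u' : RTree Δ}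
    (htop : G.Inside (.nt0 G.start) s (.inl t) (.inl u)) (hin : G.Inside s s (.inl u) (.inl u'))
    (hder : G.Derivable s (.inl u')) (hne : u' ≠ u) (hheight : u.height ≤ p) :
    ∃ C₁ C₂ C₃ C₄ t₅, IsPumpingDecomposition G.language p t C₁ C₂ C₃ C₄ t₅ := by
  obtain ⟨D₁, rfl, hD₁⟩ := htop
  obtain ⟨D₂, rfl, hD₂⟩ := hin
  have hpump (i : ℕ) : G.Derivable s (.inl ((pump D₂ .hole .hole i).plug u')) := by
    induction i with
    | zero => exact hder
    | succ i ih =>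
      rw [pump, Ctx.plug_comp, Ctx.comp_hole]
      exact hD₂ _ ih
  refine ⟨D₁, D₂, .hole, .hole, u', rfl, ?_, Nat.add_pos_left (Ctx.height_pos ?_) _,
    fun i => mem_language_iff.2 (hD₁ _ (hpump i))⟩
  · simp only [Ctx.comp_hole]
    exact (D₂.height_le_height_plug u').trans hheight
  · rintro rfl
    exact hne rfl

theorem exists_isPumpingDecomposition_of_ctx {C C' : Ctx Δ}
    (htop : G.Inside (.nt0 G.start) s (.inl t) (.inr C)) (hin : G.Inside s s (.inr C) (.inr C'))
    (hder : G.Derivable s (.inr C')) (hne : C' ≠ C) (hheight : C.height ≤ p) :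
    ∃ C₁ C₂ C₃ C₄ t₅, IsPumpingDecomposition G.language p t C₁ C₂ C₃ C₄ t₅ := by
  obtain ⟨D₁, v, rfl, hD₁⟩ := htop
  obtain ⟨D, E, rfl, hDE⟩ := hin
  have hpump (i : ℕ) : G.Derivable s (.inr (pump D C' E i)) := by
    induction i with
    | zero => exact hder
    | succ i ih => exact hDE _ ih
  refine ⟨D₁, D, C', E, v, by simp only [Ctx.plug_comp], hheight, ?_,
    fun i => mem_language_iff.2 (hD₁ _ (hpump i))⟩
  by_cases hD : D = .hole
  · refine Nat.add_pos_right _ (Ctx.height_pos ?_)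
    rintro rfl
    rw [hD, Ctx.comp_hole] at hne
    exact hne rfl
  · exact Nat.add_pos_left (Ctx.height_pos hD) _

variable (G) in
theorem exists_isPumpingHeight : ∃ p, IsPumpingHeight G.language p := by
  set M := (G.allForms.ncard + 1) * (G.allForms.ncard + 1) with hM
  refine ⟨2 ^ M, fun t ht hheight => ?_⟩
  obtain ⟨N, hN⟩ := (mem_language_iff.1 ht).exists_minDerives
  have hMN : M ≤ N := by
    by_contra! hlt
    exact (hN.1.mono hlt).height_lt.not_gt hheight
  obtain ⟨σ, ω, hσN, hωN, hpath⟩ := hN.exists_isPath (.inl rfl)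
  obtain ⟨i, j, hij, hjM, heq, hkind⟩ := exists_repetition G.finite_allForms
    (fun i => (ω i).isLeft) fun i hi => hpath.mem_allForms i (by omega)
  rw [← hM] at hjM
  have hne := hpath.object_ne hij (by omega) heq
  have hder : G.Derivable (σ j) (ω i) := heq ▸ (hpath.minDerives i (by omega)).1.derivable
  have hbound : objHeight (ω j) ≤ 2 ^ M :=
    (hpath.minDerives j (by omega)).1.height_lt.le.trans (Nat.pow_le_pow_right two_pos hjM)
  have htop := hpath.inside_of_isLeft le_rfl (by rw [hωN]; rfl) (show j ≤ N by omega)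
  rw [hσN, hωN] at htop
  rcases hkind with ⟨hi, hj⟩ | hctx
  · have hin := hpath.inside_of_isLeft (by omega) hj hij.le
    obtain ⟨u', hu'⟩ := Sum.isLeft_iff.1 hi
    obtain ⟨u, hu⟩ := Sum.isLeft_iff.1 hj
    rw [heq] at hin
    rw [hu, hu'] at hin hne
    rw [hu] at htop hbound
    exact exists_isPumpingDecomposition_of_tree htop hin (hu' ▸ hder) (by simpa using hne)
      hbound
  · simp only [Bool.not_eq_true, Sum.isLeft_eq_false] at hctx
    have hin := hpath.inside_of_forall_isRight (by omega) hij.le hctx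
    obtain ⟨C', hC'⟩ := Sum.isRight_iff.1 (hctx i le_rfl hij.le)
    obtain ⟨C, hC⟩ := Sum.isRight_iff.1 (hctx j hij.le le_rfl)
    rw [heq] at hin
    rw [hC, hC'] at hin hne
    rw [hC] at htop hbound
    exact exists_isPumpingDecomposition_of_ctx htop hin (hC' ▸ hder) (by simpa using hne)
      hbound

end LMCFTG

/-! ## Separations -/

section FiniteHeight

variable {Δ : Signature} [Finite Δ.Sym]

theorem RTree.finite_height_le (n : ℕ) : {t : RTree Δ | t.height ≤ n}.Finite := by
  induction n with
  | zero =>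
    refine Set.finite_empty.subset fun t ht => ?_
    cases t
    simp [RTree.height] at ht
  | succ n ih =>
    refine (Set.finite_iUnion fun f : Δ.Sym =>
      (Set.Finite.pi' fun _ : Fin (Δ.rank f) => ih).image (RTree.node f)).subset ?_
    rintro ⟨f, ts⟩ ht
    refine Set.mem_iUnion.2 ⟨f, ts, fun i => ?_, rfl⟩
    have hchild := Finset.le_sup (f := fun i => (ts i).height) (Finset.mem_univ i)
    simp only [Set.mem_ofPred_eq, RTree.height] at ht hchild ⊢
    omega

theorem Ctx.finite_height_le (n : ℕ) : {C : Ctx Δ | C.height ≤ n}.Finite := by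
  induction n with
  | zero =>
    refine (Set.finite_singleton Ctx.hole).subset fun C hC => ?_
    cases C with
    | hole => rfl
    | node f i ts c => simp [Ctx.height] at hC
  | succ n ih =>
    refine ((Set.finite_singleton Ctx.hole).union (Set.finite_iUnion fun f : Δ.Sym =>
      Set.finite_iUnion fun i : Fin (Δ.rank f) =>
      ((Set.Finite.pi' fun _ : {j // j ≠ i} => RTree.finite_height_le (Δ := Δ) n).prod ih).image
        fun P => Ctx.node f i (fun j hj => P.1 ⟨j, hj⟩) P.2)).subset ?_
    intro C hC
    cases C with
    | hole => exact .inl rfl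
    | node f i ts c =>
      have hchild (j : Fin (Δ.rank f)) :
          (if hj : j = i then c.height else (ts j hj).height) ≤ n := by
        have := Finset.le_sup (f := fun j => if hj : j = i then c.height else (ts j hj).height)
          (Finset.mem_univ j)
        simp only [Set.mem_ofPred_eq, Ctx.height] at hC
        omega
      refine .inr (Set.mem_iUnion.2 ⟨f, Set.mem_iUnion.2 ⟨i, ⟨fun j => ts j.1 j.2, c⟩,
        ⟨fun j => ?_, ?_⟩, rfl⟩⟩)
      · simpa [j.2] using hchild j.1
      · simpa using hchild i

theorem exists_isGenerationBound {k : ℕ} {L : Type} (yd : ProjYield Δ) (h : HRHom Δ k L) (p : ℕ) :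
    ∃ l, IsGenerationBound yd h p l := by
  obtain ⟨l, hl⟩ := ((Ctx.finite_height_le (Δ := Δ) p).image
    fun C => max (yd.ctx C).length (h.ctx C).size).bddAbove
  exact ⟨l, fun C hC => max_le_iff.1 (hl ⟨C, hC, rfl⟩)⟩

end FiniteHeight

theorem IsSeparated.exists_isMinimalSeparation {Δ : Signature} {yd : ProjYield Δ} {x y : Core}
    {l : ℕ} {t : RTree Δ} (hs : IsSeparated yd x y l t) :
    ∃ Dx D₀ ty, IsMinimalSeparation yd x y l t Dx D₀ ty := by
  obtain ⟨Dx, D₀, ty, hs⟩ := hs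
  obtain ⟨⟨Dx', D₀', ty'⟩, hs', hmin⟩ := exists_minimalFor_of_wellFoundedLT
    (fun d : Ctx Δ × Ctx Δ × RTree Δ => IsSeparation yd x y l t d.1 d.2.1 d.2.2)
    (fun d => d.2.1.height) ⟨(Dx, D₀, ty), hs⟩
  refine ⟨Dx', D₀', ty', hs', fun Dx'' D₀'' ty'' hs'' => ?_⟩
  exact (le_total _ _).elim id fun hle => hmin (j := (Dx'', D₀'', ty'')) hs'' hle

theorem ProjYield.notMem_of_count_ctx_eq_zero {Δ : Signature} (yd : ProjYield Δ) {D : Ctx Δ}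
    {τ : Token} (h : (yd.ctx D).count τ = 0) : τ ∉ yd.left D ∧ τ ∉ yd.right D := by
  rwa [List.count_eq_zero, ctx, List.mem_append, not_or] at h

theorem lemma7 (Δ : Signature) [Finite Δ.Sym] (Λ : Type) (k : ℕ)
    (G : LMCFTG Δ) (yd : ProjYield Δ) (h : HRHom Δ k (Token ⊕ Λ))
    (hcsd : rel G yd h ⊆ csdPairs k Λ) :
    (∃ p l₀ : ℕ, IsPumpingHeight G.language p ∧ IsGenerationBound yd h p l₀) ∧
    ∀ p l₀ : ℕ, IsPumpingHeight G.language p → IsGenerationBound yd h p l₀ →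
      ∀ x y : Core, (x, y) ∈ sepPairs → ∀ t ∈ G.language,
        (∀ (Dx D₀ : Ctx Δ) (ty : RTree Δ), IsSeparation yd x y l₀ t Dx D₀ ty →
          (h.tree (D₀.plug ty)).edgeCount (Sum.inl (Token.bar x)) ≤
            (yd.tree (D₀.plug ty)).count (Token.bar x) +
              (yd.tree t).count (Token.core x) * l₀) ∧
        (IsSeparated yd x y l₀ t →
          ∃ (Dx D₀ : Ctx Δ) (ty : RTree Δ), IsMinimalSeparation yd x y l₀ t Dx D₀ ty ∧
            ((yd.tree t).count (Token.bar y) : ℤ) -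
                ((yd.tree t).count (Token.core x) : ℤ) * (l₀ : ℤ) -
                (lastRun (Token.bar y) (yd.tree t) : ℤ) ≤
              ((h.tree (D₀.plug ty)).edgeCount (Sum.inl (Token.bar y)) : ℤ)) := by
  have hpair (t : RTree Δ) (ht : t ∈ G.language) : (yd.tree t, h.tree t) ∈ csdPairs k Λ :=
    hcsd ⟨t, ht, rfl⟩
  have hT (t : RTree Δ) (ht : t ∈ G.language) : yd.tree t ∈ csdStrings := (hpair t ht).1
  have hedge (z : Core) (t : RTree Δ) (ht : t ∈ G.language) :
      (h.tree t).edgeCount (.inl (.bar z)) = (yd.tree t).count (.bar z) := ((hpair t ht).2 z).2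
  refine ⟨?_, fun p l₀ hp hl₀ x y hxy t ht => ⟨?_, fun hs => ?_⟩⟩
  · obtain ⟨p, hp⟩ := G.exists_isPumpingHeight
    obtain ⟨l₀, hl₀⟩ := exists_isGenerationBound yd h p
    exact ⟨p, l₀, hp, hl₀⟩
  · rintro Dx D₀ ty ⟨rfl, hy, -, -⟩
    obtain ⟨hl, hr⟩ := yd.notMem_of_count_ctx_eq_zero hy
    exact edgeCount_tree_le_of_core_notMem hp hl₀ hT hxy (hedge x) ht hl hr
  · obtain ⟨Dx, D₀, ty, hmin⟩ := hs.exists_isMinimalSeparation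
    refine ⟨Dx, D₀, ty, hmin, ?_⟩
    obtain ⟨rfl, hy, -, -⟩ := hmin.1
    obtain ⟨hl, hr⟩ := yd.notMem_of_count_ctx_eq_zero hy
    have hctx := edgeCount_context_le_of_core_notMem hp hl₀ hT hxy (hedge y) ht hl hr
    rw [← hedge y _ ht, h.edgeCount_plug]
    zify at hctx
    push_cast
    linarith
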